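/- Let $-1<q<0$ and let $\kappa_0,\kappa_1,\kappa_2,\dots$ be complex numbers (normalising constants). Put $$h^{(N)}(x|z_1,\dots,z_N)=\frac{\kappa_N}{x}\Bigl(\prod_{j=1}^N(x-z_jq^{-1})-q^{-2N}\prod_{j=1}^N(x-z_jq)\Bigr),$$ which is a homogeneous polynomial of degree $N-1$ (zero for $N=0$). For $0\le n<l$, $N=n+l$, let $\Delta^{(nl)}(x_1,\dots,x_n|z_1,\dots,z_n|z_{n+1},\dots,z_N)$ be the polynomials with the following properties: $\Delta^{(nl)}$ is homogeneous of degree $\binom n2+nl-n$, antisymmetric in the $x_\mu$, symmetric in $z_1,\dots,z_n$ and symmetric in $z_{n+1},\dots,z_N$; $\Delta^{(0l)}=1$; and for $n\ge1$ $$\Delta^{(nl)}|_{z_N=z_nq^{-2}}=\prod_{\mu=1}^n(x_\mu-z_nq^{-1})\sum_{\nu=1}^n(-1)^{n+\nu}h^{(N-2)}(x_\nu|z_1,\dots,\widehat{z_n},\dots,z_{N-1})\,\Delta^{(n-1\,l-1)}(x_1,\dots,\widehat{x_\nu},\dots,x_n|z_1,\dots,z_{n-1}|z_{n+1},\dots,z_{N-1}).$$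 (Part of the claim is that such a family exists; the rest of the claim holds for every such family.) Let $V=\mathbb Cv_+\oplus\mathbb Cv_-$, and let $R(\zeta)\in\mathrm{End}(V\otimes V)$ fix $v_+\otimes v_+$ and $v_-\otimes v_-$ and have, on the span of $v_+\otimes v_-$, $v_-\otimes v_+$, diagonal entries $\frac{(1-\zeta^2)q}{1-q^2\zeta^2}$ and off-diagonal entries $\frac{(1-q^2)\zeta}{1-q^2\zeta^2}$. Write $z_j=\zeta_j^2$, and call $\zeta=(\zeta_1,\dots,\zeta_N)$ generic if all $\zeta_j\ne0$ and $z_i\ne z_j$, $z_i\ne q^2z_j$ for $i\ne j$. For a polynomial $D(x|z_1,\dots,z_n|z_{n+1},\dots,z_N)$ let $\langle D\rangle(x|\zeta)\in V^{\otimes N}$ denote, for generic $\zeta$, the vector in the span of the $v_{\varepsilon_1}\otimes\cdots\otimes v_{\varepsilon_N}$ with exactly $n$ signs $-$ that is determined by $$\langle D\rangle(x|\zeta)^{-\cdots-+\cdots+}=D(x|z_1,\dots,z_n|z_{n+1},\dots,z_N)\prod_{j=1}^n\zeta_j\prod_{j=1}^n\prod_{i=n+1}^N\frac1{z_i-z_jq^{-2}},$$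 $$P_{j\,j+1}\langle D\rangle(x|\dots,\zeta_{j+1},\zeta_j,\dots)=R_{j\,j+1}(\zeta_j/\zeta_{j+1})\langle D\rangle(x|\dots,\zeta_j,\zeta_{j+1},\dots)\qquad(1\le j<N).$$ Let $e_1$ act on $V^{\otimes N}$ by $\pi_\zeta(e_1)=\sum_{k=1}^Nt\otimes\cdots\otimes t\otimes E_k\otimes1\otimes\cdots\otimes1$, with $E_k$ in the $k$-th factor, $E_kv_+=0$, $E_kv_-=\zeta_kv_+$, $tv_\pm=q^{\pm1}v_\pm$. For a closed rectifiable curve $C=C(z_1,\dots,z_N)$ and a kernel $\Psi(x_1,\dots,x_n|\zeta)$ that is, as a function of $x$ on $C^n$, continuous and antisymmetric, write $A(x|z)\cong B(x|z)$ if $$\prod_{\mu=1}^n\oint_C\frac{dx_\mu}{2\pi i}\Psi(x|\zeta)A(x|z)=\prod_{\mu=1}^n\oint_C\frac{dx_\mu}{2\pi i}\Psi(x|\zeta)B(x|z).$$ **Proposition.** Let $1\le n<l$, $N=n+l$. The vector $\langle\Delta^{(nl)}\rangle$ exists, and there is a polynomial $\Delta^{(1)}_{(n-1\,l+1)}(x_1,\dots,x_n|z_1,\dots,z_{n-1}|z_n,\dots,z_N)$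 with $$\pi_\zeta(e_1)\langle\Delta^{(nl)}\rangle(x|\zeta)=\langle\Delta^{(1)}_{(n-1\,l+1)}\rangle(x|\zeta)$$ for generic $\zeta$. For every $\zeta\in\mathbb C^N$ and all $C$, $\Psi$ as above, $$\Delta^{(1)}_{(n-1\,l+1)}(x_1,\dots,x_n|z_1,\dots,z_{n-1}|z_n,\dots,z_N)\cong n\,\kappa_{l-n}\,(-1)^{l-n}q^{l+1}\bigl(1-q^{-2(l-n)}\bigr)\prod_{j=1}^{n-1}(x_n-z_jq^{-1})\;\Delta^{(n-1\,l+1)}(x_1,\dots,x_{n-1}|z_1,\dots,z_{n-1}|z_n,\dots,z_N).$$ In particular, when $h^{(N)}$ is normalised by $\kappa_N=N+2$ the constant is $n(l-n+2)(-1)^{l-n}q^{l+1}(1-q^{-2(l-n)})$. -/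

import Mathlib

open scoped BigOperators

noncomputable section

namespace XXZ

/-! ### The polynomials `Δ^{(nl)}` for `n < l` -/

/-- Polynomials in the three groups of variables `x_1, …, x_m`, `z_1, …, z_n` and
`z_{n+1}, …, z_{n+l}` (indexed by `Fin m`, `Fin n` and `Fin l`). -/
abbrev DPoly (m n l : ℕ) : Type := MvPolynomial (Fin m ⊕ Fin n ⊕ Fin l) ℂ

/-- The value `P (x | a | b)`. -/
def DPoly.val {m n l : ℕ} (P : DPoly m n l) (x : Fin m → ℂ) (a : Fin n → ℂ) (b : Fin l → ℂ) : ℂ :=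
  MvPolynomial.eval (Sum.elim x (Sum.elim a b)) P

/-- `h^{(N)}(x | z_1, …, z_N)
  = κ_N x⁻¹ (∏_j (x - z_j q⁻¹) - q^{-2N} ∏_j (x - z_j q))`.
The polynomial in the brackets has no constant term in `x`, so `Polynomial.divX` is the division
by `x`. The number `κ N` is a normalising constant. -/
def hFun (q : ℂ) (κ : ℕ → ℂ) {ι : Type} [Fintype ι] (x : ℂ) (z : ι → ℂ) : ℂ :=
  κ (Fintype.card ι) *
    ((∏ j, (Polynomial.X - Polynomial.C (z j * q⁻¹))
      - Polynomial.C ((q ^ (2 * Fintype.card ι))⁻¹)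
        * ∏ j, (Polynomial.X - Polynomial.C (z j * q))).divX).eval x

/-- The defining properties of the polynomials `Δ^{(nl)}`, `0 ≤ n < l` (so that the number of
variables `x` is `m = n`). Values of the family at `n ≥ l` are irrelevant. -/
structure IsDeltaFamily (q : ℂ) (κ : ℕ → ℂ) (Δ : (n l : ℕ) → DPoly n n l) : Prop where
  /-- homogeneous of degree `binom(n,2) + nl - n` -/
  homogeneous : ∀ n l, n < l → (Δ n l).IsHomogeneous (n.choose 2 + n * l - n)
  /-- antisymmetric in the variables `x` -/
  antisymm : ∀ n l, n < l → ∀ (σ : Equiv.Perm (Fin n)) (x a : Fin n → ℂ) (b : Fin l → ℂ),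
    (Δ n l).val (x ∘ σ) a b = ((Equiv.Perm.sign σ : ℤ) : ℂ) * (Δ n l).val x a b
  /-- symmetric in `z_1, …, z_n` -/
  symm_left : ∀ n l, n < l → ∀ (σ : Equiv.Perm (Fin n)) (x a : Fin n → ℂ) (b : Fin l → ℂ),
    (Δ n l).val x (a ∘ σ) b = (Δ n l).val x a b
  /-- symmetric in `z_{n+1}, …, z_{n+l}` -/
  symm_right : ∀ n l, n < l → ∀ (σ : Equiv.Perm (Fin l)) (x a : Fin n → ℂ) (b : Fin l → ℂ),
    (Δ n l).val x a (b ∘ σ) = (Δ n l).val x a b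
  /-- the recursion at `z_N = z_n q⁻²`, from `(n + 1, l + 1)` to `(n, l)` -/
  recursion : ∀ n l, n < l → ∀ (x a : Fin (n + 1) → ℂ) (b : Fin l → ℂ),
    (Δ (n + 1) (l + 1)).val x a (Fin.snoc b (a (Fin.last n) * (q ^ 2)⁻¹)) =
      (∏ μ, (x μ - a (Fin.last n) * q⁻¹)) *
        ∑ ν : Fin (n + 1), (-1) ^ (n + (ν : ℕ)) *
          hFun q κ (x ν) (Sum.elim (Fin.init a) b) *
          (Δ n l).val (fun i => x (ν.succAbove i)) (Fin.init a) b
  /-- the initial condition -/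
  initial : ∀ l, 0 < l → Δ 0 l = 1

/-! ### The space `V^{⊗N}`, the `R`-matrix and the action of `e_1`

A basis vector `v_{ε_1} ⊗ ⋯ ⊗ v_{ε_N}` is labelled by `ε : Fin N → Bool`, where `true` stands
for `+` and `false` for `-`; a vector is the family of its components. -/

abbrev Tens (N : ℕ) : Type := (Fin N → Bool) → ℂ

/-- The `R`-matrix: `R(ζ) v_ε ⊗ v_ε = v_ε ⊗ v_ε`, and on the span of `v_+ ⊗ v_-`, `v_- ⊗ v_+` the
diagonal entries are `(1 - ζ²) q / (1 - q² ζ²)`, the off-diagonal ones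
`(1 - q²) ζ / (1 - q² ζ²)`. -/
def Rmat (q ζ : ℂ) : Matrix (Bool × Bool) (Bool × Bool) ℂ := fun e e' =>
  if e.1 = e.2 then (if e' = e then 1 else 0)
  else if e' = e then (1 - ζ ^ 2) * q / (1 - q ^ 2 * ζ ^ 2)
  else if e' = (e.2, e.1) then (1 - q ^ 2) * ζ / (1 - q ^ 2 * ζ ^ 2)
  else 0

/-- `R_{ij}(ζ)`, acting on the tensor factors `i` and `j`. -/
def RAct (q ζ : ℂ) {N : ℕ} (i j : Fin N) (u : Tens N) : Tens N := fun ε =>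
  ∑ e : Bool × Bool, Rmat q ζ (ε i, ε j) e *
    u (Function.update (Function.update ε i e.1) j e.2)

/-- `P_{ij}`, the exchange of the tensor factors `i` and `j`. -/
def PAct {N : ℕ} (i j : Fin N) (u : Tens N) : Tens N := fun ε => u (ε ∘ Equiv.swap i j)

/-- `π_ζ(e_1) (v_+, v_-) = ζ (0, v_+)`; entry `(ε, ε')` is the coefficient of `v_ε` in the image
of `v_ε'`. -/
def e1Mat (ζ : ℂ) : Matrix Bool Bool ℂ := fun e e' => if e = true ∧ e' = false then ζ else 0

/-- `π_ζ(t_1) (v_+, v_-) = (q v_+, q⁻¹ v_-)`, the eigenvalue on `v_ε`. -/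
def t1Eig (q : ℂ) (e : Bool) : ℂ := if e = true then q else q⁻¹

/-- The action `π_{(ζ_1, …, ζ_N)}(e_1) = ∑_k t_1 ⊗ ⋯ ⊗ t_1 ⊗ π_{ζ_k}(e_1) ⊗ 1 ⊗ ⋯ ⊗ 1` on
`V^{⊗N}`, for the coproduct `e_1 ↦ e_1 ⊗ 1 + t_1 ⊗ e_1`, `t_1 ↦ t_1 ⊗ t_1`. -/
def e1Act (q : ℂ) {N : ℕ} (ζ : Fin N → ℂ) (u : Tens N) : Tens N := fun ε =>
  ∑ k : Fin N, (∏ i ∈ Finset.univ.filter (· < k), t1Eig q (ε i)) *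
    ∑ e : Bool, e1Mat (ζ k) (ε k) e * u (Function.update ε k e)

/-! ### The vector `⟨D⟩ (x | ζ)` -/

/-- The first `n` entries of an `N`-tuple, `N = n + l`. -/
def headPart {n l N : ℕ} (h : n + l = N) (z : Fin N → ℂ) : Fin n → ℂ :=
  fun j => z ⟨j, by omega⟩

/-- The last `l` entries of an `N`-tuple, `N = n + l`. -/
def tailPart {n l N : ℕ} (h : n + l = N) (z : Fin N → ℂ) : Fin l → ℂ :=
  fun i => z ⟨n + i, by omega⟩

/-- `z_j = ζ_j²`. -/
def sq {N : ℕ} (ζ : Fin N → ℂ) : Fin N → ℂ := fun j => ζ j ^ 2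

/-- The points at which the vectors `⟨D⟩ (x | ζ)` are considered: all `ζ_j` are non-zero, and
`z_i ≠ z_j`, `z_i ≠ q² z_j` for `i ≠ j`. -/
def Generic (q : ℂ) {N : ℕ} (ζ : Fin N → ℂ) : Prop :=
  (∀ i, ζ i ≠ 0) ∧ ∀ i j, i ≠ j → ζ i ^ 2 ≠ ζ j ^ 2 ∧ ζ i ^ 2 ≠ q ^ 2 * ζ j ^ 2

/-- `w (x | ζ)` is the vector `⟨D⟩ (x | ζ) ∈ V^{(nl)}`: the component `-⋯-+⋯+` (first `n` signs
`-`, last `l` signs `+`) is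
`D (x | z_1, …, z_n | z_{n+1}, …, z_N) ∏_{j ≤ n} ζ_j ∏_{j ≤ n < i} (z_i - z_j q⁻²)⁻¹`, and
`P_{j j+1} w (… ζ_{j+1}, ζ_j …) = R_{j j+1}(ζ_j / ζ_{j+1}) w (… ζ_j, ζ_{j+1} …)`. -/
structure IsBracket (q : ℂ) {m n l N : ℕ} (h : n + l = N)
    (D : (Fin m → ℂ) → (Fin n → ℂ) → (Fin l → ℂ) → ℂ)
    (w : (Fin m → ℂ) → (Fin N → ℂ) → Tens N) : Prop where
  weight : ∀ x ζ, Generic q ζ → ∀ ε : Fin N → Bool,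
    (Finset.univ.filter fun i => ε i = false).card ≠ n → w x ζ ε = 0
  extreme : ∀ x ζ, Generic q ζ →
    w x ζ (fun i => decide (n ≤ (i : ℕ))) =
      D x (headPart h (sq ζ)) (tailPart h (sq ζ)) *
        ∏ j : Fin n, (headPart h ζ j *
          ∏ i : Fin l, (tailPart h (sq ζ) i - headPart h (sq ζ) j * (q ^ 2)⁻¹)⁻¹)
  Rsymm : ∀ x ζ, Generic q ζ → ∀ i j : Fin N, (i : ℕ) + 1 = j →
    PAct i j (w x (ζ ∘ Equiv.swap i j)) = RAct q (ζ i / ζ j) i j (w x ζ)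

/-! ### The relation `≅` -/

/-- `∏_μ ∮_C dx_μ / (2πi) F(x_1, …, x_m)` for a closed curve `C` with parametrisation
`γ : [0, 1] → ℂ`. -/
def multiContour {m : ℕ} (γ : ℝ → ℂ) (F : (Fin m → ℂ) → ℂ) : ℂ :=
  ∫ t in Set.Icc (0 : Fin m → ℝ) 1,
    (∏ μ, deriv γ (t μ) / (2 * (Real.pi : ℂ) * Complex.I)) * F (fun μ => γ (t μ))

/-- A closed rectifiable curve (parametrised by a Lipschitz map). -/
def IsClosedCurve (γ : ℝ → ℂ) : Prop :=
  γ 0 = γ 1 ∧ ∃ K : NNReal, LipschitzOnWith K γ (Set.Icc 0 1)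

/-- At the point `ζ`, the path `C = C (z_1, …, z_N)` is a closed rectifiable curve and
`x ↦ Ψ (x | ζ)` is a continuous antisymmetric function of `x_1, …, x_m` on the path. -/
structure IsKernelAt {m N : ℕ} (C : (Fin N → ℂ) → ℝ → ℂ)
    (Ψ : (Fin m → ℂ) → (Fin N → ℂ) → ℂ) (ζ : Fin N → ℂ) : Prop where
  closedCurve : IsClosedCurve (C (sq ζ))
  continuousOn : ContinuousOn (fun x => Ψ x ζ) {x | ∀ μ, x μ ∈ C (sq ζ) '' Set.Icc 0 1}
  antisymm : ∀ (σ : Equiv.Perm (Fin m)) (x : Fin m → ℂ),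
    (∀ μ, x μ ∈ C (sq ζ) '' Set.Icc 0 1) →
      Ψ (x ∘ σ) ζ = ((Equiv.Perm.sign σ : ℤ) : ℂ) * Ψ x ζ

/-- `A (x | z) ≅ B (x | z)` at the point `ζ`: equal integrals against `Ψ` along `C`. -/
def CongAt {m N : ℕ} (C : (Fin N → ℂ) → ℝ → ℂ) (Ψ : (Fin m → ℂ) → (Fin N → ℂ) → ℂ)
    (ζ : Fin N → ℂ) (A B : (Fin m → ℂ) → (Fin N → ℂ) → ℂ) : Prop :=
  multiContour (C (sq ζ)) (fun x => Ψ x ζ * A x (sq ζ)) =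
    multiContour (C (sq ζ)) (fun x => Ψ x ζ * B x (sq ζ))

end XXZ

end

/-! Put k = n - 1 and d = l - n, and write a for the first k and b for the last l + 1 of the z_j.

The action of e_1 commutes with the exchange relation (`e1Act_exchange`), so for the image of ⟨Δ⟩
only the component with k leading signs - has to be computed. It is a combination of the components
of ⟨Δ⟩ with one further - at a moving site. These follow from the extreme component by solving
exchange relations (`IsBracket.moving_component`). Summing them up gives, apart from the normalising
factor of the bracket, q^{2l-k} ∑_m b_m ∏_j (b_m - a_j q⁻²) ∏_{i≠m} (b_i - b_m)⁻¹ Δ^{(k+1 l)}(x | a,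
b_m | b̂_m) (`IsBracket.e1Act_extreme`).

The heart is that this sum over m equals c ∑_ν (-1)^{k+ν} ∏_j (x_ν - a_j q⁻¹) Δ^{(k l+1)}(x̂_ν | a |
b) with c = κ_d (-1)^d q^{-d} (1 - q^{-2d}) (`altB_eq`). After multiplication by the Vandermonde
product of b, both sides are homogeneous polynomials of one degree, antisymmetric in x and in b. On
b_i = q⁻² a_j the recursion reduces both to the case k - 1, l - 1; the reductions remove two of the
x in opposite orders, which only costs a sign (`wedgeSum_wedgeSum_swap`). So the difference vanishes
on all hyperplanes x_μ = x_ν, b_i = b_j, b_i = q⁻² a_j. Their number exceeds the degree by k, which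
proves the identity by induction for k ≥ 1. For k = 0 the number equals the degree, so both sides
are multiples of the Vandermonde product, and the constant is found at x = 0 with b running through
q times the roots of unity (`altB_one`).

Against an antisymmetric kernel the k + 1 terms of the sum over ν have equal integrals, whence the
factor n (`multiContour_mul_wedgeSum`).

The family Δ exists as a determinant whose expansion along one row is the recursion
(`isDeltaFamily_deltaPoly`). The vector ⟨D⟩ exists as a sum of explicit weights that obey the
exchange relation and are triangular at the extreme component (`exists_isBracket`). -/

open scoped BigOperators

noncomputable section

namespace XXZ

/-! ### Homogeneous polynomial functions -/

/-- `F` is given by a homogeneous polynomial of degree `d`. -/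
def IsHomPoly {τ : Type} (d : ℕ) (F : (τ → ℂ) → ℂ) : Prop :=
  ∃ p : MvPolynomial τ ℂ, p.IsHomogeneous d ∧ ∀ v, MvPolynomial.eval v p = F v

namespace IsHomPoly

variable {τ τ' : Type} {d e : ℕ} {F G : (τ → ℂ) → ℂ}

theorem coord (i : τ) : IsHomPoly 1 fun v : τ → ℂ => v i :=
  ⟨MvPolynomial.X i, MvPolynomial.isHomogeneous_X _ _, fun v => by simp⟩

theorem const (c : ℂ) : IsHomPoly 0 fun _ : τ → ℂ => c :=
  ⟨MvPolynomial.C c, MvPolynomial.isHomogeneous_C _ _, fun v => by simp⟩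

theorem mul (hF : IsHomPoly d F) (hG : IsHomPoly e G) :
    IsHomPoly (d + e) fun v => F v * G v := by
  obtain ⟨p, hp, hp'⟩ := hF
  obtain ⟨r, hr, hr'⟩ := hG
  exact ⟨p * r, hp.mul hr, fun v => by simp [hp', hr']⟩

theorem const_mul (c : ℂ) (hF : IsHomPoly d F) : IsHomPoly d fun v => c * F v := by
  simpa using (const (τ := τ) c).mul hF

theorem add (hF : IsHomPoly d F) (hG : IsHomPoly d G) : IsHomPoly d fun v => F v + G v := by
  obtain ⟨p, hp, hp'⟩ := hF
  obtain ⟨r, hr, hr'⟩ := hG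
  exact ⟨p + r, hp.add hr, fun v => by simp [hp', hr']⟩

theorem sub (hF : IsHomPoly d F) (hG : IsHomPoly d G) : IsHomPoly d fun v => F v - G v := by
  obtain ⟨p, hp, hp'⟩ := hF
  obtain ⟨r, hr, hr'⟩ := hG
  exact ⟨p - r, hp.sub hr, fun v => by simp [hp', hr']⟩

theorem sum {ι : Type} (s : Finset ι) {f : ι → (τ → ℂ) → ℂ} (h : ∀ i ∈ s, IsHomPoly d (f i)) :
    IsHomPoly d fun v => ∑ i ∈ s, f i v := by
  classical
  induction s using Finset.induction_on with
  | empty => exact ⟨0, MvPolynomial.isHomogeneous_zero _ _ _, fun v => by simp⟩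
  | insert a s ha ih =>
    simp only [Finset.sum_insert ha]
    exact (h a (by simp)).add (ih fun i hi => h i (by simp [hi]))

theorem prod {ι : Type} (s : Finset ι) {n : ι → ℕ} {f : ι → (τ → ℂ) → ℂ}
    (h : ∀ i ∈ s, IsHomPoly (n i) (f i)) :
    IsHomPoly (∑ i ∈ s, n i) fun v => ∏ i ∈ s, f i v := by
  classical
  induction s using Finset.induction_on with
  | empty => simpa using const (τ := τ) 1
  | insert a s ha ih =>
    simp only [Finset.prod_insert ha, Finset.sum_insert ha]
    exact (h a (by simp)).mul (ih fun i hi => h i (by simp [hi]))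

theorem comp {F : (τ' → ℂ) → ℂ} (hF : IsHomPoly d F) (π : τ' → τ) :
    IsHomPoly d fun v => F (v ∘ π) := by
  obtain ⟨p, hp, hp'⟩ := hF
  exact ⟨MvPolynomial.rename π p, hp.rename_isHomogeneous,
    fun v => by rw [MvPolynomial.eval_rename, hp']⟩

end IsHomPoly

theorem eval_smul_of_isHomogeneous {τ : Type} {d : ℕ} {p : MvPolynomial τ ℂ}
    (hp : p.IsHomogeneous d) (t : ℂ) (v : τ → ℂ) :
    MvPolynomial.eval (t • v) p = t ^ d * MvPolynomial.eval v p := by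
  rw [MvPolynomial.eval_eq, MvPolynomial.eval_eq, Finset.mul_sum]
  refine Finset.sum_congr rfl fun m hm => ?_
  have hdeg : ∑ i ∈ m.support, m i = d := by
    have := hp (MvPolynomial.mem_support_iff.1 hm)
    simpa [Finsupp.weight_apply, Finsupp.sum] using this
  simp only [Pi.smul_apply, smul_eq_mul, mul_pow, Finset.prod_mul_distrib,
    Finset.prod_pow_eq_pow_sum, hdeg]
  ring

/-- Along the line t v the polynomial is ∑_j t^j p_j(v) with p_j its homogeneous components.
Agreement with t^d p(v) at infinitely many t kills every p_j with j ≠ d. -/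
theorem isHomogeneous_of_scaling {τ : Type} {d : ℕ} {p : MvPolynomial τ ℂ}
    (h : ∀ (t : ℂ) (v : τ → ℂ), t ≠ 0 →
      MvPolynomial.eval (t • v) p = t ^ d * MvPolynomial.eval v p) :
    p.IsHomogeneous d := by
  have hcomp : ∀ i, i ≠ d → MvPolynomial.homogeneousComponent i p = 0 := by
    intro i hi
    apply MvPolynomial.funext
    intro v
    have hsum : ∀ t : ℂ, MvPolynomial.eval (t • v) p =
        ∑ j ∈ Finset.range (p.totalDegree + 1),
          t ^ j * MvPolynomial.eval v (MvPolynomial.homogeneousComponent j p) := by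
      intro t
      conv_lhs => rw [← MvPolynomial.sum_homogeneousComponent p]
      rw [map_sum]
      refine Finset.sum_congr rfl fun j _ => ?_
      exact eval_smul_of_isHomogeneous (MvPolynomial.homogeneousComponent_isHomogeneous j p) t v
    set P : Polynomial ℂ := ∑ j ∈ Finset.range (p.totalDegree + 1),
        Polynomial.C (MvPolynomial.eval v (MvPolynomial.homogeneousComponent j p)) *
          Polynomial.X ^ j - Polynomial.C (MvPolynomial.eval v p) * Polynomial.X ^ d with hP
    have hP0 : P = 0 := by
      apply Polynomial.eq_zero_of_infinite_isRoot
      refine Set.Infinite.mono (s := {0}ᶜ) ?_ (Set.finite_singleton (0 : ℂ)).infinite_compl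
      intro t ht
      have := h t v ht
      rw [hsum] at this
      simp only [Set.mem_ofPred_eq, Polynomial.IsRoot, hP, Polynomial.eval_sub,
        Polynomial.eval_finsetSum, Polynomial.eval_mul, Polynomial.eval_C, Polynomial.eval_pow,
        Polynomial.eval_X]
      rw [sub_eq_zero, mul_comm _ (t ^ d), ← this]
      exact Finset.sum_congr rfl fun j _ => mul_comm _ _
    by_cases hlt : i < p.totalDegree + 1
    · have hc := congrArg (fun Q => Polynomial.coeff Q i) hP0
      simp only [hP, Polynomial.coeff_sub, Polynomial.finsetSum_coeff,
        Polynomial.coeff_C_mul, Polynomial.coeff_X_pow, if_neg hi, mul_zero, sub_zero,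
        Polynomial.coeff_zero, mul_ite, mul_one] at hc
      rw [Finset.sum_ite_eq, if_pos (Finset.mem_range.2 hlt)] at hc
      simpa using hc
    · rw [MvPolynomial.homogeneousComponent_eq_zero _ _ (by omega)]
  have : p = MvPolynomial.homogeneousComponent d p := by
    conv_lhs => rw [← MvPolynomial.sum_homogeneousComponent p]
    by_cases hd : d < p.totalDegree + 1
    · rw [Finset.sum_eq_single d (fun j _ hj => hcomp j hj)
        (fun h => absurd (Finset.mem_range.2 hd) h)]
    · rw [MvPolynomial.homogeneousComponent_eq_zero d p (by omega)]
      exact Finset.sum_eq_zero fun j hj => hcomp j (by have := Finset.mem_range.1 hj; omega)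
  rw [this]
  exact MvPolynomial.homogeneousComponent_isHomogeneous d p

/-! ### Vanishing on hyperplanes -/

section Hyperplanes

variable {τ : Type}

-- The substitution X_i ↦ c X_j is the identity modulo the linear form, and it sends p to a
-- polynomial that vanishes everywhere.
open MvPolynomial in
theorem linearForm_dvd [DecidableEq τ] {p : MvPolynomial τ ℂ} {i j : τ} (hij : i ≠ j) {c : ℂ}
    (h : ∀ v : τ → ℂ, v i = c * v j → eval v p = 0) :
    (X i - C c * X j : MvPolynomial τ ℂ) ∣ p := by
  set φ : MvPolynomial τ ℂ →ₐ[ℂ] MvPolynomial τ ℂ :=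
    aeval (Function.update X i (C c * X j)) with hφ
  have h0 : φ p = 0 := by
    apply MvPolynomial.funext
    intro v
    have hcomp : (aeval v : MvPolynomial τ ℂ →ₐ[ℂ] ℂ).comp φ =
        aeval (Function.update v i (c * v j)) := by
      apply MvPolynomial.algHom_ext
      intro k
      by_cases hk : k = i
      · subst hk; simp [hφ]
      · simp [hφ, hk]
    have := DFunLike.congr_fun hcomp p
    rw [AlgHom.comp_apply, aeval_eq_eval, aeval_eq_eval] at this
    refine Eq.trans this ?_
    rw [map_zero]
    exact h _ (by simp [hij.symm])
  have hker : ((Ideal.Quotient.mkₐ ℂ (Ideal.span {(X i - C c * X j : MvPolynomial τ ℂ)})).comp φ)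
      = Ideal.Quotient.mkₐ ℂ (Ideal.span {(X i - C c * X j : MvPolynomial τ ℂ)}) := by
    apply MvPolynomial.algHom_ext
    intro k
    simp only [AlgHom.comp_apply, hφ, aeval_X]
    by_cases hk : k = i
    · subst hk
      rw [Function.update_self]
      refine (Ideal.Quotient.eq.2 ?_).symm
      exact Ideal.mem_span_singleton_self _
    · rw [Function.update_of_ne hk]
  have := DFunLike.congr_fun hker p
  rw [AlgHom.comp_apply, h0, map_zero] at this
  exact Ideal.mem_span_singleton.1 (Ideal.Quotient.eq_zero_iff_mem.1 this.symm)

open MvPolynomial in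
theorem linearForm_ne_zero [DecidableEq τ] {i j : τ} (hij : i ≠ j) (c : ℂ) :
    (X i - C c * X j : MvPolynomial τ ℂ) ≠ 0 := by
  intro h
  have := congrArg (eval (Function.update (0 : τ → ℂ) i 1)) h
  simp [hij.symm] at this

open MvPolynomial in
theorem linearForm_isHomogeneous (i j : τ) (c : ℂ) :
    (X i - C c * X j : MvPolynomial τ ℂ).IsHomogeneous 1 := by
  refine (isHomogeneous_X _ _).sub ?_
  simpa using (isHomogeneous_C τ c).mul (isHomogeneous_X ℂ j)

open MvPolynomial in
theorem linearForm_irreducible [DecidableEq τ] {i j : τ} (hij : i ≠ j) (c : ℂ) :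
    Irreducible (X i - C c * X j : MvPolynomial τ ℂ) := by
  apply irreducible_of_totalDegree_eq_one
  · exact (linearForm_isHomogeneous i j c).totalDegree (linearForm_ne_zero hij c)
  · intro x hx
    have h1 : x ∣ coeff (Finsupp.single i 1) (X i - C c * X j : MvPolynomial τ ℂ) := hx _
    have h2 : coeff (Finsupp.single i 1) (X i - C c * X j : MvPolynomial τ ℂ) = 1 := by
      rw [coeff_sub, coeff_C_mul, coeff_X, coeff_X]
      simp [Finsupp.single_left_inj, hij.symm]
    rw [h2] at h1
    exact isUnit_of_dvd_one h1

/-- A polynomial vanishing on the hyperplanes `v i = c v j`, `(i, j) ∈ T`, is divisible by the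
product of their equations. -/
theorem prod_linearForm_dvd [DecidableEq τ] (T : Finset (τ × τ)) (c : τ × τ → ℂ)
    (hT : ∀ t ∈ T, t.1 ≠ t.2 ∧ t.swap ∉ T) (hc : ∀ t ∈ T, c t ≠ 0) {p : MvPolynomial τ ℂ}
    (h : ∀ t ∈ T, ∀ v : τ → ℂ, v t.1 = c t * v t.2 → MvPolynomial.eval v p = 0) :
    (∏ t ∈ T, (MvPolynomial.X t.1 - MvPolynomial.C (c t) * MvPolynomial.X t.2)) ∣ p := by
  apply Finset.prod_dvd_of_isRelPrime
  · intro s hs t ht hst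
    refine ((linearForm_irreducible (hT s hs).1 (c s)).isRelPrime_iff_not_dvd).2 ?_
    rintro ⟨r, hr⟩
    -- If one form divided another, its hyperplane would lie in the other one. Unit vectors refute
    -- this unless both pairs have the same entries, and then `t.swap ∉ T` forces the pairs to
    -- coincide.
    have key : ∀ v : τ → ℂ, v s.1 = c s * v s.2 → v t.1 = c t * v t.2 := by
      intro v hv
      have := congrArg (MvPolynomial.eval v) hr
      simp only [map_mul, map_sub, MvPolynomial.eval_X, MvPolynomial.eval_C, hv, sub_self,
        zero_mul] at this
      exact sub_eq_zero.1 this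
    by_cases h1 : t.1 = s.1 ∨ t.1 = s.2
    · by_cases h2 : t.2 = s.1 ∨ t.2 = s.2
      · have := (hT t ht).1
        rcases h1 with h1 | h1 <;> rcases h2 with h2 | h2
        · exact this (h1.trans h2.symm)
        · exact hst (Prod.ext h1.symm h2.symm)
        · exact (hT t ht).2 (by
            have : t.swap = s := Prod.ext h2 h1
            rwa [this])
        · exact this (h1.trans h2.symm)
      · push Not at h2
        have := key (Function.update 0 t.2 1) (by simp [h2.1.symm, h2.2.symm])
        simp [(hT t ht).1] at this
        exact hc t ht this.symm
    · push Not at h1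
      have := key (Function.update 0 t.1 1) (by simp [h1.1.symm, h1.2.symm])
      simp [(hT t ht).1.symm] at this
  · intro t ht
    exact linearForm_dvd (hT t ht).1 (h t ht)

theorem prod_linearForm_isHomogeneous (T : Finset (τ × τ)) (c : τ × τ → ℂ) :
    (∏ t ∈ T, (MvPolynomial.X t.1 - MvPolynomial.C (c t) * MvPolynomial.X t.2 :
      MvPolynomial τ ℂ)).IsHomogeneous T.card := by
  have := MvPolynomial.IsHomogeneous.prod T
    (fun t => (MvPolynomial.X t.1 - MvPolynomial.C (c t) * MvPolynomial.X t.2 :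
      MvPolynomial τ ℂ)) (fun _ => 1) fun t _ => linearForm_isHomogeneous t.1 t.2 (c t)
  simpa using this

/-- A homogeneous polynomial that vanishes on at least as many hyperplanes as its degree is a
constant multiple of the product of their equations (zero if there are more). -/
theorem IsHomPoly.eq_const_mul_prod [DecidableEq τ] {d : ℕ} {F : (τ → ℂ) → ℂ} (hF : IsHomPoly d F)
    (T : Finset (τ × τ)) (c : τ × τ → ℂ)
    (hT : ∀ t ∈ T, t.1 ≠ t.2 ∧ t.swap ∉ T) (hc : ∀ t ∈ T, c t ≠ 0)
    (h : ∀ t ∈ T, ∀ v : τ → ℂ, v t.1 = c t * v t.2 → F v = 0) (hd : d ≤ T.card) :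
    ∃ A : ℂ, (d < T.card → A = 0) ∧ ∀ v, F v = A * ∏ t ∈ T, (v t.1 - c t * v t.2) := by
  obtain ⟨p, hp, hpF⟩ := hF
  obtain ⟨r, hr⟩ := prod_linearForm_dvd T c hT hc (p := p)
    fun t ht v hv => by rw [hpF, h t ht v hv]
  by_cases hp0 : p = 0
  · refine ⟨0, fun _ => rfl, fun v => ?_⟩
    rw [← hpF, hp0]; simp
  set P := ∏ t ∈ T, (MvPolynomial.X t.1 - MvPolynomial.C (c t) * MvPolynomial.X t.2 :
      MvPolynomial τ ℂ) with hP
  have hP0 : P ≠ 0 := fun h0 => hp0 (by rw [hr, h0, zero_mul])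
  have hr0 : r ≠ 0 := fun h0 => hp0 (by rw [hr, h0, mul_zero])
  -- Degrees add over a domain: d ≤ |T| makes the quotient r constant, and d < |T| is impossible for
  -- p ≠ 0.
  have hdeg := MvPolynomial.totalDegree_mul_of_isDomain hP0 hr0
  rw [← hr, hp.totalDegree hp0, (prod_linearForm_isHomogeneous T c).totalDegree hP0] at hdeg
  have hr' : r.totalDegree = 0 := by omega
  rw [MvPolynomial.totalDegree_eq_zero_iff_eq_C] at hr'
  refine ⟨r.coeff 0, fun hlt => by omega, fun v => ?_⟩
  rw [← hpF, hr, map_mul, hr', hP, map_prod, mul_comm]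
  simp

theorem IsHomPoly.eq_zero_of_hyperplanes [DecidableEq τ] {d : ℕ} {F : (τ → ℂ) → ℂ} (hF : IsHomPoly d F)
    (T : Finset (τ × τ)) (c : τ × τ → ℂ)
    (hT : ∀ t ∈ T, t.1 ≠ t.2 ∧ t.swap ∉ T) (hc : ∀ t ∈ T, c t ≠ 0)
    (h : ∀ t ∈ T, ∀ v : τ → ℂ, v t.1 = c t * v t.2 → F v = 0) (hd : d < T.card) (v : τ → ℂ) :
    F v = 0 := by
  obtain ⟨A, hA, hAF⟩ := hF.eq_const_mul_prod T c hT hc h hd.le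
  rw [hAF, hA hd, zero_mul]

end Hyperplanes

/-! ### Antisymmetric sums -/

/-- The sign of a permutation as a complex number. -/
abbrev csign {n : ℕ} (σ : Equiv.Perm (Fin n)) : ℂ := ((Equiv.Perm.sign σ : ℤ) : ℂ)

theorem csign_mul {n : ℕ} (σ τ : Equiv.Perm (Fin n)) : csign (σ * τ) = csign σ * csign τ := by
  simp [csign]

theorem csign_mul_self {n : ℕ} (σ : Equiv.Perm (Fin n)) : csign σ * csign σ = 1 := by
  rcases Int.units_eq_one_or (Equiv.Perm.sign σ) with h | h <;> simp [csign, h]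

theorem csign_cycleRange_symm {n : ℕ} (i : Fin n) :
    csign (i.cycleRange.symm) = (-1) ^ (i : ℕ) := by
  simp [csign, Equiv.Perm.sign_symm, Fin.sign_cycleRange]

/-- `∑_ν (-1)^ν F(x_ν; x_0, …, x̂_ν, …, x_k)`. -/
def wedgeSum {α : Type} {k : ℕ} (F : α → (Fin k → α) → ℂ) (x : Fin (k + 1) → α) : ℂ :=
  ∑ ν : Fin (k + 1), (-1) ^ (ν : ℕ) * F (x ν) (x ∘ ν.succAbove)

theorem comp_cycleRange_symm_succ {α : Type} {k : ℕ} (x : Fin (k + 1) → α) (ν : Fin (k + 1)) :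
    (fun i : Fin k => x (ν.cycleRange.symm i.succ)) = x ∘ ν.succAbove := by
  funext i
  simp [Fin.cycleRange_symm_succ]

/-- Factor σ as the cycle that brings σ 0 to the front and a permutation of the other entries.
Antisymmetry of F absorbs the latter, so the k! permutations with a given σ 0 contribute equally.
The full alternation makes the antisymmetry of `wedgeSum` evident. -/
theorem sum_perm_eq_wedgeSum {α : Type} {k : ℕ} {F : α → (Fin k → α) → ℂ}
    (hF : ∀ t y (σ : Equiv.Perm (Fin k)), F t (y ∘ σ) = csign σ * F t y) (x : Fin (k + 1) → α) :
    ∑ σ : Equiv.Perm (Fin (k + 1)), csign σ * F (x (σ 0)) (fun i => x (σ i.succ)) =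
      (k.factorial : ℂ) * wedgeSum F x := by
  have key : ∀ σ : Equiv.Perm (Fin (k + 1)),
      csign σ * F (x (σ 0)) (fun i => x (σ i.succ)) =
        (-1) ^ ((σ 0 : Fin (k + 1)) : ℕ) * F (x (σ 0)) (x ∘ (σ 0).succAbove) := by
    intro σ
    set ν := σ 0 with hν
    set c : Equiv.Perm (Fin (k + 1)) := ν.cycleRange.symm with hc
    obtain ⟨⟨p, τ⟩, hpτ⟩ := Equiv.Perm.decomposeFin.symm.surjective (c⁻¹ * σ)
    have h0 : (c⁻¹ * σ) 0 = 0 := by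
      simp [hc, ← hν, Equiv.Perm.inv_def, Fin.cycleRange_self]
    have hp : p = 0 := by
      rw [← hpτ, Equiv.Perm.decomposeFin_symm_apply_zero] at h0; exact h0
    subst hp
    have hsucc : ∀ i : Fin k, σ i.succ = c (τ i).succ := by
      intro i
      have : (c⁻¹ * σ) i.succ = (τ i).succ := by
        rw [← hpτ]; simp [Equiv.Perm.decomposeFin_symm_apply_succ]
      rw [← this]; simp
    have hsign : csign σ = (-1) ^ (ν : ℕ) * csign τ := by
      have h1 : σ = c * Equiv.Perm.decomposeFin.symm (0, τ) := by rw [hpτ]; simp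
      rw [h1, csign_mul, hc, csign_cycleRange_symm]
      simp [csign, Equiv.Perm.decomposeFin.symm_sign]
    have harg : (fun i : Fin k => x (σ i.succ)) = (x ∘ ν.succAbove) ∘ τ := by
      funext i
      rw [hsucc i, hc, Fin.cycleRange_symm_succ]; rfl
    rw [harg, hF, hsign]
    linear_combination (-1) ^ (ν : ℕ) * F (x ν) (x ∘ ν.succAbove) * csign_mul_self τ
  rw [Finset.sum_congr rfl fun σ _ => key σ]
  rw [← Equiv.sum_comp Equiv.Perm.decomposeFin.symm]
  rw [Fintype.sum_prod_type]
  simp only [Equiv.Perm.decomposeFin_symm_apply_zero, Finset.sum_const, Finset.card_univ,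
    Fintype.card_perm, Fintype.card_fin, nsmul_eq_mul]
  rw [wedgeSum, Finset.mul_sum]

theorem wedgeSum_perm {α : Type} {k : ℕ} {F : α → (Fin k → α) → ℂ}
    (hF : ∀ t y (σ : Equiv.Perm (Fin k)), F t (y ∘ σ) = csign σ * F t y)
    (x : Fin (k + 1) → α) (ρ : Equiv.Perm (Fin (k + 1))) :
    wedgeSum F (x ∘ ρ) = csign ρ * wedgeSum F x := by
  have hk : (k.factorial : ℂ) ≠ 0 := by exact_mod_cast k.factorial_ne_zero
  apply mul_left_cancel₀ hk
  rw [← sum_perm_eq_wedgeSum hF, mul_left_comm, ← sum_perm_eq_wedgeSum hF, Finset.mul_sum]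
  rw [← Equiv.sum_comp (Equiv.mulLeft ρ) (fun σ => csign ρ * (csign σ * _))]
  refine Finset.sum_congr rfl fun σ _ => ?_
  simp only [Equiv.coe_mulLeft, csign_mul, Function.comp_apply, Equiv.Perm.coe_mul]
  linear_combination -(csign σ * F (x (ρ (σ 0))) fun i => x (ρ (σ i.succ))) * csign_mul_self ρ

theorem eq_zero_of_antisymm {α : Type} {n : ℕ} {F : (Fin n → α) → ℂ}
    (hF : ∀ (σ : Equiv.Perm (Fin n)) y, F (y ∘ σ) = csign σ * F y) {i j : Fin n} (hij : i ≠ j)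
    {y : Fin n → α} (hy : y i = y j) : F y = 0 := by
  have h1 : y ∘ Equiv.swap i j = y := by
    funext k
    simp only [Function.comp_apply, Equiv.swap_apply_def]
    split_ifs with h h' <;> simp_all
  have := hF (Equiv.swap i j) y
  rw [h1] at this
  simp [csign, Equiv.Perm.sign_swap hij] at this
  linear_combination this / 2

/-- Two entries are removed one after the other. The involution (i, j) ↦ (`i.succAbove j`,
`j.predAbove i`) exchanges the order of removal and reverses the sign. -/
theorem wedgeSum_wedgeSum_swap {α : Type} {k : ℕ} (g h : α → ℂ) (f : (Fin k → α) → ℂ)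
    (x : Fin (k + 2) → α) :
    wedgeSum (fun t y => g t * wedgeSum (fun s z => h s * f z) y) x =
      - wedgeSum (fun t y => h t * wedgeSum (fun s z => g s * f z) y) x := by
  simp only [wedgeSum, Finset.mul_sum]
  rw [← Finset.sum_neg_distrib]
  simp only [← Finset.sum_neg_distrib]
  rw [← Fintype.sum_prod_type', ← Fintype.sum_prod_type']
  let e : Fin (k + 2) × Fin (k + 1) → Fin (k + 2) × Fin (k + 1) :=
    fun p => (p.1.succAbove p.2, p.2.predAbove p.1)
  have he : Function.Involutive e := by
    rintro ⟨i, j⟩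
    simp [e, Fin.succAbove_succAbove_predAbove, Fin.predAbove_predAbove_succAbove]
  rw [← Equiv.sum_comp he.toPerm]
  refine Finset.sum_congr rfl fun p _ => ?_
  obtain ⟨i, j⟩ := p
  simp only [Function.Involutive.coe_toPerm, e, Function.comp_apply,
    Fin.succAbove_succAbove_predAbove]
  have hx : ((x ∘ (i.succAbove j).succAbove) ∘ (j.predAbove i).succAbove) =
      (x ∘ i.succAbove) ∘ j.succAbove := by
    funext t
    simp [Fin.succAbove_succAbove_succAbove_predAbove]
  rw [hx]
  have hs := Fin.neg_one_pow_succAbove_add_predAbove (R := ℂ) i j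
  rw [pow_add, pow_add] at hs
  linear_combination (g (x (i.succAbove j)) * (h (x i) * f ((x ∘ i.succAbove) ∘ j.succAbove))) * hs

/-! ### The Vandermonde product -/

/-- `∏_{i<j} (b_j - b_i)`. -/
def vand {l : ℕ} (b : Fin l → ℂ) : ℂ := ∏ i, ∏ j ∈ Finset.Ioi i, (b j - b i)

theorem vand_eq_det {l : ℕ} (b : Fin l → ℂ) : vand b = (Matrix.vandermonde b).det :=
  (Matrix.det_vandermonde b).symm

theorem vand_perm {l : ℕ} (b : Fin l → ℂ) (σ : Equiv.Perm (Fin l)) :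
    vand (b ∘ σ) = csign σ * vand b := by
  rw [vand_eq_det, vand_eq_det, ← Matrix.det_permute]
  rfl

theorem vand_ne_zero {l : ℕ} {b : Fin l → ℂ} (hb : Function.Injective b) : vand b ≠ 0 := by
  rw [vand_eq_det]; exact Matrix.det_vandermonde_ne_zero_iff.2 hb

theorem vand_cons {l : ℕ} (t : ℂ) (b : Fin l → ℂ) :
    vand (Fin.cons t b : Fin (l + 1) → ℂ) = (∏ i, (b i - t)) * vand b := by
  simp only [vand, Fin.prod_univ_succ, Fin.prod_Ioi_zero, Fin.prod_Ioi_succ, Fin.cons_succ,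
    Fin.cons_zero]

/-- A cycle of sign (-1)^m moves b_m to the front. -/
theorem vand_succAbove {l : ℕ} (b : Fin (l + 1) → ℂ) (m : Fin (l + 1)) :
    vand b = (-1) ^ (m : ℕ) * (∏ i, (b (m.succAbove i) - b m)) * vand (b ∘ m.succAbove) := by
  have h : b ∘ m.cycleRange.symm = (Fin.cons (b m) (b ∘ m.succAbove) : Fin (l + 1) → ℂ) := by
    funext i
    refine Fin.cases ?_ (fun i => ?_) i
    · simp
    · simp [Fin.cycleRange_symm_succ]
  have h2 := vand_perm b m.cycleRange.symm
  rw [h, vand_cons, csign_cycleRange_symm] at h2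
  have h3 : ((-1 : ℂ) ^ (m : ℕ)) * (-1) ^ (m : ℕ) = 1 := by
    rw [← mul_pow]; simp
  simp only [Function.comp_apply] at h2 ⊢
  rw [mul_assoc, h2, ← mul_assoc, h3, one_mul]

theorem vand_snoc {l : ℕ} (b : Fin l → ℂ) (t : ℂ) :
    vand (Fin.snoc b t : Fin (l + 1) → ℂ) = (∏ i, (t - b i)) * vand b := by
  have h := vand_succAbove (Fin.snoc b t : Fin (l + 1) → ℂ) (Fin.last l)
  have h1 : (Fin.snoc b t : Fin (l + 1) → ℂ) ∘ (Fin.last l).succAbove = b := by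
    funext i; simp
  rw [h1] at h
  rw [h]
  simp only [Fin.succAbove_last, Fin.snoc_castSucc, Fin.snoc_last, Fin.val_last]
  rw [← Fin.prod_const, ← Finset.prod_mul_distrib]
  congr 1
  exact Finset.prod_congr rfl fun i _ => by ring

theorem card_filter_fst_lt_snd (m : ℕ) :
    (Finset.univ.filter fun p : Fin m × Fin m => p.1 < p.2).card = m.choose 2 := by
  rw [Finset.card_filter, Fintype.sum_prod_type_right]
  have : ∀ j : Fin m, (∑ i : Fin m, if i < j then 1 else 0) = (j : ℕ) := by
    intro j
    rw [← Finset.card_filter, Finset.filter_gt_eq_Iio, Fin.card_Iio]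
  rw [Finset.sum_congr rfl fun j _ => this j, Fin.sum_univ_eq_sum_range (fun i => i),
    Finset.sum_range_id, Nat.choose_two_right]

theorem isHomPoly_vand {τ : Type} {l : ℕ} (π : Fin l → τ) :
    IsHomPoly (l.choose 2) fun v : τ → ℂ => vand (v ∘ π) := by
  have h : IsHomPoly (∑ i : Fin l, ∑ j ∈ Finset.Ioi i, 1) fun v : τ → ℂ => vand (v ∘ π) :=
    IsHomPoly.prod _ fun i _ => IsHomPoly.prod _ fun j _ =>
      (IsHomPoly.coord (π j)).sub (IsHomPoly.coord (π i))
  convert h using 1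
  rw [← card_filter_fst_lt_snd, Finset.card_filter, Fintype.sum_prod_type]
  refine Finset.sum_congr rfl fun i _ => ?_
  rw [← Finset.card_filter, Finset.filter_lt_eq_Ioi, Finset.card_eq_sum_ones]

/-! ### Polynomials in three groups of variables that vanish on hyperplanes -/

section ThreeGroups

variable {m n l d : ℕ}

/-- The function of all variables defined by a function of the three groups. -/
def joinVars (F : (Fin m → ℂ) → (Fin n → ℂ) → (Fin l → ℂ) → ℂ) :
    (Fin m ⊕ Fin n ⊕ Fin l → ℂ) → ℂ :=
  fun v => F (v ∘ Sum.inl) (v ∘ Sum.inr ∘ Sum.inl) (v ∘ Sum.inr ∘ Sum.inr)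

/-- The index pairs `(x_μ, x_ν)`, `(b_i, a_j)`, `(b_i, b_j)`. -/
def hyperplanePairs (m n l : ℕ) (B : Finset (Fin l × Fin l)) :
    Finset ((Fin m ⊕ Fin n ⊕ Fin l) × (Fin m ⊕ Fin n ⊕ Fin l)) :=
  ((Finset.univ.filter fun p : Fin m × Fin m => p.1 < p.2).image
      fun p => (Sum.inl p.1, Sum.inl p.2)) ∪
    ((Finset.univ : Finset (Fin l × Fin n)).image
      fun p => (Sum.inr (Sum.inr p.1), Sum.inr (Sum.inl p.2))) ∪
    B.image fun p => (Sum.inr (Sum.inr p.1), Sum.inr (Sum.inr p.2))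

/-- The coefficient `r` for the pairs `(b_i, a_j)`, `1` for the others. -/
def hyperplaneCoeff (m n l : ℕ) (r : ℂ) :
    (Fin m ⊕ Fin n ⊕ Fin l) × (Fin m ⊕ Fin n ⊕ Fin l) → ℂ
  | (_, Sum.inr (Sum.inl _)) => r
  | _ => 1

theorem card_hyperplanePairs (B : Finset (Fin l × Fin l)) :
    (hyperplanePairs m n l B).card = m.choose 2 + l * n + B.card := by
  rw [hyperplanePairs, Finset.card_union_of_disjoint, Finset.card_union_of_disjoint,
    Finset.card_image_of_injective, Finset.card_image_of_injective,
    Finset.card_image_of_injective, card_filter_fst_lt_snd]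
  · simp
  · rintro ⟨a, b⟩ ⟨a', b'⟩ h; simpa using h
  · rintro ⟨a, b⟩ ⟨a', b'⟩ h; simpa using h
  · rintro ⟨a, b⟩ ⟨a', b'⟩ h; simpa using h
  · rw [Finset.disjoint_left]; intro t h1 h2
    simp only [Finset.mem_image] at h1 h2
    obtain ⟨p, _, rfl⟩ := h1
    obtain ⟨p', _, h⟩ := h2
    simp at h
  · rw [Finset.disjoint_left]; intro t h1 h2
    simp only [Finset.mem_image, Finset.mem_union] at h1 h2
    obtain ⟨p', _, h⟩ := h2
    rcases h1 with ⟨p, _, rfl⟩ | ⟨p, _, rfl⟩ <;> simp at h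

theorem hyperplanePairs_ne {B : Finset (Fin l × Fin l)} (hB : ∀ p ∈ B, p.1 < p.2) :
    ∀ t ∈ hyperplanePairs m n l B, t.1 ≠ t.2 ∧ t.swap ∉ hyperplanePairs m n l B := by
  intro t ht
  simp only [hyperplanePairs, Finset.mem_image, Finset.mem_union, Finset.mem_filter,
    Finset.mem_univ, true_and, Prod.exists] at ht ⊢
  rcases ht with (⟨a, b, h, rfl⟩ | ⟨a, b, rfl⟩) | ⟨a, b, h, rfl⟩
  · simp only [ne_eq, Sum.inl.injEq, Prod.swap_prod_mk, Prod.mk.injEq]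
    refine ⟨h.ne, ?_⟩
    rintro ((⟨c, d, h', rfl, rfl⟩ | ⟨c, d, h', h''⟩) | ⟨c, d, _, h', h''⟩)
    · exact lt_asymm h h'
    · simp at h'
    · simp at h'
  · simp
  · have h := hB _ h
    simp only [ne_eq, Sum.inr.injEq, Prod.swap_prod_mk, Prod.mk.injEq]
    refine ⟨h.ne, ?_⟩
    rintro ((⟨c, d, h', h'', h'''⟩ | ⟨c, d, h', h''⟩) | ⟨c, d, hcd, rfl, rfl⟩)
    · simp at h''
    · simp at h''
    · exact lt_asymm h (hB _ hcd)

theorem hyperplaneCoeff_ne_zero {r : ℂ} (hr : r ≠ 0)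
    (t : (Fin m ⊕ Fin n ⊕ Fin l) × (Fin m ⊕ Fin n ⊕ Fin l)) : hyperplaneCoeff m n l r t ≠ 0 := by
  obtain ⟨s, t⟩ := t
  rcases t with t | t | t <;> simp [hyperplaneCoeff, hr]

theorem vanish_on_hyperplanePairs {F : (Fin m → ℂ) → (Fin n → ℂ) → (Fin l → ℂ) → ℂ} {r : ℂ}
    {B : Finset (Fin l × Fin l)} (hB : ∀ p ∈ B, p.1 < p.2)
    (hx : ∀ x a b μ ν, μ ≠ ν → x μ = x ν → F x a b = 0)
    (hab : ∀ x a b i j, b i = r * a j → F x a b = 0)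
    (hb : ∀ x a b, ∀ p ∈ B, p.1 ≠ p.2 → b p.1 = b p.2 → F x a b = 0) :
    ∀ t ∈ hyperplanePairs m n l B, ∀ v : Fin m ⊕ Fin n ⊕ Fin l → ℂ,
      v t.1 = hyperplaneCoeff m n l r t * v t.2 → joinVars F v = 0 := by
  intro t ht v hv
  simp only [hyperplanePairs, Finset.mem_image, Finset.mem_union, Finset.mem_filter,
    Finset.mem_univ, true_and, Prod.exists] at ht
  rcases ht with (⟨a, b, h, rfl⟩ | ⟨a, b, rfl⟩) | ⟨a, b, h, rfl⟩
  · exact hx _ _ _ a b h.ne (by simpa [hyperplaneCoeff] using hv)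
  · exact hab _ _ _ a b (by simpa [hyperplaneCoeff] using hv)
  · exact hb _ _ _ _ h (hB _ h).ne (by simpa [hyperplaneCoeff] using hv)

/-- The vanishing criterion behind every polynomial identity below. The set `B` is kept free: all
pairs for functions antisymmetric in b, the empty set for symmetric ones. -/
theorem eq_zero_of_vanish {F : (Fin m → ℂ) → (Fin n → ℂ) → (Fin l → ℂ) → ℂ}
    (hF : IsHomPoly d (joinVars F)) {r : ℂ} (hr : r ≠ 0)
    {B : Finset (Fin l × Fin l)} (hB : ∀ p ∈ B, p.1 < p.2)
    (hx : ∀ x a b μ ν, μ ≠ ν → x μ = x ν → F x a b = 0)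
    (hab : ∀ x a b i j, b i = r * a j → F x a b = 0)
    (hb : ∀ x a b, ∀ p ∈ B, p.1 ≠ p.2 → b p.1 = b p.2 → F x a b = 0)
    (hd : d < m.choose 2 + l * n + B.card) (x : Fin m → ℂ) (a : Fin n → ℂ) (b : Fin l → ℂ) :
    F x a b = 0 :=
  hF.eq_zero_of_hyperplanes (hyperplanePairs m n l B) (hyperplaneCoeff m n l r)
    (hyperplanePairs_ne hB) (fun t _ => hyperplaneCoeff_ne_zero hr t)
    (vanish_on_hyperplanePairs hB hx hab hb) (by rw [card_hyperplanePairs]; exact hd)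
    (Sum.elim x (Sum.elim a b))

/-- Without variables `a` and with at most one variable `x`, an antisymmetric function of `b` of
the degree of the Vandermonde product is a multiple of it. -/
theorem mul_vand_eq_of_antisymm_of_degree {F : (Fin 1 → ℂ) → (Fin 0 → ℂ) → (Fin l → ℂ) → ℂ}
    (hF : IsHomPoly (l.choose 2) (joinVars F))
    (hb : ∀ x a b (i j : Fin l), i ≠ j → b i = b j → F x a b = 0)
    (x x' : Fin 1 → ℂ) (a a' : Fin 0 → ℂ) (b b' : Fin l → ℂ) :
    F x a b * vand b' = F x' a' b' * vand b := by
  set B := Finset.univ.filter fun p : Fin l × Fin l => p.1 < p.2 with hBdef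
  have hB : ∀ p ∈ B, p.1 < p.2 := fun p hp => (Finset.mem_filter.1 hp).2
  have key : ∀ G : (Fin 1 → ℂ) → (Fin 0 → ℂ) → (Fin l → ℂ) → ℂ,
      IsHomPoly (l.choose 2) (joinVars G) →
      (∀ x a b (i j : Fin l), i ≠ j → b i = b j → G x a b = 0) →
      ∃ A : ℂ, ∀ x a b, G x a b = A * ∏ t ∈ hyperplanePairs 1 0 l B,
        ((Sum.elim 0 (Sum.elim 0 b) : Fin 1 ⊕ Fin 0 ⊕ Fin l → ℂ) t.1 -
          hyperplaneCoeff 1 0 l 1 t * (Sum.elim 0 (Sum.elim 0 b) : _ → ℂ) t.2) := by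
    intro G hG hGb
    obtain ⟨A, -, hA⟩ := hG.eq_const_mul_prod (hyperplanePairs 1 0 l B) (hyperplaneCoeff 1 0 l 1)
      (hyperplanePairs_ne hB) (fun t _ => hyperplaneCoeff_ne_zero one_ne_zero t)
      (vanish_on_hyperplanePairs hB
        (fun x a b μ ν h => absurd (Subsingleton.elim μ ν) h) (fun x a b i j => j.elim0)
        (fun x a b p _ => hGb x a b p.1 p.2))
      (by rw [card_hyperplanePairs, hBdef, card_filter_fst_lt_snd]; omega)
    refine ⟨A, fun x a b => (hA (Sum.elim x (Sum.elim a b))).trans ?_⟩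
    congr 1
    -- With one x and no a only the pairs (b_i, b_j) occur, so the product does not involve x.
    refine Finset.prod_congr rfl fun t ht => ?_
    simp only [hyperplanePairs, Finset.mem_image, Finset.mem_union, Finset.mem_filter,
      Finset.mem_univ, true_and, Prod.exists] at ht
    rcases ht with (⟨i, j, h, rfl⟩ | ⟨i, j, rfl⟩) | ⟨i, j, h, rfl⟩
    · exact absurd (Subsingleton.elim i j) h.ne
    · exact j.elim0
    · rfl
  obtain ⟨A, hA⟩ := key F hF hb
  obtain ⟨A', hA'⟩ := key (fun _ _ b => vand b) (isHomPoly_vand _)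
    fun _ _ b i j hij h => eq_zero_of_antisymm (fun σ y => vand_perm y σ) hij h
  rw [hA x a b, hA x' a' b', hA' x a b, hA' x a b']
  ring

end ThreeGroups

section

/-! ### The determinant formula for `Δ^{(nl)}` -/

open Polynomial

/-- The remainder acquires the same linear factor as the divisor, so its degree stays below the
degree of the divisor. This lets the recursion pass through the quotient in the rows. -/
theorem mul_X_sub_C_divByMonic_cancel {R : Type} [CommRing R] [Nontrivial R] (g : R[X]) {h : R[X]}
    (hh : h.Monic) (s : R) : (g * (X - C s)) /ₘ (h * (X - C s)) = g /ₘ h := by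
  refine (div_modByMonic_unique (g /ₘ h) ((g %ₘ h) * (X - C s)) (hh.mul (monic_X_sub_C s))
    ⟨?_, ?_⟩).1
  · conv_rhs => rw [← modByMonic_add_div g h]
    ring
  · rw [(monic_X_sub_C s).degree_mul, (monic_X_sub_C s).degree_mul]
    have := degree_modByMonic_lt g hh
    rw [degree_X_sub_C]
    by_cases h0 : g %ₘ h = 0
    · rw [h0, degree_zero, WithBot.bot_add, bot_lt_iff_ne_bot, degree_eq_natDegree hh.ne_zero]
      exact WithBot.coe_ne_bot
    · rw [degree_eq_natDegree h0, degree_eq_natDegree hh.ne_zero] at *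
      norm_cast at *
      omega

theorem add_divByMonic {R : Type} [CommRing R] (f g : R[X]) {h : R[X]} (hh : h.Monic) :
    (f + g) /ₘ h = f /ₘ h + g /ₘ h := by
  nontriviality R
  refine (div_modByMonic_unique (f /ₘ h + g /ₘ h) (f %ₘ h + g %ₘ h) hh ⟨?_, ?_⟩).1
  · conv_rhs => rw [← modByMonic_add_div f h, ← modByMonic_add_div g h]
    ring
  · exact (degree_add_le _ _).trans_lt
      (max_lt (degree_modByMonic_lt _ hh) (degree_modByMonic_lt _ hh))

theorem C_mul_divByMonic {R : Type} [CommRing R] (c : R) (f : R[X]) {h : R[X]} (hh : h.Monic) :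
    (C c * f) /ₘ h = C c * (f /ₘ h) := by
  nontriviality R
  refine (div_modByMonic_unique (C c * (f /ₘ h)) (C c * (f %ₘ h)) hh ⟨?_, ?_⟩).1
  · conv_rhs => rw [← modByMonic_add_div f h]
    ring
  · rw [← smul_eq_C_mul]
    exact (degree_smul_le _ _).trans_lt (degree_modByMonic_lt _ hh)

/-! ### The rows and the determinant over a commutative ring -/

section Determinant

variable {R : Type} [CommRing R] {n l : ℕ}

/-- `∏_j (X - r z_j)`. -/
def rootsPoly {ι : Type} [Fintype ι] (r : R) (z : ι → R) : R[X] := ∏ j, (X - C (z j * r))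

/-- The substitution `X ↦ c X`. -/
def dil (c : R) (f : R[X]) : R[X] := f.comp (C c * X)

theorem dil_add (c : R) (f g : R[X]) : dil c (f + g) = dil c f + dil c g := add_comp
theorem dil_sub (c : R) (f g : R[X]) : dil c (f - g) = dil c f - dil c g := sub_comp
theorem dil_mul (c : R) (f g : R[X]) : dil c (f * g) = dil c f * dil c g := mul_comp _ _ _
theorem dil_C (c a : R) : dil c (C a) = C a := C_comp
theorem dil_X (c : R) : dil c X = C c * X := X_comp
theorem dil_comm (c d : R) (f : R[X]) : dil c (dil d f) = dil d (dil c f) := by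
  simp only [dil, comp_assoc, mul_comp, C_comp, X_comp]
  congr 1
  ring

theorem eval_zero_dil (c : R) (f : R[X]) : (dil c f).eval 0 = f.eval 0 := by
  simp [dil, eval_comp]

theorem dil_rootsPoly {ι : Type} [Fintype ι] (c r : R) (z : ι → R) :
    dil c (rootsPoly r z) = ∏ j, (C c * X - C (z j * r)) := by
  simp [dil, rootsPoly, prod_comp, sub_comp]

theorem rootsPoly_monic {ι : Type} [Fintype ι] (r : R) (z : ι → R) : (rootsPoly r z).Monic :=
  monic_prod_of_monic _ _ fun _ _ => monic_X_sub_C _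

theorem rootsPoly_snoc (r : R) (z : Fin n → R) (t : R) :
    rootsPoly r (Fin.snoc z t : Fin (n + 1) → R) = rootsPoly r z * (X - C (t * r)) := by
  simp [rootsPoly, Fin.prod_univ_castSucc]

theorem rootsPoly_init (r : R) (z : Fin (n + 1) → R) :
    rootsPoly r z = rootsPoly r (Fin.init z) * (X - C (z (Fin.last n) * r)) := by
  simp [rootsPoly, Fin.prod_univ_castSucc, Fin.init]

theorem rootsPoly_perm {ι ι' : Type} [Fintype ι] [Fintype ι'] (r : R) (z : ι → R) (σ : ι' ≃ ι) :
    rootsPoly r (z ∘ σ) = rootsPoly r z := by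
  simp only [rootsPoly, Function.comp_apply]
  exact Equiv.prod_comp σ fun j => X - C (z j * r)

theorem rootsPoly_map {R' : Type} [CommRing R'] (φ : R →+* R') {ι : Type} [Fintype ι]
    (r : R) (z : ι → R) : (rootsPoly r z).map φ = rootsPoly (φ r) (φ ∘ z) := by
  simp [rootsPoly, Polynomial.map_prod]

/-- The polynomial `x A_f(x)`, where the rows of the determinant are the `A_f`, `f = X^k`;
here `r = q⁻¹`. -/
def rowNumerator (q r : R) (a : Fin n → R) (b : Fin l → R) (f : R[X]) : R[X] :=
  rootsPoly r a * (f * rootsPoly r b /ₘ rootsPoly (r ^ 3) a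
      - dil (r ^ 2) (f * rootsPoly r b /ₘ rootsPoly (r ^ 3) a))
    + C (q ^ (2 * n)) * (dil (r ^ 2) f - dil (r ^ 2) (dil (r ^ 2) f)) * dil (r ^ 2) (rootsPoly r b)

/-- The polynomial `A_f(x)`. -/
def rowPoly (q r : R) (a : Fin n → R) (b : Fin l → R) (f : R[X]) : R[X] :=
  (rowNumerator q r a b f).divX

theorem X_mul_rowPoly (q r : R) (a : Fin n → R) (b : Fin l → R) (f : R[X]) :
    X * rowPoly q r a b f = rowNumerator q r a b f := by
  have h : (rowNumerator q r a b f).coeff 0 = 0 := by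
    rw [coeff_zero_eq_eval_zero]
    simp [rowNumerator, eval_zero_dil]
  have := X_mul_divX_add (rowNumerator q r a b f)
  rw [h, C_0, add_zero] at this
  exact this

theorem rowNumerator_add (q r : R) (a : Fin n → R) (b : Fin l → R) (f g : R[X]) :
    rowNumerator q r a b (f + g) = rowNumerator q r a b f + rowNumerator q r a b g := by
  simp only [rowNumerator, add_mul, add_divByMonic _ _ (rootsPoly_monic _ _), dil_add]
  ring

theorem rowNumerator_C_mul (q r : R) (a : Fin n → R) (b : Fin l → R) (c : R) (f : R[X]) :
    rowNumerator q r a b (C c * f) = C c * rowNumerator q r a b f := by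
  have h : C c * f * rootsPoly r b /ₘ rootsPoly (r ^ 3) a =
      C c * (f * rootsPoly r b /ₘ rootsPoly (r ^ 3) a) := by
    rw [mul_assoc, C_mul_divByMonic _ _ (rootsPoly_monic _ _)]
  simp only [rowNumerator, h, dil_mul, dil_C]
  ring

theorem rowPoly_add (q r : R) (a : Fin n → R) (b : Fin l → R) (f g : R[X]) :
    rowPoly q r a b (f + g) = rowPoly q r a b f + rowPoly q r a b g := by
  rw [rowPoly, rowNumerator_add, divX_add]; rfl

theorem rowPoly_C_mul (q r : R) (a : Fin n → R) (b : Fin l → R) (c : R) (f : R[X]) :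
    rowPoly q r a b (C c * f) = C c * rowPoly q r a b f := by
  rw [rowPoly, rowNumerator_C_mul, divX_C_mul]; rfl

theorem rowPoly_sum (q r : R) (a : Fin n → R) (b : Fin l → R) {ι : Type} (s : Finset ι)
    (c : ι → R) (f : ι → R[X]) :
    rowPoly q r a b (∑ i ∈ s, C (c i) * f i) = ∑ i ∈ s, C (c i) * rowPoly q r a b (f i) := by
  classical
  induction s using Finset.induction_on with
  | empty =>
    have := rowPoly_C_mul q r a b 0 0
    simpa using this
  | insert i s hi ih => rw [Finset.sum_insert hi, Finset.sum_insert hi, rowPoly_add,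
      rowPoly_C_mul, ih]

/-- Division by a monic polynomial commutes with ring homomorphisms. Hence the determinant can be
formed over the polynomial ring and evaluated afterwards; in spite of the division it is a
polynomial in all variables. -/
theorem rowPoly_map {R' : Type} [CommRing R'] (φ : R →+* R') (q r : R) (a : Fin n → R)
    (b : Fin l → R) (f : R[X]) :
    (rowPoly q r a b f).map φ = rowPoly (φ q) (φ r) (φ ∘ a) (φ ∘ b) (f.map φ) := by
  have hd : ∀ g : R[X], (g.divX).map φ = (g.map φ).divX := by
    intro g; ext i; simp [coeff_divX]
  have hdil : ∀ (c : R) (g : R[X]), (dil c g).map φ = dil (φ c) (g.map φ) := by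
    intro c g; simp [dil, map_comp]
  rw [rowPoly, hd, rowPoly, rowNumerator, rowNumerator]
  simp only [Polynomial.map_add, Polynomial.map_mul, Polynomial.map_sub, hdil, rootsPoly_map,
    map_divByMonic φ (rootsPoly_monic _ _), map_C, RingHom.map_pow φ]

/-- The determinant of the `A_{X^k}(x_μ)`. -/
def rowDet (q r : R) (x : Fin n → R) (a : Fin n → R) (b : Fin l → R) : R :=
  (Matrix.of fun k μ : Fin n => (rowPoly q r a b (X ^ (k : ℕ))).eval (x μ)).det

theorem rowDet_map {R' : Type} [CommRing R'] (φ : R →+* R') (q r : R) (x a : Fin n → R)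
    (b : Fin l → R) : φ (rowDet q r x a b) = rowDet (φ q) (φ r) (φ ∘ x) (φ ∘ a) (φ ∘ b) := by
  rw [rowDet, RingHom.map_det, rowDet]
  congr 1
  ext k μ
  simp only [RingHom.mapMatrix_apply, Matrix.map_apply, Matrix.of_apply, Function.comp_apply]
  rw [← eval_map_apply, rowPoly_map, Polynomial.map_pow, map_X]

theorem rowDet_perm (q r : R) (x a : Fin n → R) (b : Fin l → R) (σ : Equiv.Perm (Fin n)) :
    rowDet q r (x ∘ σ) a b = ((Equiv.Perm.sign σ : ℤ) : R) * rowDet q r x a b := by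
  rw [rowDet, rowDet, ← Matrix.det_permute']
  rfl

theorem rowDet_perm_left (q r : R) (x a : Fin n → R) (b : Fin l → R) (σ : Equiv.Perm (Fin n)) :
    rowDet q r x (a ∘ σ) b = rowDet q r x a b := by
  simp only [rowDet, rowPoly, rowNumerator, rootsPoly_perm]

theorem rowDet_perm_right (q r : R) (x a : Fin n → R) (b : Fin l → R) (σ : Equiv.Perm (Fin l)) :
    rowDet q r x a (b ∘ σ) = rowDet q r x a b := by
  simp only [rowDet, rowPoly, rowNumerator, rootsPoly_perm]

end Determinant

/-! ### Recursion and homogeneity of the determinant over the complex numbers -/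

section Complex

variable {n l : ℕ} {q : ℂ}

theorem dil_rootsPoly_inv_sq (hq : q ≠ 0) {ι : Type} [Fintype ι] (z : ι → ℂ) :
    dil (q⁻¹ ^ 2) (rootsPoly q⁻¹ z) =
      C ((q ^ (2 * Fintype.card ι))⁻¹) * ∏ j, (X - C (z j * q)) := by
  rw [dil_rootsPoly]
  have : ∀ j, (C (q⁻¹ ^ 2) * X - C (z j * q⁻¹) : ℂ[X]) = C (q⁻¹ ^ 2) * (X - C (z j * q)) := by
    intro j
    rw [mul_sub, ← C_mul]
    congr 2
    field_simp
  rw [Finset.prod_congr rfl fun j _ => this j, Finset.prod_mul_distrib, Finset.prod_const,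
    Finset.card_univ, ← C_pow]
  congr 2
  rw [← pow_mul, inv_pow]

theorem dil_rootsPoly_inv_cube (hq : q ≠ 0) (a : Fin n → ℂ) :
    C (q ^ (2 * n)) * dil (q⁻¹ ^ 2) (rootsPoly (q⁻¹ ^ 3) a) = rootsPoly q⁻¹ a := by
  rw [dil_rootsPoly]
  have : ∀ j, (C (q⁻¹ ^ 2) * X - C (a j * q⁻¹ ^ 3) : ℂ[X]) = C (q⁻¹ ^ 2) * (X - C (a j * q⁻¹)) := by
    intro j
    rw [mul_sub, ← C_mul]
    congr 2
    ring
  rw [Finset.prod_congr rfl fun j _ => this j, Finset.prod_mul_distrib, Finset.prod_const,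
    Finset.card_univ, ← C_pow, ← mul_assoc, ← C_mul, Fintype.card_fin, rootsPoly]
  have : q ^ (2 * n) * (q⁻¹ ^ 2) ^ n = 1 := by
    rw [← pow_mul, ← mul_pow, mul_inv_cancel₀ hq, one_pow]
  rw [this, C_1, one_mul]

/-- The extra entry of b puts the factor X - a_n q⁻³ into the dividend, where it cancels against the
divisor. Both summands of `rowNumerator` then contain X - a_n q⁻¹: the first through `rootsPoly q⁻¹
a`, the second through the dilated b-polynomial, whose factor q⁻² adjusts the power q^{2n}. -/
theorem rowPoly_snoc (hq : q ≠ 0) (a : Fin (n + 1) → ℂ) (b : Fin l → ℂ) (f : ℂ[X]) :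
    rowPoly q q⁻¹ a (Fin.snoc b (a (Fin.last n) * (q ^ 2)⁻¹) : Fin (l + 1) → ℂ) f =
      (X - C (a (Fin.last n) * q⁻¹)) * rowPoly q q⁻¹ (Fin.init a) b f := by
  have hX : (X : ℂ[X]) ≠ 0 := X_ne_zero
  apply mul_left_cancel₀ hX
  rw [X_mul_rowPoly, mul_left_comm, X_mul_rowPoly]
  set s := a (Fin.last n) with hs
  have e1 : s * (q ^ 2)⁻¹ * q⁻¹ = s * q⁻¹ ^ 3 := by field_simp
  have hdil : dil (q⁻¹ ^ 2) (X - C (s * q⁻¹ ^ 3)) = C (q⁻¹ ^ 2) * (X - C (s * q⁻¹)) := by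
    rw [dil_sub, dil_X, dil_C, mul_sub, ← C_mul]
    congr 2
    ring
  have hc : (C (q ^ (2 * (n + 1))) * C (q⁻¹ ^ 2) : ℂ[X]) = C (q ^ (2 * n)) := by
    rw [← C_mul]
    congr 1
    field_simp
    ring
  rw [rowNumerator, rootsPoly_snoc, e1, rootsPoly_init (q⁻¹ ^ 3) a, rootsPoly_init q⁻¹ a, ← hs,
    ← mul_assoc f, mul_X_sub_C_divByMonic_cancel _ (rootsPoly_monic _ _), dil_mul, hdil,
    rowNumerator, ← hc]
  ring

/-- If f is the divisor itself, the quotient is the b-polynomial, and `dil_rootsPoly_inv_cube` makes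
the mixed terms of the two summands cancel. What is left is the bracket in h^{(N)}; the second
summand of `rowNumerator` is designed for this. -/
theorem rowNumerator_rootsPoly (hq : q ≠ 0) (a : Fin n → ℂ) (b : Fin l → ℂ) :
    rowNumerator q q⁻¹ a b (rootsPoly (q⁻¹ ^ 3) a) =
      rootsPoly q⁻¹ (Sum.elim a b) - dil (q⁻¹ ^ 2) (rootsPoly q⁻¹ (Sum.elim a b)) := by
  have h1 : rootsPoly q⁻¹ (Sum.elim a b) = rootsPoly q⁻¹ a * rootsPoly q⁻¹ b := by
    simp [rootsPoly, Fintype.prod_sum_type]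
  have h2 := dil_rootsPoly_inv_cube hq a
  have h3 : rootsPoly (q⁻¹ ^ 3) a * rootsPoly q⁻¹ b /ₘ rootsPoly (q⁻¹ ^ 3) a = rootsPoly q⁻¹ b :=
    mul_divByMonic_cancel_left _ (rootsPoly_monic _ _)
  rw [rowNumerator, h3, h1, dil_mul, ← h2]
  simp only [dil_mul, dil_C]
  ring

theorem hFun_eq (hq : q ≠ 0) (κ : ℕ → ℂ) (x : ℂ) (a : Fin n → ℂ) (b : Fin l → ℂ) :
    hFun q κ x (Sum.elim a b) =
      κ (n + l) * (rowPoly q q⁻¹ a b (rootsPoly (q⁻¹ ^ 3) a)).eval x := by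
  rw [rowPoly, rowNumerator_rootsPoly hq, dil_rootsPoly_inv_sq hq, hFun]
  simp only [Fintype.card_sum, Fintype.card_fin, rootsPoly]

/-- By `rowPoly_snoc` a factor x_μ - a_n q⁻¹ comes out of each column. In the remaining determinant
the row of X^n may be replaced by the row of S = ∏_j (X - a_j q⁻³) over the other a_j, because S is
monic of degree n. That row consists of the values of h without κ, and expanding along it gives the
recursion. -/
theorem rowDet_snoc (hq : q ≠ 0) (x a : Fin (n + 1) → ℂ) (b : Fin l → ℂ) :
    rowDet q q⁻¹ x a (Fin.snoc b (a (Fin.last n) * (q ^ 2)⁻¹) : Fin (l + 1) → ℂ) =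
      (∏ μ, (x μ - a (Fin.last n) * q⁻¹)) *
        ∑ ν : Fin (n + 1), (-1) ^ (n + (ν : ℕ)) *
          (rowPoly q q⁻¹ (Fin.init a) b (rootsPoly (q⁻¹ ^ 3) (Fin.init a))).eval (x ν) *
          rowDet q q⁻¹ (fun i => x (ν.succAbove i)) (Fin.init a) b := by
  set B : Matrix (Fin (n + 1)) (Fin (n + 1)) ℂ :=
    Matrix.of fun k μ => (rowPoly q q⁻¹ (Fin.init a) b (X ^ (k : ℕ))).eval (x μ) with hB
  have h1 : rowDet q q⁻¹ x a (Fin.snoc b (a (Fin.last n) * (q ^ 2)⁻¹) : Fin (l + 1) → ℂ) =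
      (∏ μ, (x μ - a (Fin.last n) * q⁻¹)) * B.det := by
    have hd := Matrix.det_mul_row (fun μ => x μ - a (Fin.last n) * q⁻¹) B
    rw [← hd]
    unfold rowDet
    refine congrArg Matrix.det ?_
    funext k μ
    simp only [Matrix.of_apply, hB, rowPoly_snoc hq, eval_mul, eval_sub, eval_X, eval_C]
  rw [h1]
  refine congrArg₂ (· * ·) rfl ?_
  set S := rootsPoly (q⁻¹ ^ 3) (Fin.init a) with hS
  have hSm : S.Monic := rootsPoly_monic _ _
  have hSd : S.natDegree = n := by
    rw [hS, rootsPoly, natDegree_prod_of_monic _ _ fun _ _ => monic_X_sub_C _]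
    simp only [natDegree_X_sub_C, Finset.sum_const, Finset.card_univ, Fintype.card_fin,
      smul_eq_mul, mul_one]
  have hSsum : S = ∑ k : Fin (n + 1), C (S.coeff k) * X ^ (k : ℕ) := by
    rw [Fin.sum_univ_eq_sum_range (fun k => C (S.coeff k) * X ^ k) (n + 1)]
    conv_lhs => rw [S.as_sum_range_C_mul_X_pow, hSd]
  have h2 := Matrix.det_updateRow_sum B (Fin.last n) (fun k => S.coeff k)
  have h3 : S.coeff ((Fin.last n : Fin (n + 1)) : ℕ) = 1 := by
    have := hSm.coeff_natDegree
    rwa [hSd] at this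
  rw [h3, one_smul] at h2
  rw [← h2, Matrix.det_succ_row _ (Fin.last n)]
  refine Finset.sum_congr rfl fun ν _ => ?_
  rw [Fin.val_last]
  refine congrArg₂ (· * ·) (congrArg₂ (· * ·) rfl ?_) ?_
  · rw [Matrix.updateRow_self]
    conv_rhs => rw [hSsum, rowPoly_sum, eval_finsetSum]
    simp [hB]
  · unfold rowDet
    refine congrArg Matrix.det ?_
    funext k μ
    simp [hB, Matrix.updateRow_ne, (Fin.castSucc_lt_last k).ne]

theorem dil_rootsPoly_smul (t r : ℂ) {ι : Type} [Fintype ι] (z : ι → ℂ) :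
    dil t (rootsPoly r (t • z)) = C (t ^ Fintype.card ι) * rootsPoly r z := by
  rw [dil_rootsPoly, rootsPoly, C_pow, ← Finset.card_univ, ← Finset.prod_const,
    ← Finset.prod_mul_distrib]
  refine Finset.prod_congr rfl fun j _ => ?_
  rw [mul_sub, ← C_mul, Pi.smul_apply, smul_eq_mul, mul_assoc]

/-- Degree count: l + k for the dividend, -n for the division, +n for the factor `rootsPoly r a`, -1
for the division by X. Uniqueness of division with remainder shows that the quotient scales
accordingly. -/
theorem dil_rowPoly_smul {t : ℂ} (ht : t ≠ 0) (r : ℂ) (a : Fin n → ℂ) (b : Fin l → ℂ)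
    (hl : 0 < l) (k : ℕ) :
    dil t (rowPoly q r (t • a) (t • b) (X ^ k)) =
      C (t ^ (l + k - 1)) * rowPoly q r a b (X ^ k) := by
  have hXk : dil t (X ^ k) = C (t ^ k) * X ^ k := by simp [dil, mul_pow]
  have hdeg : ∀ f : ℂ[X], (dil t f).degree = f.degree := by
    intro f
    by_cases hf : f = 0
    · simp [hf, dil]
    have h0 : (dil t f).natDegree = f.natDegree := by
      rw [dil, natDegree_comp, natDegree_C_mul_X t ht, mul_one]
    have hne : dil t f ≠ 0 := by
      intro h
      have h2 : dil t⁻¹ (dil t f) = f := by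
        simp [dil, comp_assoc, ← mul_assoc, ← C_mul, ht]
      rw [h] at h2
      exact hf (by rw [← h2]; simp [dil])
    rw [degree_eq_natDegree hf, degree_eq_natDegree hne, h0]
  set Q := X ^ k * rootsPoly r b /ₘ rootsPoly (r ^ 3) a with hQ
  set Q' := X ^ k * rootsPoly r (t • b) /ₘ rootsPoly (r ^ 3) (t • a) with hQ'
  have hQQ : C (t ^ n) * dil t Q' = C (t ^ (l + k)) * Q := by
    have h1 := modByMonic_add_div (X ^ k * rootsPoly r (t • b)) (rootsPoly (r ^ 3) (t • a))
    have h2 := congrArg (dil t) h1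
    rw [dil_add, dil_mul, dil_mul, dil_rootsPoly_smul, dil_rootsPoly_smul, hXk,
      Fintype.card_fin, Fintype.card_fin, ← hQ'] at h2
    have h3 : C (t ^ n) * dil t Q' = (C (t ^ (l + k)) * (X ^ k * rootsPoly r b)) /ₘ
        rootsPoly (r ^ 3) a := by
      refine ((div_modByMonic_unique _ (dil t (X ^ k * rootsPoly r (t • b) %ₘ
        rootsPoly (r ^ 3) (t • a))) (rootsPoly_monic _ _) ⟨?_, ?_⟩).1).symm
      · rw [pow_add, C_mul]
        linear_combination h2
      · rw [hdeg]
        refine (degree_modByMonic_lt _ (rootsPoly_monic _ _)).trans_eq ?_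
        rw [degree_eq_natDegree (rootsPoly_monic _ _).ne_zero,
          degree_eq_natDegree (rootsPoly_monic _ _).ne_zero, rootsPoly, rootsPoly,
          natDegree_prod_of_monic _ _ fun _ _ => monic_X_sub_C _,
          natDegree_prod_of_monic _ _ fun _ _ => monic_X_sub_C _]
        simp only [natDegree_X_sub_C]
    rw [h3, C_mul_divByMonic _ _ (rootsPoly_monic _ _)]
  have hQQ2 : C (t ^ n) * dil t (dil (r ^ 2) Q') = C (t ^ (l + k)) * dil (r ^ 2) Q := by
    have := congrArg (dil (r ^ 2)) hQQ
    rw [dil_mul, dil_mul, dil_C, dil_C] at this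
    rw [dil_comm, this]
  have hnum : dil t (rowNumerator q r (t • a) (t • b) (X ^ k)) =
      C (t ^ (l + k)) * rowNumerator q r a b (X ^ k) := by
    rw [rowNumerator, ← hQ', rowNumerator, ← hQ]
    simp only [dil_add, dil_mul, dil_sub, dil_C, dil_rootsPoly_smul, Fintype.card_fin]
    rw [dil_comm t (r ^ 2) (rootsPoly _ _), dil_rootsPoly_smul, dil_comm t (r ^ 2) (dil _ (X ^ k)),
      dil_comm t (r ^ 2) (X ^ k), hXk]
    simp only [dil_mul, dil_C, Fintype.card_fin]
    rw [mul_sub, add_comm l k, pow_add t k l, C_mul] at *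
    linear_combination rootsPoly r a * hQQ - rootsPoly r a * hQQ2
  have hX : (C t * X : ℂ[X]) ≠ 0 := mul_ne_zero (C_ne_zero.2 ht) X_ne_zero
  apply mul_left_cancel₀ hX
  rw [← X_mul_rowPoly, ← X_mul_rowPoly, dil_mul, dil_X] at hnum
  rw [hnum]
  obtain ⟨m, rfl⟩ : ∃ m, l = m + 1 := ⟨l - 1, by omega⟩
  have : m + 1 + k - 1 = m + k := by omega
  rw [this, show m + 1 + k = m + k + 1 by omega, pow_succ, C_mul]
  ring

theorem rowDet_smul {t : ℂ} (ht : t ≠ 0) (r : ℂ) (x a : Fin n → ℂ) (b : Fin l → ℂ) (hl : 0 < l) :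
    rowDet q r (t • x) (t • a) (t • b) = t ^ (n.choose 2 + n * l - n) * rowDet q r x a b := by
  have hexp : ∏ k : Fin n, t ^ (l + (k : ℕ) - 1) = t ^ (n.choose 2 + n * l - n) := by
    rw [Finset.prod_pow_eq_pow_sum]
    congr 1
    obtain ⟨m, rfl⟩ : ∃ m, l = m + 1 := ⟨l - 1, by omega⟩
    have : ∀ k : Fin n, m + 1 + (k : ℕ) - 1 = m + (k : ℕ) := fun k => by omega
    rw [Finset.sum_congr rfl fun k _ => this k, Finset.sum_add_distrib,
      Fin.sum_univ_eq_sum_range (fun i => i), Finset.sum_range_id, Nat.choose_two_right]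
    simp only [Finset.sum_const, Finset.card_univ, Fintype.card_fin, smul_eq_mul]
    rw [mul_add, mul_one]
    omega
  rw [← hexp, rowDet, rowDet, ← Matrix.det_mul_column]
  congr 1
  ext k μ
  simp only [Matrix.of_apply]
  have := congrArg (Polynomial.eval (x μ)) (dil_rowPoly_smul (q := q) ht r a b hl k)
  simpa [dil, eval_comp] using this

/-- The polynomials `Δ^{(nl)}`. -/
def deltaPoly (q : ℂ) (κ : ℕ → ℂ) (n l : ℕ) : DPoly n n l :=
  MvPolynomial.C (∏ i : Fin n, κ (l - n + 2 * (i : ℕ))) *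
    rowDet (MvPolynomial.C q) (MvPolynomial.C q⁻¹) (fun i => MvPolynomial.X (Sum.inl i))
      (fun i => MvPolynomial.X (Sum.inr (Sum.inl i)))
      (fun i => MvPolynomial.X (Sum.inr (Sum.inr i)))

theorem deltaPoly_val (q : ℂ) (κ : ℕ → ℂ) (n l : ℕ) (x a : Fin n → ℂ) (b : Fin l → ℂ) :
    (deltaPoly q κ n l).val x a b =
      (∏ i : Fin n, κ (l - n + 2 * (i : ℕ))) * rowDet q q⁻¹ x a b := by
  rw [DPoly.val, deltaPoly, map_mul, rowDet_map, MvPolynomial.eval_C, MvPolynomial.eval_C,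
    MvPolynomial.eval_C]
  congr 2 <;> · funext i; simp

theorem isDeltaFamily_deltaPoly (hq : q ≠ 0) (κ : ℕ → ℂ) :
    IsDeltaFamily q κ (deltaPoly q κ) where
  homogeneous n l h := by
    apply isHomogeneous_of_scaling
    intro t v ht
    have hv : ∀ v : Fin n ⊕ Fin n ⊕ Fin l → ℂ, MvPolynomial.eval v (deltaPoly q κ n l) =
        (deltaPoly q κ n l).val (v ∘ Sum.inl) (v ∘ Sum.inr ∘ Sum.inl) (v ∘ Sum.inr ∘ Sum.inr) := by
      intro v
      rw [DPoly.val]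
      congr 2
      funext i
      rcases i with i | i | i <;> rfl
    rw [hv, hv, deltaPoly_val, deltaPoly_val]
    have := rowDet_smul (q := q) ht q⁻¹ (v ∘ Sum.inl) (v ∘ Sum.inr ∘ Sum.inl)
      (v ∘ Sum.inr ∘ Sum.inr) (by omega : 0 < l)
    rw [mul_left_comm, ← this]
    rfl
  antisymm n l _ σ x a b := by
    rw [deltaPoly_val, deltaPoly_val, rowDet_perm]; ring
  symm_left n l _ σ x a b := by rw [deltaPoly_val, deltaPoly_val, rowDet_perm_left]
  symm_right n l _ σ x a b := by rw [deltaPoly_val, deltaPoly_val, rowDet_perm_right]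
  recursion n l h x a b := by
    rw [deltaPoly_val, rowDet_snoc hq, mul_left_comm, Finset.mul_sum]
    congr 1
    refine Finset.sum_congr rfl fun ν _ => ?_
    rw [hFun_eq hq, deltaPoly_val, Fin.prod_univ_castSucc]
    have h1 : l + 1 - (n + 1) = l - n := by omega
    -- The recursion contributes κ_{N-2} for N = n + l + 2, which is the last factor of the product
    -- of the κ; the difference l - n is unchanged.
    have h2 : l - n + 2 * n = n + l := by omega
    simp only [h1, Fin.val_castSucc, Fin.val_last, h2]
    ring
  initial l _ := by
    rw [deltaPoly, rowDet]
    simp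

end Complex

end

/-! ### Existence of the vector `⟨D⟩` -/

/-! ### Weights and their exchange relations at two neighbouring sites -/

section Weight

variable {N : ℕ} {q : ℂ}

theorem RAct_of_eq (q t : ℂ) {i j : Fin N} (u : Tens N) {ε : Fin N → Bool}
    (h : ε i = ε j) : RAct q t i j u ε = u ε := by
  rw [RAct, Finset.sum_eq_single (ε i, ε j)]
  · simp [Rmat, h]
    congr 1
    rw [← h, Function.update_eq_self, h, Function.update_eq_self]
  · rintro e - he
    simp [Rmat, h]
    intro h'
    exact absurd (by rw [h', h]) he
  · simp

theorem update_update_swap {i j : Fin N} (ε : Fin N → Bool) :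
    Function.update (Function.update ε i (ε j)) j (ε i) = ε ∘ Equiv.swap i j := by
  funext k
  simp only [Function.comp_apply, Function.update_apply, Equiv.swap_apply_def]
  split_ifs <;> simp_all

theorem RAct_of_ne (q t : ℂ) {i j : Fin N} (u : Tens N) {ε : Fin N → Bool} (h : ε i ≠ ε j) :
    RAct q t i j u ε = (1 - t ^ 2) * q / (1 - q ^ 2 * t ^ 2) * u ε
      + (1 - q ^ 2) * t / (1 - q ^ 2 * t ^ 2) * u (ε ∘ Equiv.swap i j) := by
  have hne : ((ε i, ε j) : Bool × Bool) ≠ (ε j, ε i) := by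
    intro h'; exact h (Prod.ext_iff.1 h').1
  rw [RAct, ← Finset.add_sum_erase _ _ (Finset.mem_univ (ε i, ε j)),
    ← Finset.add_sum_erase _ _ (Finset.mem_erase.2 ⟨hne.symm, Finset.mem_univ (ε j, ε i)⟩),
    Finset.sum_eq_zero]
  · rw [add_zero, update_update_swap]
    congr 1
    · simp [Rmat, h]
    · simp [Rmat, h, hne.symm]
  · intro e he
    simp only [Finset.mem_erase, Finset.mem_univ, and_true] at he
    simp [Rmat, h, he.1, he.2]

/-- The one-variable factor of the site `p`. -/
def siteFactor (q : ℂ) (z : Fin N → ℂ) (p : Fin N) (t : ℂ) : ℂ :=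
  ∏ r, if p < r then q * (t - z r) else if r < p then t - q ^ 2 * z r else 1

/-- The two-variable factor. -/
def pairFactor (q s t : ℂ) : ℂ := (q ^ 2 * t - s) / (s - t)

/-- The weight of `ε` with the variable `u p` at the site `p`. -/
def siteWeight (q : ℂ) (ε : Fin N → Bool) (u ζ : Fin N → ℂ) : ℂ :=
  (∏ p, if ε p = false then ζ p * siteFactor q (sq ζ) p (u p) else 1) *
    ∏ p, ∏ p', if p < p' ∧ ε p = false ∧ ε p' = false then pairFactor q (u p) (u p') else 1

/-- The sites other than `i` and `j`. -/
def others (i j : Fin N) : Finset (Fin N) := (Finset.univ.erase i).erase j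

theorem prod_eq_others {i j : Fin N} (hij : i ≠ j) (f : Fin N → ℂ) :
    ∏ p, f p = f i * f j * ∏ p ∈ others i j, f p := by
  rw [others, mul_assoc, Finset.mul_prod_erase _ _ (Finset.mem_erase.2 ⟨hij.symm, Finset.mem_univ j⟩),
    Finset.mul_prod_erase _ _ (Finset.mem_univ i)]

theorem swap_of_mem_others {i j p : Fin N} (hp : p ∈ others i j) : Equiv.swap i j p = p := by
  simp only [others, Finset.mem_erase] at hp
  exact Equiv.swap_apply_of_ne_of_ne hp.2.1 hp.1

theorem lt_iff_of_mem_others {i j p : Fin N} (hij : (i : ℕ) + 1 = j) (hp : p ∈ others i j) :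
    (p < j ↔ p < i) ∧ (j < p ↔ ¬ p < i) ∧ (i < p ↔ ¬ p < i) := by
  simp only [others, Finset.mem_erase, ne_eq, Fin.ext_iff] at hp
  simp only [Fin.lt_def]
  omega

/-- The factor of a variable at the sites `i`, `j` that comes from the `z_r` of other sites. -/
def outerSite (q : ℂ) (i j : Fin N) (z : Fin N → ℂ) (t : ℂ) : ℂ :=
  ∏ r ∈ others i j, if r < i then t - q ^ 2 * z r else q * (t - z r)

/-- The factor of a variable at the sites `i`, `j` that comes from the variables at other sites. -/
def outerPair (q : ℂ) (i j : Fin N) (ε : Fin N → Bool) (u : Fin N → ℂ) (t : ℂ) : ℂ :=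
  ∏ p ∈ others i j, if ε p = false then
    (if p < i then pairFactor q (u p) t else pairFactor q t (u p)) else 1

/-- The factor that does not involve the variables at the sites `i`, `j`. -/
def outerWeight (q : ℂ) (i j : Fin N) (ε : Fin N → Bool) (u ζ : Fin N → ℂ) : ℂ :=
  (∏ p ∈ others i j, if ε p = false then ζ p * siteFactor q (sq ζ) p (u p) else 1) *
    ∏ p ∈ others i j, ∏ p' ∈ others i j,
      if p < p' ∧ ε p = false ∧ ε p' = false then pairFactor q (u p) (u p') else 1

theorem siteFactor_left {i j : Fin N} (hij : (i : ℕ) + 1 = j) (z : Fin N → ℂ) (t : ℂ) :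
    siteFactor q z i t = q * (t - z j) * outerSite q i j z t := by
  have hne : i ≠ j := by intro h; rw [h] at hij; omega
  have hlt : i < j := by rw [Fin.lt_def]; omega
  rw [siteFactor, prod_eq_others hne, outerSite]
  simp only [lt_irrefl, if_false, one_mul, hlt, if_true]
  congr 1
  refine Finset.prod_congr rfl fun r hr => ?_
  obtain ⟨h1, h2, h3⟩ := lt_iff_of_mem_others hij hr
  by_cases h : r < i <;> simp [h, h3]

theorem siteFactor_right {i j : Fin N} (hij : (i : ℕ) + 1 = j) (z : Fin N → ℂ) (t : ℂ) :
    siteFactor q z j t = (t - q ^ 2 * z i) * outerSite q i j z t := by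
  have hne : i ≠ j := by intro h; rw [h] at hij; omega
  have hlt : i < j := by rw [Fin.lt_def]; omega
  rw [siteFactor, prod_eq_others hne, outerSite]
  simp only [lt_irrefl, if_false, mul_one, hlt, if_true, hlt.not_gt]
  congr 1
  refine Finset.prod_congr rfl fun r hr => ?_
  obtain ⟨h1, h2, h3⟩ := lt_iff_of_mem_others hij hr
  by_cases h : r < i <;> simp [h, h1, h2]

theorem siteFactor_swap {i j p : Fin N} (hij : (i : ℕ) + 1 = j) (hp : p ∈ others i j)
    (z : Fin N → ℂ) (t : ℂ) : siteFactor q (z ∘ Equiv.swap i j) p t = siteFactor q z p t := by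
  have hne : i ≠ j := by intro h; rw [h] at hij; omega
  rw [siteFactor, siteFactor, prod_eq_others hne, prod_eq_others hne]
  obtain ⟨h1, h2, h3⟩ := lt_iff_of_mem_others hij hp
  congr 1
  · simp only [Function.comp_apply, Equiv.swap_apply_left, Equiv.swap_apply_right]
    by_cases h : p < i
    · simp [h, h1]; ring
    · simp [h, h1, h2, h3]; ring
  · refine Finset.prod_congr rfl fun r hr => ?_
    simp only [Function.comp_apply, swap_of_mem_others hr]

/-- All other sites enter through functions `outerSite` and `outerPair` that are the same for both
sites i and j. The exchange relations thus become rational identities in the data of two sites. -/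
theorem siteWeight_eq {i j : Fin N} (hij : (i : ℕ) + 1 = j) (ε : Fin N → Bool) (u ζ : Fin N → ℂ) :
    siteWeight q ε u ζ = outerWeight q i j ε u ζ *
      (if ε i = false then ζ i * (q * (u i - ζ j ^ 2)) * outerSite q i j (sq ζ) (u i) *
        outerPair q i j ε u (u i) else 1) *
      (if ε j = false then ζ j * (u j - q ^ 2 * ζ i ^ 2) * outerSite q i j (sq ζ) (u j) *
        outerPair q i j ε u (u j) else 1) *
      (if ε i = false ∧ ε j = false then pairFactor q (u i) (u j) else 1) := by
  have hne : i ≠ j := by intro h; rw [h] at hij; omega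
  have hlt : i < j := by rw [Fin.lt_def]; omega
  set B : Fin N → Fin N → ℂ := fun p p' =>
    if p < p' ∧ ε p = false ∧ ε p' = false then pairFactor q (u p) (u p') else 1 with hB
  have hrow : ∀ p, ∏ p', B p p' = B p i * B p j * ∏ p' ∈ others i j, B p p' :=
    fun p => prod_eq_others hne _
  have hBB : ∏ p, ∏ p', B p p' = B i j *
      ((∏ p ∈ others i j, B p i) * ∏ p ∈ others i j, B i p) *
      ((∏ p ∈ others i j, B p j) * ∏ p ∈ others i j, B j p) *
      ∏ p ∈ others i j, ∏ p' ∈ others i j, B p p' := by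
    rw [prod_eq_others hne, hrow i, hrow j, Finset.prod_congr rfl fun p _ => hrow p,
      Finset.prod_mul_distrib, Finset.prod_mul_distrib]
    have h1 : B i i = 1 := by simp [hB]
    have h2 : B j j = 1 := by simp [hB]
    have h3 : B j i = 1 := by simp [hB, hlt.not_gt]
    rw [h1, h2, h3]
    ring
  have hi : (∏ p ∈ others i j, B p i) * ∏ p ∈ others i j, B i p =
      if ε i = false then outerPair q i j ε u (u i) else 1 := by
    rw [← Finset.prod_mul_distrib]
    by_cases h : ε i = false
    · rw [if_pos h, outerPair]
      refine Finset.prod_congr rfl fun p hp => ?_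
      obtain ⟨h1, h2, h3⟩ := lt_iff_of_mem_others hij hp
      by_cases hp' : ε p = false <;> by_cases hpi : p < i <;> simp [hB, h, h3, hp', hpi]
    · rw [if_neg h]
      exact Finset.prod_eq_one fun p _ => by simp [hB, h]
  have hj : (∏ p ∈ others i j, B p j) * ∏ p ∈ others i j, B j p =
      if ε j = false then outerPair q i j ε u (u j) else 1 := by
    rw [← Finset.prod_mul_distrib]
    by_cases h : ε j = false
    · rw [if_pos h, outerPair]
      refine Finset.prod_congr rfl fun p hp => ?_
      obtain ⟨h1, h2, h3⟩ := lt_iff_of_mem_others hij hp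
      by_cases hp' : ε p = false <;> by_cases hpi : p < i <;> simp [hB, h, h1, h2, hp', hpi]
    · rw [if_neg h]
      exact Finset.prod_eq_one fun p _ => by simp [hB, h]
  have hBij : B i j = if ε i = false ∧ ε j = false then pairFactor q (u i) (u j) else 1 := by
    simp [hB, hlt]
  rw [siteWeight, hBB, hi, hj, hBij, prod_eq_others hne, outerWeight,
    siteFactor_left hij, siteFactor_right hij]
  change _ = _ * (∏ p ∈ others i j, ∏ p' ∈ others i j, B p p') * _ * _ * _
  simp only [sq]
  by_cases h1 : ε i = false <;> by_cases h2 : ε j = false <;>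
    simp only [h1, h2, if_true, if_false, and_self, and_true, and_false,
      reduceCtorEq, mul_one] <;> ring

theorem outerWeight_swap {i j : Fin N} (hij : (i : ℕ) + 1 = j) (ε : Fin N → Bool)
    (u ζ : Fin N → ℂ) :
    outerWeight q i j ε u (ζ ∘ Equiv.swap i j) = outerWeight q i j ε u ζ := by
  rw [outerWeight, outerWeight]
  congr 1
  refine Finset.prod_congr rfl fun p hp => ?_
  rw [show sq (ζ ∘ Equiv.swap i j) = sq ζ ∘ Equiv.swap i j from rfl, siteFactor_swap hij hp,
    Function.comp_apply, swap_of_mem_others hp]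

theorem outerWeight_swap_vars {i j : Fin N} (ε : Fin N → Bool) (u ζ : Fin N → ℂ) :
    outerWeight q i j ε (u ∘ Equiv.swap i j) ζ = outerWeight q i j ε u ζ := by
  rw [outerWeight, outerWeight]
  congr 1
  · refine Finset.prod_congr rfl fun p hp => ?_
    rw [Function.comp_apply, swap_of_mem_others hp]
  · refine Finset.prod_congr rfl fun p hp => Finset.prod_congr rfl fun p' hp' => ?_
    simp only [Function.comp_apply, swap_of_mem_others hp, swap_of_mem_others hp']

theorem outerWeight_swap_signs {i j : Fin N} (ε : Fin N → Bool) (u ζ : Fin N → ℂ) :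
    outerWeight q i j (ε ∘ Equiv.swap i j) u ζ = outerWeight q i j ε u ζ := by
  rw [outerWeight, outerWeight]
  congr 1
  · refine Finset.prod_congr rfl fun p hp => ?_
    rw [Function.comp_apply, swap_of_mem_others hp]
  · refine Finset.prod_congr rfl fun p hp => Finset.prod_congr rfl fun p' hp' => ?_
    simp only [Function.comp_apply, swap_of_mem_others hp, swap_of_mem_others hp']

theorem outerSite_swap {i j : Fin N} (z : Fin N → ℂ) (t : ℂ) :
    outerSite q i j (z ∘ Equiv.swap i j) t = outerSite q i j z t := by
  rw [outerSite, outerSite]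
  refine Finset.prod_congr rfl fun p hp => ?_
  rw [Function.comp_apply, swap_of_mem_others hp]

theorem outerPair_swap_vars {i j : Fin N} (ε : Fin N → Bool) (u : Fin N → ℂ) (t : ℂ) :
    outerPair q i j ε (u ∘ Equiv.swap i j) t = outerPair q i j ε u t := by
  rw [outerPair, outerPair]
  refine Finset.prod_congr rfl fun p hp => ?_
  rw [Function.comp_apply, swap_of_mem_others hp]

theorem outerPair_swap_signs {i j : Fin N} (ε : Fin N → Bool) (u : Fin N → ℂ) (t : ℂ) :
    outerPair q i j (ε ∘ Equiv.swap i j) u t = outerPair q i j ε u t := by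
  rw [outerPair, outerPair]
  refine Finset.prod_congr rfl fun p hp => ?_
  rw [Function.comp_apply, swap_of_mem_others hp]

theorem siteWeight_swap_plus {i j : Fin N} (hij : (i : ℕ) + 1 = j) {ε : Fin N → Bool}
    (hi : ε i = true) (hj : ε j = true) (u ζ : Fin N → ℂ) :
    siteWeight q ε (u ∘ Equiv.swap i j) (ζ ∘ Equiv.swap i j) = siteWeight q ε u ζ := by
  rw [siteWeight_eq hij, siteWeight_eq hij, outerWeight_swap hij, outerWeight_swap_vars]
  simp [hi, hj]

/-- R fixes v_- ⊗ v_-, so invariance under the swap of ζ_i and ζ_j is wanted. It is obtained here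
after summing over both assignments of the two variables to the two sites; `pairFactor` is chosen
for this. -/
theorem siteWeight_swap_minus {i j : Fin N} (hij : (i : ℕ) + 1 = j) {ε : Fin N → Bool}
    (hi : ε i = false) (hj : ε j = false) {u : Fin N → ℂ} (hu : u i ≠ u j) (ζ : Fin N → ℂ) :
    siteWeight q ε (u ∘ Equiv.swap i j) (ζ ∘ Equiv.swap i j) +
        siteWeight q ε u (ζ ∘ Equiv.swap i j) =
      siteWeight q ε u ζ + siteWeight q ε (u ∘ Equiv.swap i j) ζ := by
  have hsq : sq (ζ ∘ Equiv.swap i j) = sq ζ ∘ Equiv.swap i j := rfl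
  simp only [siteWeight_eq hij, outerWeight_swap hij, outerWeight_swap_vars, hsq, outerSite_swap,
    outerPair_swap_vars, hi, hj, Function.comp_apply, Equiv.swap_apply_left,
    Equiv.swap_apply_right, if_true, and_self, pairFactor]
  have h1 : u i - u j ≠ 0 := sub_ne_zero.2 hu
  have h2 : u j - u i ≠ 0 := sub_ne_zero.2 hu.symm
  have h3 : ∀ t : ℂ, t / (u j - u i) = - (t / (u i - u j)) := by
    intro t; rw [← neg_sub (u i), div_neg]
  rw [h3]
  field_simp
  ring

/-- Only one variable t sits at the two sites, and the site factors q (t - z_j) and t - q² z_i are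
transformed into one another by the entries of R. No summation over variables is needed. -/
theorem siteWeight_swap_ne {i j : Fin N} (hij : (i : ℕ) + 1 = j) {ε : Fin N → Bool}
    (hε : ε i ≠ ε j) (u : Fin N → ℂ) {ζ : Fin N → ℂ} (h0 : ζ j ≠ 0)
    (hgen : ζ j ^ 2 ≠ q ^ 2 * ζ i ^ 2) :
    siteWeight q (ε ∘ Equiv.swap i j) (u ∘ Equiv.swap i j) (ζ ∘ Equiv.swap i j) =
      (1 - (ζ i / ζ j) ^ 2) * q / (1 - q ^ 2 * (ζ i / ζ j) ^ 2) * siteWeight q ε u ζ +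
      (1 - q ^ 2) * (ζ i / ζ j) / (1 - q ^ 2 * (ζ i / ζ j) ^ 2) *
        siteWeight q (ε ∘ Equiv.swap i j) (u ∘ Equiv.swap i j) ζ := by
  have hsq : sq (ζ ∘ Equiv.swap i j) = sq ζ ∘ Equiv.swap i j := rfl
  have h1 : ζ j ^ 2 - q ^ 2 * ζ i ^ 2 ≠ 0 := sub_ne_zero.2 hgen
  obtain ⟨e, he⟩ : ∃ e, (ζ j ^ 2 - q ^ 2 * ζ i ^ 2) * e = 1 := ⟨_, mul_inv_cancel₀ h1⟩
  have he' : e = (ζ j ^ 2 - q ^ 2 * ζ i ^ 2)⁻¹ := eq_inv_of_mul_eq_one_right he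
  have h2 : 1 - q ^ 2 * (ζ i / ζ j) ^ 2 = (ζ j ^ 2 - q ^ 2 * ζ i ^ 2) / ζ j ^ 2 := by
    field_simp
  have hα : (1 - (ζ i / ζ j) ^ 2) * q / (1 - q ^ 2 * (ζ i / ζ j) ^ 2) =
      (ζ j ^ 2 - ζ i ^ 2) * q * e := by
    rw [h2, he']; field_simp
  have hβ : (1 - q ^ 2) * (ζ i / ζ j) / (1 - q ^ 2 * (ζ i / ζ j) ^ 2) =
      (1 - q ^ 2) * ζ i * ζ j * e := by
    rw [h2, he']; field_simp
  simp only [siteWeight_eq hij, outerWeight_swap hij, outerWeight_swap_vars, hsq, outerSite_swap,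
    outerPair_swap_vars, outerWeight_swap_signs, outerPair_swap_signs, Function.comp_apply,
    Equiv.swap_apply_left, Equiv.swap_apply_right, hα, hβ]
  rcases hi : ε i <;> rcases hj : ε j
  · exact absurd (hi.trans hj.symm) hε
  · simp only [if_true, if_false, and_true, and_false, reduceCtorEq, mul_one]
    linear_combination (-(outerWeight q i j ε u ζ * (ζ i * (u i - q ^ 2 * ζ j ^ 2) *
      outerSite q i j (sq ζ) (u i) * outerPair q i j ε u (u i)))) * he
  · simp only [if_true, if_false, and_true, and_false, reduceCtorEq, mul_one]
    linear_combination (-(outerWeight q i j ε u ζ * (ζ j * (q * (u j - ζ i ^ 2)) *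
      outerSite q i j (sq ζ) (u j) * outerPair q i j ε u (u j)))) * he
  · exact absurd (hi.trans hj.symm) hε

end Weight

/-! ### Sums of weights: exchange relation and triangularity -/

section BracketVec

variable {N : ℕ} {q : ℂ}

/-- The sum of `F (z ∘ σ)` over the permutations `σ` that carry the signs `ε₀` to `η`. -/
def signCoeff (ε₀ : Fin N → Bool) (F : (Fin N → ℂ) → ℂ) (z : Fin N → ℂ) (η : Fin N → Bool) : ℂ :=
  ∑ σ : Equiv.Perm (Fin N), if η = ε₀ ∘ σ.symm then F (z ∘ σ) else 0

/-- An explicit vector with the exchange property. -/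
def bracketVec (q : ℂ) (ε₀ : Fin N → Bool) (F : (Fin N → ℂ) → ℂ) (ζ : Fin N → ℂ) : Tens N :=
  fun ε => ∑ τ : Equiv.Perm (Fin N),
    signCoeff ε₀ F (sq ζ) (ε ∘ τ.symm) * siteWeight q ε (sq ζ ∘ τ) ζ

theorem signCoeff_swap (ε₀ : Fin N → Bool) (F : (Fin N → ℂ) → ℂ) (z : Fin N → ℂ)
    (η : Fin N → Bool) (i j : Fin N) :
    signCoeff ε₀ F (z ∘ Equiv.swap i j) (η ∘ Equiv.swap i j) = signCoeff ε₀ F z η := by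
  set s := Equiv.swap i j with hs
  have hss : ∀ p, s (s p) = p := fun p => by simp [hs]
  rw [signCoeff, signCoeff, ← Equiv.sum_comp (Equiv.mulLeft s) (fun σ : Equiv.Perm (Fin N) =>
    if η = ε₀ ∘ σ.symm then F (z ∘ σ) else 0)]
  refine Finset.sum_congr rfl fun σ _ => ?_
  have h : (η ∘ s = ε₀ ∘ σ.symm) ↔ (η = ε₀ ∘ (s * σ).symm) := by
    have h' : ∀ p, (s * σ).symm p = σ.symm (s p) := by
      intro p
      rw [Equiv.symm_apply_eq]
      simp [hss]
    constructor
    · intro h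
      funext p
      have := congrFun h (s p)
      simp only [Function.comp_apply, hss] at this
      rw [Function.comp_apply, h', this]
    · intro h
      funext p
      rw [h, Function.comp_apply, Function.comp_apply, h', hss, Function.comp_apply]
  simp only [Equiv.coe_mulLeft, h]
  rfl

theorem bracketVec_swap (ε₀ : Fin N → Bool) (F : (Fin N → ℂ) → ℂ) (ζ : Fin N → ℂ)
    (ε : Fin N → Bool) (i j : Fin N) :
    bracketVec q ε₀ F (ζ ∘ Equiv.swap i j) (ε ∘ Equiv.swap i j) =
      ∑ τ : Equiv.Perm (Fin N), signCoeff ε₀ F (sq ζ) (ε ∘ τ.symm) *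
        siteWeight q (ε ∘ Equiv.swap i j) ((sq ζ ∘ τ) ∘ Equiv.swap i j)
          (ζ ∘ Equiv.swap i j) := by
  set s := Equiv.swap i j with hs
  have hss : ∀ p, s (s p) = p := fun p => by simp [hs]
  -- Reindexing by τ ↦ s τ s replaces the variables by their swap and leaves the coefficients
  -- unchanged.
  rw [bracketVec, ← Equiv.sum_comp ((Equiv.mulLeft s).trans (Equiv.mulRight s))]
  refine Finset.sum_congr rfl fun τ _ => ?_
  simp only [Equiv.trans_apply, Equiv.coe_mulLeft, Equiv.coe_mulRight]
  have h1 : (ε ∘ s) ∘ (s * τ * s).symm = (ε ∘ τ.symm) ∘ s := by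
    funext p
    simp only [Function.comp_apply]
    have h' : (s * τ * s).symm p = s (τ.symm (s p)) := by
      rw [Equiv.symm_apply_eq]
      simp [hss]
    rw [h', hss]
  have h2 : sq (ζ ∘ s) ∘ (s * τ * s) = (sq ζ ∘ τ) ∘ s := by
    funext p
    simp [sq, hss]
  rw [h1, h2, show sq (ζ ∘ s) = sq ζ ∘ s from rfl, hs, signCoeff_swap]

theorem bracketVec_reindex (ε₀ : Fin N → Bool) (F : (Fin N → ℂ) → ℂ) (ζ : Fin N → ℂ)
    (ε : Fin N → Bool) (i j : Fin N) :
    bracketVec q ε₀ F ζ (ε ∘ Equiv.swap i j) =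
      ∑ τ : Equiv.Perm (Fin N), signCoeff ε₀ F (sq ζ) (ε ∘ τ.symm) *
        siteWeight q (ε ∘ Equiv.swap i j) ((sq ζ ∘ τ) ∘ Equiv.swap i j) ζ := by
  set s := Equiv.swap i j with hs
  have hss : ∀ p, s (s p) = p := fun p => by simp [hs]
  rw [bracketVec, ← Equiv.sum_comp (Equiv.mulRight s)]
  refine Finset.sum_congr rfl fun τ _ => ?_
  simp only [Equiv.coe_mulRight]
  have h1 : (ε ∘ s) ∘ (τ * s).symm = ε ∘ τ.symm := by
    funext p
    simp only [Function.comp_apply]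
    have h' : (τ * s).symm p = s (τ.symm p) := by
      rw [Equiv.symm_apply_eq]
      simp [hss]
    rw [h', hss]
  rw [h1]
  rfl

theorem comp_swap_of_eq {α : Type} {i j : Fin N} {ε : Fin N → α} (h : ε i = ε j) :
    ε ∘ Equiv.swap i j = ε := by
  funext p
  simp only [Function.comp_apply, Equiv.swap_apply_def]
  split_ifs with h1 h2
  · rw [h1, h]
  · rw [h2, h]
  · rfl

theorem bracketVec_exchange (ε₀ : Fin N → Bool) (F : (Fin N → ℂ) → ℂ) {ζ : Fin N → ℂ}
    (hζ : Generic q ζ) {i j : Fin N} (hij : (i : ℕ) + 1 = j) :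
    PAct i j (bracketVec q ε₀ F (ζ ∘ Equiv.swap i j)) =
      RAct q (ζ i / ζ j) i j (bracketVec q ε₀ F ζ) := by
  have hne : i ≠ j := by intro h; rw [h] at hij; omega
  funext ε
  rw [PAct, bracketVec_swap]
  by_cases hε : ε i = ε j
  · rw [RAct_of_eq _ _ _ hε, comp_swap_of_eq hε]
    rcases hi : ε i
    · have hj : ε j = false := hε ▸ hi
      set f : Equiv.Perm (Fin N) → ℂ := fun τ => signCoeff ε₀ F (sq ζ) (ε ∘ τ.symm) *
        siteWeight q ε ((sq ζ ∘ τ) ∘ Equiv.swap i j) (ζ ∘ Equiv.swap i j) with hf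
      set g : Equiv.Perm (Fin N) → ℂ := fun τ => signCoeff ε₀ F (sq ζ) (ε ∘ τ.symm) *
        siteWeight q ε (sq ζ ∘ τ) ζ with hg
      have hc : ∀ τ : Equiv.Perm (Fin N), ε ∘ (τ * Equiv.swap i j).symm = ε ∘ τ.symm := by
        intro τ
        have : (ε ∘ Equiv.swap i j) ∘ τ.symm = ε ∘ τ.symm := by rw [comp_swap_of_eq hε]
        rw [← this]
        funext p
        have h' : (τ * Equiv.swap i j).symm p = Equiv.swap i j (τ.symm p) := by
          rw [Equiv.symm_apply_eq]
          simp
        simp only [Function.comp_apply, h']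
      -- Since ε i = ε j, the permutations τ and τ (i j) have the same coefficient, so the
      -- symmetrised identity applies to each such pair. Summation counts everything twice.
      have key : ∀ τ : Equiv.Perm (Fin N), f τ + f (τ * Equiv.swap i j) =
          g τ + g (τ * Equiv.swap i j) := by
        intro τ
        have hu : (sq ζ ∘ τ) i ≠ (sq ζ ∘ τ) j :=
          (hζ.2 (τ i) (τ j) (τ.injective.ne hne)).1
        have := siteWeight_swap_minus (q := q) hij hi hj hu ζ
        have h1 : sq ζ ∘ (τ * Equiv.swap i j) = (sq ζ ∘ τ) ∘ Equiv.swap i j := rfl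
        have h2 : ((sq ζ ∘ τ) ∘ Equiv.swap i j) ∘ Equiv.swap i j = sq ζ ∘ τ := by
          funext p; simp
        simp only [hf, hg, hc, h1, h2]
        linear_combination signCoeff ε₀ F (sq ζ) (ε ∘ τ.symm) * this
      have hsum : ∀ g : Equiv.Perm (Fin N) → ℂ,
          ∑ τ, g (τ * Equiv.swap i j) = ∑ τ, g τ := fun g =>
        Equiv.sum_comp (Equiv.mulRight (Equiv.swap i j)) g
      have h3 := Finset.sum_congr (rfl : (Finset.univ : Finset (Equiv.Perm (Fin N))) = _)
        fun τ _ => key τ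
      rw [Finset.sum_add_distrib, Finset.sum_add_distrib, hsum, hsum] at h3
      have h4 : ∑ τ, f τ = ∑ τ, g τ := by linear_combination h3 / 2
      exact h4
    · have hj : ε j = true := hε ▸ hi
      refine Finset.sum_congr rfl fun τ _ => ?_
      rw [siteWeight_swap_plus hij hi hj]
  · rw [RAct_of_ne _ _ _ hε, bracketVec_reindex, bracketVec, Finset.mul_sum, Finset.mul_sum,
      ← Finset.sum_add_distrib]
    refine Finset.sum_congr rfl fun τ _ => ?_
    rw [siteWeight_swap_ne hij hε _ (hζ.1 j) (hζ.2 j i hne.symm).2]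
    ring

theorem signCoeff_eq_zero {ε₀ : Fin N → Bool} (F : (Fin N → ℂ) → ℂ) (z : Fin N → ℂ)
    {ε : Fin N → Bool} (τ : Equiv.Perm (Fin N))
    (h : (Finset.univ.filter fun i => ε i = false).card ≠
      (Finset.univ.filter fun i => ε₀ i = false).card) :
    signCoeff ε₀ F z (ε ∘ τ.symm) = 0 := by
  refine Finset.sum_eq_zero fun σ _ => if_neg fun h' => h ?_
  refine Finset.card_equiv (τ.trans σ.symm) fun i => ?_
  have := congrFun h' (τ i)
  simp only [Function.comp_apply, Equiv.symm_apply_apply] at this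
  simp [this]

/-- The part of the extreme component that depends on the `z_j`. -/
def headWeight (q : ℂ) (ε₀ : Fin N → Bool) (v : Fin N → ℂ) : ℂ :=
  ∏ p, ∏ r, if ε₀ p = false then
    (if ε₀ r = true then q * (v p - v r) else if p ≠ r then q ^ 2 * v r - v p else 1) else 1

theorem headWeight_perm (ε₀ : Fin N → Bool) (v : Fin N → ℂ) {σ : Equiv.Perm (Fin N)}
    (hσ : ε₀ ∘ σ = ε₀) : headWeight q ε₀ (v ∘ σ) = headWeight q ε₀ v := by
  symm
  rw [headWeight, headWeight, ← Equiv.prod_comp σ]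
  refine Finset.prod_congr rfl fun p _ => ?_
  rw [← Equiv.prod_comp σ]
  refine Finset.prod_congr rfl fun r _ => ?_
  have h1 : ∀ p, ε₀ (σ p) = ε₀ p := fun p => congrFun hσ p
  simp only [Function.comp_apply, h1, ne_eq, σ.injective.eq_iff]

theorem headWeight_ne_zero (hq : q ≠ 0) (ε₀ : Fin N → Bool) {v : Fin N → ℂ}
    (hv : ∀ i j, i ≠ j → v i ≠ v j ∧ v i ≠ q ^ 2 * v j) : headWeight q ε₀ v ≠ 0 := by
  refine Finset.prod_ne_zero_iff.2 fun p _ => Finset.prod_ne_zero_iff.2 fun r _ => ?_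
  split_ifs with h1 h2 h3
  · have : p ≠ r := by rintro rfl; rw [h1] at h2; exact absurd h2 (by decide)
    exact mul_ne_zero hq (sub_ne_zero.2 (hv p r this).1)
  · exact sub_ne_zero.2 (hv p r h3).2.symm
  · exact one_ne_zero
  · exact one_ne_zero

/-- A power of `-q`. -/
def headConst (q : ℂ) (ε₀ : Fin N → Bool) : ℂ :=
  ∏ p : Fin N, ∏ r : Fin N, if p < r ∧ ε₀ p = false ∧ ε₀ r = false then -q else 1

theorem headConst_ne_zero (hq : q ≠ 0) (ε₀ : Fin N → Bool) : headConst q ε₀ ≠ 0 := by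
  refine Finset.prod_ne_zero_iff.2 fun p _ => Finset.prod_ne_zero_iff.2 fun r _ => ?_
  split_ifs
  · exact neg_ne_zero.2 hq
  · exact one_ne_zero

/-- `ε₀` is of the form `-⋯-+⋯+`. -/
def MinusFirst (ε₀ : Fin N → Bool) : Prop := ∀ p r, r < p → ε₀ p = false → ε₀ r = false

/-- For two minus sites p < r the factors q (v_p - v_r), v_r - q² v_p and (q² v_r - v_p)/(v_p - v_r)
multiply to -q (q² v_r - v_p)(q² v_p - v_r). Apart from the constant -q this is symmetric, which is
needed to divide by it later. -/
theorem siteWeight_minusFirst {ε₀ : Fin N → Bool} (hε : MinusFirst ε₀) {ζ : Fin N → ℂ}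
    (hζ : ∀ i j, i ≠ j → sq ζ i ≠ sq ζ j) :
    siteWeight q ε₀ (sq ζ) ζ = (∏ p, if ε₀ p = false then ζ p else 1) *
      (headConst q ε₀ * headWeight q ε₀ (sq ζ)) := by
  set v := sq ζ with hv
  have hA : ∀ p, (if ε₀ p = false then ζ p * siteFactor q v p (v p) else 1) =
      (if ε₀ p = false then ζ p else 1) *
        ∏ r, if ε₀ p = false then (if p < r then q * (v p - v r) else
          if r < p then v p - q ^ 2 * v r else 1) else 1 := by
    intro p
    by_cases h : ε₀ p = false <;> simp [h, siteFactor]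
  rw [siteWeight, Finset.prod_congr rfl fun p _ => hA p, Finset.prod_mul_distrib, mul_assoc]
  congr 1
  set A : Fin N → Fin N → ℂ := fun p r => if ε₀ p = false then (if p < r then q * (v p - v r) else
          if r < p then v p - q ^ 2 * v r else 1) else 1 with hAdef
  set A1 : Fin N → Fin N → ℂ := fun p r => if ε₀ p = false ∧ p < r then q * (v p - v r) else 1
    with hA1
  set A2 : Fin N → Fin N → ℂ := fun p r => if ε₀ p = false ∧ r < p then v p - q ^ 2 * v r else 1
    with hA2
  set B1 : Fin N → Fin N → ℂ := fun p r => if ε₀ p = false ∧ ε₀ r = true then q * (v p - v r)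
    else if ε₀ p = false ∧ p < r then q ^ 2 * v r - v p else 1 with hB1
  set B2 : Fin N → Fin N → ℂ := fun p r => if ε₀ p = false ∧ ε₀ r = false ∧ r < p then
    q ^ 2 * v r - v p else 1 with hB2
  -- The contribution of (r, p) is moved to the position (p, r), so that the claim can be checked
  -- separately for each pair p < r.
  have hAA : ∏ p, ∏ r, A p r = (∏ p, ∏ r, A1 p r) * ∏ p, ∏ r, A2 r p := by
    rw [Finset.prod_comm (f := fun p r => A2 r p), ← Finset.prod_mul_distrib]
    refine Finset.prod_congr rfl fun p _ => ?_
    rw [← Finset.prod_mul_distrib]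
    refine Finset.prod_congr rfl fun r _ => ?_
    rcases lt_trichotomy p r with h | h | h
    · simp [hAdef, hA1, hA2, h, h.not_gt]
    · simp [hAdef, hA1, hA2, h]
    · simp [hAdef, hA1, hA2, h, h.not_gt]
  have hBB : headWeight q ε₀ v = (∏ p, ∏ r, B1 p r) * ∏ p, ∏ r, B2 r p := by
    rw [Finset.prod_comm (f := fun p r => B2 r p), ← Finset.prod_mul_distrib]
    refine Finset.prod_congr rfl fun p _ => ?_
    rw [← Finset.prod_mul_distrib]
    refine Finset.prod_congr rfl fun r _ => ?_
    rcases lt_trichotomy p r with h | h | h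
    · rcases h1 : ε₀ p <;> rcases h2 : ε₀ r <;> simp [hB1, hB2, h1, h2, h, h.not_gt, h.ne]
    · subst h
      rcases h1 : ε₀ p <;> simp [hB1, hB2, h1]
    · rcases h1 : ε₀ p <;> rcases h2 : ε₀ r <;> simp [hB1, hB2, h1, h2, h, h.not_gt, h.ne']
  rw [hAA, hBB, headConst]
  simp only [← Finset.prod_mul_distrib]
  refine Finset.prod_congr rfl fun p _ => Finset.prod_congr rfl fun r _ => ?_
  rcases lt_trichotomy p r with h | h | h
  · rcases h1 : ε₀ p <;> rcases h2 : ε₀ r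
    · have hne : v p - v r ≠ 0 := sub_ne_zero.2 (hζ p r h.ne)
      simp [hA1, hA2, hB1, hB2, h, h1, h2, pairFactor]
      field_simp
      ring
    · simp [hA1, hA2, hB1, hB2, h, h1, h2]
    · rw [hε r p h h2] at h1
      exact absurd h1 (by decide)
    · simp [hA1, hA2, hB1, hB2, h, h1, h2]
  · subst h
    rcases h1 : ε₀ p <;> simp [hA1, hA2, hB1, hB2, h1]
  · rcases h1 : ε₀ p <;> rcases h2 : ε₀ r
    · simp [hA1, hA2, hB1, hB2, h.not_gt, h1, h2]
    · rw [hε p r h h1] at h2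
      exact absurd h2 (by decide)
    · simp [hA1, hA2, hB1, hB2, h.not_gt, h1, h2]
    · simp [hA1, hA2, hB1, hB2, h.not_gt, h1, h2]

/-- The variable at p is z_r with r = τ p > p, a zero of the site factor at p. -/
theorem siteWeight_eq_zero {ε : Fin N → Bool} {p : Fin N} (hp : ε p = false)
    {τ : Equiv.Perm (Fin N)} (h : p < τ p) (ζ : Fin N → ℂ) :
    siteWeight q ε (sq ζ ∘ τ) ζ = 0 := by
  rw [siteWeight, Finset.prod_eq_zero (Finset.mem_univ p), zero_mul]
  rw [if_pos hp, siteFactor, Finset.prod_eq_zero (Finset.mem_univ (τ p)), mul_zero]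
  simp [h]

theorem perm_fixes_of_le {ε₀ : Fin N → Bool} (hε : MinusFirst ε₀) {τ : Equiv.Perm (Fin N)}
    (h : ∀ p, ε₀ p = false → τ p ≤ p) : ∀ p, ε₀ p = false → τ p = p := by
  intro p
  induction p using WellFoundedLT.induction with
  | ind p ih =>
    intro hp
    by_contra hne
    have hlt : τ p < p := lt_of_le_of_ne (h p hp) hne
    have := ih (τ p) hlt (hε p _ hlt hp)
    exact hne (τ.injective this)

/-- Triangularity: a weight vanishes unless τ p ≤ p at every minus site. The minus sites form an
initial segment, so τ fixes each of them and a single assignment of variables survives. The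
cardinalities count repetitions: τ is free on the plus sites, and σ runs over the stabiliser of ε₀.
-/
theorem bracketVec_minusFirst {ε₀ : Fin N → Bool} (hε : MinusFirst ε₀) {F : (Fin N → ℂ) → ℂ}
    (hF : ∀ z (σ : Equiv.Perm (Fin N)), ε₀ ∘ σ = ε₀ → F (z ∘ σ) = F z) {ζ : Fin N → ℂ}
    (hζ : ∀ i j, i ≠ j → sq ζ i ≠ sq ζ j) :
    bracketVec q ε₀ F ζ ε₀ =
      (((Finset.univ.filter fun τ : Equiv.Perm (Fin N) => ∀ p, ε₀ p = false → τ p = p).card *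
        (Finset.univ.filter fun σ : Equiv.Perm (Fin N) => ε₀ = ε₀ ∘ σ.symm).card : ℕ) : ℂ) *
      F (sq ζ) * ((∏ p, if ε₀ p = false then ζ p else 1) *
        (headConst q ε₀ * headWeight q ε₀ (sq ζ))) := by
  have hsc : signCoeff ε₀ F (sq ζ) ε₀ =
      ((Finset.univ.filter fun σ : Equiv.Perm (Fin N) => ε₀ = ε₀ ∘ σ.symm).card : ℂ) *
        F (sq ζ) := by
    rw [signCoeff, ← Finset.sum_filter, ← nsmul_eq_mul, ← Finset.sum_const]
    refine Finset.sum_congr rfl fun σ hσ => hF _ σ ?_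
    have h1 := (Finset.mem_filter.1 hσ).2
    funext p
    have := congrFun h1 (σ p)
    simpa using this
  have hterm : ∀ τ : Equiv.Perm (Fin N),
      signCoeff ε₀ F (sq ζ) (ε₀ ∘ τ.symm) * siteWeight q ε₀ (sq ζ ∘ τ) ζ =
        if ∀ p, ε₀ p = false → τ p = p then
          signCoeff ε₀ F (sq ζ) ε₀ * siteWeight q ε₀ (sq ζ) ζ else 0 := by
    intro τ
    split_ifs with h
    · congr 1
      · congr 1
        funext p
        rw [Function.comp_apply]
        by_cases hp : ε₀ p = false
        · have : τ.symm p = p := by rw [Equiv.symm_apply_eq, h p hp]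
          rw [this]
        · by_cases hp' : ε₀ (τ.symm p) = false
          · have := h _ hp'
            rw [Equiv.apply_symm_apply] at this
            exact absurd (this ▸ hp') hp
          · simp only [Bool.not_eq_false] at hp hp'
            rw [hp, hp']
      · rw [siteWeight, siteWeight]
        congr 1
        · refine Finset.prod_congr rfl fun p _ => ?_
          split_ifs with hp
          · rw [Function.comp_apply, h p hp]
          · rfl
        · refine Finset.prod_congr rfl fun p _ => Finset.prod_congr rfl fun r _ => ?_
          split_ifs with hp
          · rw [Function.comp_apply, Function.comp_apply, h p hp.2.1, h r hp.2.2]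
          · rfl
    · have : ∃ p, ε₀ p = false ∧ p < τ p := by
        by_contra hcon
        push Not at hcon
        exact h (perm_fixes_of_le hε hcon)
      obtain ⟨p, hp, hlt⟩ := this
      rw [siteWeight_eq_zero hp hlt, mul_zero]
  rw [bracketVec, Finset.sum_congr rfl fun τ _ => hterm τ, ← Finset.sum_filter, Finset.sum_const,
    nsmul_eq_mul, hsc, siteWeight_minusFirst hε hζ]
  push_cast
  ring

end BracketVec

/-! ### Normalisation at the extreme component -/

section IsBracket

variable {n l N : ℕ} {q : ℂ}

theorem exists_headPart_perm (h : n + l = N) {σ : Equiv.Perm (Fin N)}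
    (hσ : ∀ i, (n ≤ (σ i : ℕ)) ↔ n ≤ (i : ℕ)) :
    ∃ ρ : Equiv.Perm (Fin n), ∀ z : Fin N → ℂ, headPart h (z ∘ σ) = headPart h z ∘ ρ := by
  have hlt : ∀ j : Fin n, (σ ⟨j, by omega⟩ : ℕ) < n := by
    intro j
    have := (hσ ⟨j, by omega⟩).not.2 (by simp)
    omega
  let f : Fin n → Fin n := fun j => ⟨σ ⟨j, by omega⟩, hlt j⟩
  have hf : Function.Injective f := by
    intro i j hij
    have h1 : (σ ⟨i, by omega⟩ : ℕ) = σ ⟨j, by omega⟩ := by simpa [f] using hij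
    have h2 := σ.injective (Fin.ext h1)
    simpa [Fin.ext_iff] using h2
  exact ⟨Equiv.ofBijective f (Finite.injective_iff_bijective.1 hf), fun z => rfl⟩

theorem exists_tailPart_perm (h : n + l = N) {σ : Equiv.Perm (Fin N)}
    (hσ : ∀ i, (n ≤ (σ i : ℕ)) ↔ n ≤ (i : ℕ)) :
    ∃ ρ : Equiv.Perm (Fin l), ∀ z : Fin N → ℂ, tailPart h (z ∘ σ) = tailPart h z ∘ ρ := by
  have hle : ∀ j : Fin l, n ≤ (σ ⟨n + j, by omega⟩ : ℕ) := by
    intro j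
    exact (hσ ⟨n + j, by omega⟩).2 (by simp)
  let f : Fin l → Fin l := fun j =>
    ⟨σ ⟨n + j, by omega⟩ - n, by have := (σ ⟨n + j, by omega⟩).2; have := hle j; omega⟩
  have hf : Function.Injective f := by
    intro i j hij
    have h0 : (σ ⟨n + i, by omega⟩ : ℕ) - n = σ ⟨n + j, by omega⟩ - n := by
      simpa [f] using hij
    have h1 : (σ ⟨n + i, by omega⟩ : ℕ) = σ ⟨n + j, by omega⟩ := by
      have := hle i; have := hle j; omega
    have h2 := σ.injective (Fin.ext h1)
    simpa [Fin.ext_iff] using h2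
  refine ⟨Equiv.ofBijective f (Finite.injective_iff_bijective.1 hf), fun z => ?_⟩
  funext j
  simp only [tailPart, Function.comp_apply, Equiv.ofBijective_apply, f]
  congr 1
  apply Fin.ext
  have := hle j
  simp only
  omega

theorem prod_minus_eq_prod_headPart (h : n + l = N) (ζ : Fin N → ℂ) :
    (∏ p : Fin N, if decide (n ≤ (p : ℕ)) = false then ζ p else 1) =
      ∏ j : Fin n, headPart h ζ j := by
  subst h
  rw [Fin.prod_univ_add]
  have h1 : ∀ i : Fin l, (if decide (n ≤ ((Fin.natAdd n i : Fin (n + l)) : ℕ)) = false then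
      ζ (Fin.natAdd n i) else 1) = 1 := fun i => by simp
  have h2 : ∀ i : Fin n, (if decide (n ≤ ((Fin.castAdd l i : Fin (n + l)) : ℕ)) = false then
      ζ (Fin.castAdd l i) else 1) = headPart rfl ζ i := fun i => by
    have : ¬ n ≤ (i : ℕ) := by omega
    simp [this, headPart]
    rfl
  rw [Finset.prod_congr rfl fun i _ => h1 i, Finset.prod_congr rfl fun i _ => h2 i]
  simp

theorem card_minusFirst (h : n + l = N) :
    (Finset.univ.filter fun i : Fin N => decide (n ≤ (i : ℕ)) = false).card = n := by
  have := Fin.card_filter_val_lt (m := n) (n := N)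
  simp only [decide_eq_false_iff_not, not_le]
  rw [this]
  omega

/-- The vector `⟨D⟩` exists for `D` symmetric in both groups of variables. -/
theorem exists_isBracket (hq : q ≠ 0) {m : ℕ} (h : n + l = N)
    {D : (Fin m → ℂ) → (Fin n → ℂ) → (Fin l → ℂ) → ℂ}
    (hl : ∀ x a b (σ : Equiv.Perm (Fin n)), D x (a ∘ σ) b = D x a b)
    (hr : ∀ x a b (σ : Equiv.Perm (Fin l)), D x a (b ∘ σ) = D x a b) :
    ∃ w, IsBracket q h D w := by
  set ε₀ : Fin N → Bool := fun i => decide (n ≤ (i : ℕ)) with hε₀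
  have hmf : MinusFirst ε₀ := by
    intro p r hrp hp
    simp only [hε₀, decide_eq_false_iff_not, not_le] at hp ⊢
    exact lt_trans hrp hp
  set c : ℂ := (((Finset.univ.filter fun τ : Equiv.Perm (Fin N) =>
      ∀ p, ε₀ p = false → τ p = p).card *
    (Finset.univ.filter fun σ : Equiv.Perm (Fin N) => ε₀ = ε₀ ∘ σ.symm).card : ℕ) : ℂ) with hc
  have hc0 : c ≠ 0 := by
    rw [hc, Nat.cast_ne_zero]
    refine mul_ne_zero (Finset.card_ne_zero.2 ⟨1, ?_⟩) (Finset.card_ne_zero.2 ⟨1, ?_⟩)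
    · simp
    · simp only [Finset.mem_filter, Finset.mem_univ, true_and]; rfl
  set G : (Fin n → ℂ) → (Fin l → ℂ) → ℂ := fun a b =>
    ∏ j, ∏ i, (b i - a j * (q ^ 2)⁻¹)⁻¹ with hG
  have hGl : ∀ a b (σ : Equiv.Perm (Fin n)), G (a ∘ σ) b = G a b := fun a b σ =>
    Equiv.prod_comp σ fun j => ∏ i, (b i - a j * (q ^ 2)⁻¹)⁻¹
  have hGr : ∀ a b (σ : Equiv.Perm (Fin l)), G a (b ∘ σ) = G a b := fun a b σ =>
    Finset.prod_congr rfl fun j _ => Equiv.prod_comp σ fun i => (b i - a j * (q ^ 2)⁻¹)⁻¹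
  -- The prescribed component without ∏ ζ_j, divided by the factor from `bracketVec_minusFirst`.
  -- Both are invariant under permutations within the two groups of z, as that lemma requires.
  set F : (Fin m → ℂ) → (Fin N → ℂ) → ℂ := fun x z =>
    D x (headPart h z) (tailPart h z) * G (headPart h z) (tailPart h z) /
      (c * (headConst q ε₀ * headWeight q ε₀ z)) with hF
  have hFs : ∀ x z (σ : Equiv.Perm (Fin N)), ε₀ ∘ σ = ε₀ → F x (z ∘ σ) = F x z := by
    intro x z σ hσ
    have hσ' : ∀ i, (n ≤ (σ i : ℕ)) ↔ n ≤ (i : ℕ) := fun i => by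
      have := congrFun hσ i
      simpa [hε₀] using this
    obtain ⟨ρ, hρ⟩ := exists_headPart_perm h hσ'
    obtain ⟨ρ', hρ'⟩ := exists_tailPart_perm h hσ'
    simp only [hF]
    rw [hρ, hρ', hl, hr, hGl, hGr, headWeight_perm _ _ hσ]
  refine ⟨fun x ζ => bracketVec q ε₀ (F x) ζ, ?_, ?_, ?_⟩
  · intro x ζ _ ε hε
    refine Finset.sum_eq_zero fun τ _ => ?_
    rw [signCoeff_eq_zero, zero_mul]
    rwa [hε₀, card_minusFirst h]
  · intro x ζ hζ
    have hinj : ∀ i j, i ≠ j → sq ζ i ≠ sq ζ j := fun i j hij => (hζ.2 i j hij).1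
    have h1 := bracketVec_minusFirst (q := q) hmf (hFs x) hinj
    rw [← hc] at h1
    change bracketVec q ε₀ (F x) ζ ε₀ = _
    rw [h1, prod_minus_eq_prod_headPart h, Finset.prod_mul_distrib]
    have h2 := headConst_ne_zero hq ε₀
    have h3 := headWeight_ne_zero hq ε₀ (v := sq ζ) hζ.2
    change _ = D x (headPart h (sq ζ)) (tailPart h (sq ζ)) *
      ((∏ j, headPart h ζ j) * G (headPart h (sq ζ)) (tailPart h (sq ζ)))
    simp only [hF]
    clear_value G
    field_simp
  · intro x ζ hζ i j hij
    exact bracketVec_exchange ε₀ (F x) hζ hij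

end IsBracket

/-! ### The action of `e_1` -/

section ActionOfE

variable {N : ℕ} {q : ℂ}

/-- The eigenvalue of `t ⊗ ⋯ ⊗ t` on the factors to the left of `k`. -/
def leftEig (q : ℂ) (ε : Fin N → Bool) (k : Fin N) : ℂ :=
  ∏ i ∈ Finset.univ.filter (· < k), t1Eig q (ε i)

theorem e1Act_apply (ζ : Fin N → ℂ) (u : Tens N) (ε : Fin N → Bool) :
    e1Act q ζ u ε = ∑ k, leftEig q ε k *
      (if ε k = true then ζ k * u (Function.update ε k false) else 0) := by
  rw [e1Act]
  refine Finset.sum_congr rfl fun k _ => ?_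
  rw [leftEig]
  congr 1
  rw [Fintype.sum_bool]
  cases h : ε k <;> simp [e1Mat]

theorem sum_eq_others {i j : Fin N} (hij : i ≠ j) (f : Fin N → ℂ) :
    ∑ p, f p = f i + f j + ∑ p ∈ others i j, f p := by
  rw [others, add_assoc, Finset.add_sum_erase _ _ (Finset.mem_erase.2 ⟨hij.symm, Finset.mem_univ j⟩),
    Finset.add_sum_erase _ _ (Finset.mem_univ i)]

theorem leftEig_right {i j : Fin N} (hij : (i : ℕ) + 1 = j) (ε : Fin N → Bool) :
    leftEig q ε j = leftEig q ε i * t1Eig q (ε i) := by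
  have : Finset.univ.filter (· < j) = insert i (Finset.univ.filter (· < i)) := by
    ext p
    simp only [Finset.mem_filter, Finset.mem_univ, true_and, Finset.mem_insert, Fin.lt_def,
      Fin.ext_iff]
    omega
  rw [leftEig, this, Finset.prod_insert (by simp), mul_comm, leftEig]

theorem leftEig_swap_left {i j : Fin N} (hij : (i : ℕ) + 1 = j) (ε : Fin N → Bool) :
    leftEig q (ε ∘ Equiv.swap i j) i = leftEig q ε i := by
  refine Finset.prod_congr rfl fun p hp => ?_
  have hp := (Finset.mem_filter.1 hp).2
  rw [Function.comp_apply, Equiv.swap_apply_of_ne_of_ne]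
  · exact hp.ne
  · rw [Fin.lt_def] at hp
    rw [ne_eq, Fin.ext_iff]
    omega

theorem leftEig_swap_others {i j k : Fin N} (hij : (i : ℕ) + 1 = j) (hk : k ∈ others i j)
    (ε : Fin N → Bool) : leftEig q (ε ∘ Equiv.swap i j) k = leftEig q ε k := by
  rw [leftEig, leftEig, Finset.prod_filter, Finset.prod_filter,
    ← Equiv.prod_comp (Equiv.swap i j)]
  refine Finset.prod_congr rfl fun p _ => ?_
  obtain ⟨h1, h2, h3⟩ := lt_iff_of_mem_others hij hk
  have : (Equiv.swap i j p < k) ↔ p < k := by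
    by_cases hp : p = i
    · rw [hp, Equiv.swap_apply_left, h2, h3]
    · by_cases hp' : p = j
      · rw [hp', Equiv.swap_apply_right, h2, h3]
      · rw [Equiv.swap_apply_of_ne_of_ne hp hp']
  simp only [Function.comp_apply, Equiv.swap_apply_self, this]

theorem Rmat_coeffs {s t : ℂ} (ht : t ≠ 0) (hgen : t ^ 2 ≠ q ^ 2 * s ^ 2) :
    ∃ e, (t ^ 2 - q ^ 2 * s ^ 2) * e = 1 ∧
      (1 - (s / t) ^ 2) * q / (1 - q ^ 2 * (s / t) ^ 2) = (t ^ 2 - s ^ 2) * q * e ∧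
      (1 - q ^ 2) * (s / t) / (1 - q ^ 2 * (s / t) ^ 2) = (1 - q ^ 2) * s * t * e := by
  have h1 : t ^ 2 - q ^ 2 * s ^ 2 ≠ 0 := sub_ne_zero.2 hgen
  have h2 : 1 - q ^ 2 * (s / t) ^ 2 = (t ^ 2 - q ^ 2 * s ^ 2) / t ^ 2 := by field_simp
  refine ⟨(t ^ 2 - q ^ 2 * s ^ 2)⁻¹, mul_inv_cancel₀ h1, ?_, ?_⟩ <;> · rw [h2]; field_simp

/-- The action of `e_1` commutes with the exchange relation. -/
theorem e1Act_exchange (hq : q ≠ 0) {i j : Fin N} (hij : (i : ℕ) + 1 = j) {ζ : Fin N → ℂ}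
    (h0 : ζ j ≠ 0) (hgen : ζ j ^ 2 ≠ q ^ 2 * ζ i ^ 2) {u u' : Tens N}
    (h : PAct i j u' = RAct q (ζ i / ζ j) i j u) :
    PAct i j (e1Act q (ζ ∘ Equiv.swap i j) u') =
      RAct q (ζ i / ζ j) i j (e1Act q ζ u) := by
  have hne : i ≠ j := by intro h; rw [h] at hij; omega
  obtain ⟨e, he, hα, hβ⟩ := Rmat_coeffs (q := q) h0 hgen
  have hss : ∀ p, Equiv.swap i j (Equiv.swap i j p) = p := fun p => by simp
  have hu : ∀ η, u' (η ∘ Equiv.swap i j) = RAct q (ζ i / ζ j) i j u η := fun η => congrFun h η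
  have hupd : ∀ (ε : Fin N → Bool) k,
      Function.update (ε ∘ Equiv.swap i j) (Equiv.swap i j k) false =
        Function.update ε k false ∘ Equiv.swap i j := by
    intro ε k
    funext p
    simp only [Function.comp_apply, Function.update_apply]
    have : p = Equiv.swap i j k ↔ Equiv.swap i j p = k :=
      ⟨fun h => by rw [h, hss], fun h => by rw [← h, hss]⟩
    simp only [this]
  have hupd' : ∀ (ε : Fin N → Bool) k, k ∈ others i j →
      Function.update (ε ∘ Equiv.swap i j) k false =
        Function.update ε k false ∘ Equiv.swap i j := by
    intro ε k hk
    rw [← hupd, swap_of_mem_others hk]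
  funext ε
  -- Terms of e_1 at sites k other than i, j commute with R_{ij}, since the sign changed lies
  -- elsewhere and the eigenvalue to the left of k is invariant under the swap. Only the terms at i
  -- and j need the entries of R.
  have hL : PAct i j (e1Act q (ζ ∘ Equiv.swap i j) u') ε =
      leftEig q ε i * t1Eig q (ε j) * (if ε i = true then ζ i *
        RAct q (ζ i / ζ j) i j u (Function.update ε i false) else 0) +
      leftEig q ε i * (if ε j = true then ζ j *
        RAct q (ζ i / ζ j) i j u (Function.update ε j false) else 0) +
      ∑ k ∈ others i j, leftEig q ε k * (if ε k = true then ζ k *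
        RAct q (ζ i / ζ j) i j u (Function.update ε k false) else 0) := by
    rw [PAct, e1Act_apply, ← Equiv.sum_comp (Equiv.swap i j), sum_eq_others hne]
    simp only [hupd, hu, Function.comp_apply, hss]
    congr 1
    · rw [Equiv.swap_apply_left, Equiv.swap_apply_right, leftEig_right hij, leftEig_swap_left hij,
        Function.comp_apply, Equiv.swap_apply_left]
    · refine Finset.sum_congr rfl fun k hk => ?_
      rw [swap_of_mem_others hk, leftEig_swap_others hij hk]
  have hR : ∀ ε : Fin N → Bool, e1Act q ζ u ε =
      leftEig q ε i * (if ε i = true then ζ i * u (Function.update ε i false) else 0) +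
      leftEig q ε i * t1Eig q (ε i) *
        (if ε j = true then ζ j * u (Function.update ε j false) else 0) +
      ∑ k ∈ others i j, leftEig q ε k *
        (if ε k = true then ζ k * u (Function.update ε k false) else 0) := by
    intro ε
    rw [e1Act_apply, sum_eq_others hne, leftEig_right hij]
  have hij_upd : ∀ k, k ∈ others i j → Function.update ε k false i = ε i ∧
      Function.update ε k false j = ε j := by
    intro k hk
    simp only [others, Finset.mem_erase] at hk
    exact ⟨Function.update_of_ne (Ne.symm hk.2.1) _ _, Function.update_of_ne (Ne.symm hk.1) _ _⟩
  rw [hL]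
  by_cases hε : ε i = ε j
  · rw [RAct_of_eq _ _ _ hε, hR]
    congr 1
    · rcases hi : ε i
      · have hj : ε j = false := hε ▸ hi
        simp [hj]
      · have hj : ε j = true := hε ▸ hi
        have h1 : Function.update ε i false i ≠ Function.update ε i false j := by
          simp [hne.symm, hj]
        have h2 : Function.update ε j false i ≠ Function.update ε j false j := by
          simp [hne, hi]
        have h3 : Function.update ε i false ∘ Equiv.swap i j = Function.update ε j false := by
          rw [← hupd, Equiv.swap_apply_left, comp_swap_of_eq hε]
        have h4 : Function.update ε j false ∘ Equiv.swap i j = Function.update ε i false := by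
          rw [← hupd, Equiv.swap_apply_right, comp_swap_of_eq hε]
        rw [RAct_of_ne _ _ _ h1, RAct_of_ne _ _ _ h2, hα, hβ, h3, h4, hj]
        simp only [t1Eig, if_true]
        linear_combination leftEig q ε i * (ζ i * u (Function.update ε i false) +
          q * ζ j * u (Function.update ε j false)) * he
    · refine Finset.sum_congr rfl fun k hk => ?_
      obtain ⟨h1, h2⟩ := hij_upd k hk
      rw [RAct_of_eq _ _ _ (by rw [h1, h2, hε])]
  · rw [RAct_of_ne _ _ _ hε, hα, hβ, hR, hR, leftEig_swap_left hij]
    have hoth : ∑ k ∈ others i j, leftEig q ε k * (if ε k = true then ζ k *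
          RAct q (ζ i / ζ j) i j u (Function.update ε k false) else 0) =
        (ζ j ^ 2 - ζ i ^ 2) * q * e * ∑ k ∈ others i j, leftEig q ε k *
          (if ε k = true then ζ k * u (Function.update ε k false) else 0) +
        (1 - q ^ 2) * ζ i * ζ j * e * ∑ k ∈ others i j, leftEig q (ε ∘ Equiv.swap i j) k *
          (if (ε ∘ Equiv.swap i j) k = true then
            ζ k * u (Function.update (ε ∘ Equiv.swap i j) k false) else 0) := by
      rw [Finset.mul_sum, Finset.mul_sum, ← Finset.sum_add_distrib]
      refine Finset.sum_congr rfl fun k hk => ?_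
      obtain ⟨h1, h2⟩ := hij_upd k hk
      rw [RAct_of_ne _ _ _ (by rwa [h1, h2]), hα, hβ, leftEig_swap_others hij hk, hupd' _ _ hk,
        Function.comp_apply, swap_of_mem_others hk]
      split_ifs <;> ring
    rw [hoth]
    simp only [Function.comp_apply, Equiv.swap_apply_left, Equiv.swap_apply_right]
    rcases hi : ε i <;> rcases hj : ε j
    · exact absurd (hi.trans hj.symm) hε
    · have h1 : Function.update (ε ∘ Equiv.swap i j) i false = Function.update ε j false := by
        funext p
        by_cases hp : p = i
        · rw [hp]; simp [hne, hi]
        · by_cases hp' : p = j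
          · rw [hp']; simp [hne.symm, hi]
          · simp [hp, hp', Equiv.swap_apply_of_ne_of_ne hp hp']
      have h2 : Function.update ε j false i = Function.update ε j false j := by
        simp [hne, hi]
      rw [h1, RAct_of_eq _ _ _ h2]
      simp only [t1Eig, if_true, if_false, reduceCtorEq]
      obtain ⟨r, hr⟩ : ∃ r, q * r = 1 := ⟨q⁻¹, mul_inv_cancel₀ hq⟩
      rw [show q⁻¹ = r from (eq_inv_of_mul_eq_one_right hr).symm]
      linear_combination (-(leftEig q ε i * ζ j * u (Function.update ε j false))) * he
        - leftEig q ε i * ζ j * u (Function.update ε j false) * (ζ j ^ 2 - ζ i ^ 2) * e * hr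
    · have h1 : Function.update (ε ∘ Equiv.swap i j) j false = Function.update ε i false := by
        funext p
        by_cases hp : p = i
        · rw [hp]; simp [hne, hj]
        · by_cases hp' : p = j
          · rw [hp']; simp [hne.symm, hj]
          · simp [hp, hp', Equiv.swap_apply_of_ne_of_ne hp hp']
      have h2 : Function.update ε i false i = Function.update ε i false j := by
        simp [hne.symm, hj]
      rw [h1, RAct_of_eq _ _ _ h2]
      simp only [t1Eig, if_true, if_false, reduceCtorEq]
      obtain ⟨r, hr⟩ : ∃ r, q * r = 1 := ⟨q⁻¹, mul_inv_cancel₀ hq⟩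
      rw [show q⁻¹ = r from (eq_inv_of_mul_eq_one_right hr).symm]
      linear_combination (-(leftEig q ε i * r * ζ i * u (Function.update ε i false))) * he
        + leftEig q ε i * ζ i * u (Function.update ε i false) * (ζ j ^ 2 - ζ i ^ 2) * q * e * hr
    · exact absurd (hi.trans hj.symm) hε

/-- The action of `e_1` turns one sign `-` into `+`. -/
theorem e1Act_weight {n : ℕ} {ζ : Fin N → ℂ} {u : Tens N}
    (h : ∀ ε : Fin N → Bool, (Finset.univ.filter fun i => ε i = false).card ≠ n + 1 → u ε = 0)
    {ε : Fin N → Bool} (hε : (Finset.univ.filter fun i => ε i = false).card ≠ n) :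
    e1Act q ζ u ε = 0 := by
  rw [e1Act_apply]
  refine Finset.sum_eq_zero fun k _ => ?_
  split_ifs with hk
  · rw [h, mul_zero, mul_zero]
    have : (Finset.univ.filter fun i => Function.update ε k false i = false) =
        insert k (Finset.univ.filter fun i => ε i = false) := by
      ext p
      by_cases hp : p = k <;> simp [hp, Function.update_apply]
    rw [this, Finset.card_insert_of_notMem (by simp [hk])]
    omega
  · rw [mul_zero]

end ActionOfE

/-! ### The extreme component of the image under `e_1` -/

/-- Adding a last site multiplies all earlier site factors by q (t - z_L), and the new term supplies
exactly the increment of the right-hand side. -/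
theorem sum_siteFactor (q t : ℂ) {L : ℕ} (z : Fin L → ℂ) :
    q * (1 - q ^ 2) * ∑ r : Fin L, q ^ (r : ℕ) * (z r * siteFactor q z r t) =
      q ^ L * ((∏ i, (t - q ^ 2 * z i)) - ∏ i, (t - z i)) := by
  induction L with
  | zero => simp
  | succ L ih =>
    have h1 : ∀ r : Fin L, siteFactor q z r.castSucc t =
        siteFactor q (Fin.init z) r t * (q * (t - z (Fin.last L))) := by
      intro r
      rw [siteFactor, Fin.prod_univ_castSucc, siteFactor]
      simp [Fin.castSucc_lt_last, Fin.init]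
    have h2 : siteFactor q z (Fin.last L) t = ∏ i : Fin L, (t - q ^ 2 * z i.castSucc) := by
      rw [siteFactor, Fin.prod_univ_castSucc]
      simp only [lt_irrefl, if_false, mul_one]
      refine Finset.prod_congr rfl fun i _ => ?_
      simp [Fin.castSucc_lt_last, (Fin.castSucc_lt_last i).not_gt]
    have ih := ih (Fin.init z)
    rw [Fin.sum_univ_castSucc, h2, Fin.prod_univ_castSucc, Fin.prod_univ_castSucc]
    simp only [h1, Fin.val_castSucc, Fin.val_last]
    have h3 : ∑ r : Fin L, q ^ (r : ℕ) * (z r.castSucc *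
        (siteFactor q (Fin.init z) r t * (q * (t - z (Fin.last L))))) =
        q * (t - z (Fin.last L)) * ∑ r : Fin L, q ^ (r : ℕ) * (Fin.init z r *
          siteFactor q (Fin.init z) r t) := by
      rw [Finset.mul_sum]
      refine Finset.sum_congr rfl fun r _ => ?_
      simp only [Fin.init]
      ring
    rw [h3]
    simp only [Fin.init] at ih ⊢
    rw [pow_succ q L]
    linear_combination q * (t - z (Fin.last L)) * ih

theorem exists_perm_succAbove {l : ℕ} (σ : Equiv.Perm (Fin (l + 1))) (m : Fin (l + 1)) :
    ∃ ρ : Equiv.Perm (Fin l), ∀ i, σ (m.succAbove i) = (σ m).succAbove (ρ i) := by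
  have h : ∀ i, ∃ j, (σ m).succAbove j = σ (m.succAbove i) := fun i =>
    Fin.exists_succAbove_eq fun h => Fin.succAbove_ne m i (σ.injective h)
  choose f hf using h
  have hinj : Function.Injective f := by
    intro i j hij
    have := (hf i).symm.trans ((congrArg _ hij).trans (hf j))
    exact Fin.succAbove_right_injective (σ.injective this)
  exact ⟨Equiv.ofBijective f (Finite.injective_iff_bijective.1 hinj), fun i => (hf i).symm⟩

section Extreme

variable {k l N : ℕ} {q : ℂ}

/-- The coefficient of the `m`-th term in the components with one moving sign `-`. -/
def moveCoeff (q : ℂ) (D : (Fin (k + 1) → ℂ) → (Fin l → ℂ) → ℂ) (a : Fin k → ℂ)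
    (b : Fin (l + 1) → ℂ) (m : Fin (l + 1)) : ℂ :=
  D (Fin.snoc a (b m)) (b ∘ m.succAbove) *
    (∏ j, ∏ i, (b (m.succAbove i) - a j * (q ^ 2)⁻¹)⁻¹) *
    (∏ i, (b (m.succAbove i) - b m * (q ^ 2)⁻¹)⁻¹) * ∏ i, (q * (b m - b (m.succAbove i)))⁻¹

theorem moveCoeff_perm {D : (Fin (k + 1) → ℂ) → (Fin l → ℂ) → ℂ}
    (hr : ∀ a b (σ : Equiv.Perm (Fin l)), D a (b ∘ σ) = D a b) (a : Fin k → ℂ)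
    (b : Fin (l + 1) → ℂ) (σ : Equiv.Perm (Fin (l + 1))) (m : Fin (l + 1)) :
    moveCoeff q D a (b ∘ σ) m = moveCoeff q D a b (σ m) := by
  obtain ⟨ρ, hρ⟩ := exists_perm_succAbove σ m
  have h1 : (b ∘ σ) ∘ m.succAbove = (b ∘ (σ m).succAbove) ∘ ρ := by
    funext i; simp [hρ]
  have h2 : ∀ i, (b ∘ σ) (m.succAbove i) = b ((σ m).succAbove (ρ i)) := fun i => by simp [hρ]
  rw [moveCoeff, moveCoeff, h1, hr]
  simp only [h2, Function.comp_apply]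
  congr 1
  · congr 1
    · congr 1
      refine Finset.prod_congr rfl fun j _ => ?_
      exact Equiv.prod_comp ρ fun i => (b ((σ m).succAbove i) - a j * (q ^ 2)⁻¹)⁻¹
    · exact Equiv.prod_comp ρ fun i => (b ((σ m).succAbove i) - b (σ m) * (q ^ 2)⁻¹)⁻¹
  · exact Equiv.prod_comp ρ fun i => (q * (b (σ m) - b ((σ m).succAbove i)))⁻¹

/-- The signs with `-` at the first `k` sites and at the site `k + r`. -/
def moveSigns (k : ℕ) (N : ℕ) (r : ℕ) : Fin N → Bool :=
  fun i => decide (k ≤ (i : ℕ) ∧ (i : ℕ) ≠ k + r)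

theorem headPart_eq_snoc (hN : k + 1 + l = N) (hN' : k + (l + 1) = N) (z : Fin N → ℂ) :
    headPart hN z = Fin.snoc (headPart hN' z) (tailPart hN' z 0) := by
  funext j
  refine Fin.lastCases ?_ (fun j => ?_) j
  · rw [Fin.snoc_last]; rfl
  · rw [Fin.snoc_castSucc]; rfl

theorem tailPart_eq_succ (hN : k + 1 + l = N) (hN' : k + (l + 1) = N) (z : Fin N → ℂ) :
    tailPart hN z = tailPart hN' z ∘ Fin.succ := by
  funext j
  simp only [tailPart, Function.comp_apply]
  congr 1
  apply Fin.ext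
  simp only [Fin.val_succ]
  omega

theorem siteFactor_zero_eq_zero (z : Fin (l + 1) → ℂ) {m : Fin (l + 1)} (hm : m ≠ 0) :
    siteFactor q z 0 (z m) = 0 := by
  rw [siteFactor, Finset.prod_eq_zero (Finset.mem_univ m)]
  simp [Fin.pos_iff_ne_zero.2 hm]

/-- Induction on r, solving the exchange relation at the sites k + r, k + r + 1 for the component
whose sign - is one place further to the right. The shape of the sum persists because `moveCoeff` is
covariant under permutations of b and the site factors obey the one-variable exchange relation. At r
= 0 only the term m = 0 survives, and it is the extreme component. -/
theorem IsBracket.moving_component (hq : q ≠ 0) {m : ℕ} {hN : k + 1 + l = N}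
    (hN' : k + (l + 1) = N) {D : (Fin m → ℂ) → (Fin (k + 1) → ℂ) → (Fin l → ℂ) → ℂ}
    (hr : ∀ x a b (σ : Equiv.Perm (Fin l)), D x a (b ∘ σ) = D x a b)
    {w : (Fin m → ℂ) → (Fin N → ℂ) → Tens N} (hw : IsBracket q hN D w) (x : Fin m → ℂ)
    (r : ℕ) (hrl : r < l + 1) : ∀ ζ, Generic q ζ →
    w x ζ (moveSigns k N r) = (∏ j, headPart hN' ζ j) * tailPart hN' ζ ⟨r, hrl⟩ *
      ∑ m, moveCoeff q (D x) (headPart hN' (sq ζ)) (tailPart hN' (sq ζ)) m *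
        siteFactor q (tailPart hN' (sq ζ)) ⟨r, hrl⟩ (tailPart hN' (sq ζ) m) := by
  induction r with
  | zero =>
    intro ζ hζ
    have hsign : moveSigns k N 0 = fun i : Fin N => decide (k + 1 ≤ (i : ℕ)) := by
      funext i
      simp only [moveSigns]
      congr 1
      rw [eq_iff_iff]
      omega
    rw [hsign, hw.extreme x ζ hζ, headPart_eq_snoc hN hN', headPart_eq_snoc hN hN',
      tailPart_eq_succ hN hN', Finset.sum_eq_single 0]
    · simp only [Fin.prod_univ_castSucc, Fin.snoc_castSucc, Fin.snoc_last,
        Finset.prod_mul_distrib]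
      set a := headPart hN' (sq ζ) with ha
      set b := tailPart hN' (sq ζ) with hb
      have hsf : siteFactor q b ⟨0, hrl⟩ (b 0) * ∏ i : Fin l, (q * (b 0 - b i.succ))⁻¹ = 1 := by
        have h1 : siteFactor q b ⟨0, hrl⟩ (b 0) = ∏ i : Fin l, (q * (b 0 - b i.succ)) := by
          rw [siteFactor, Fin.prod_univ_succ]
          simp only [Fin.mk_zero, lt_irrefl, if_false, one_mul, Fin.succ_pos, if_true]
        rw [h1, ← Finset.prod_mul_distrib]
        refine Finset.prod_eq_one fun i _ => mul_inv_cancel₀ (mul_ne_zero hq (sub_ne_zero.2 ?_))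
        refine (hζ.2 _ _ ?_).1
        simp [Fin.ext_iff]
      rw [moveCoeff, Fin.succAbove_zero]
      have h0 : tailPart hN' ζ ⟨0, hrl⟩ = tailPart hN' ζ 0 := rfl
      rw [h0]
      simp only [Function.comp_apply]
      linear_combination (-(D x (Fin.snoc a (b 0)) (b ∘ Fin.succ)) *
        (∏ j, ∏ i : Fin l, (b i.succ - a j * (q ^ 2)⁻¹)⁻¹) *
        (∏ i : Fin l, (b i.succ - b 0 * (q ^ 2)⁻¹)⁻¹) * (∏ j, headPart hN' ζ j) *
        tailPart hN' ζ 0) * hsf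
    · intro m' _ hm
      rw [show (⟨0, hrl⟩ : Fin (l + 1)) = 0 from rfl, siteFactor_zero_eq_zero _ hm, mul_zero]
    · simp
  | succ r ih =>
    intro ζ hζ
    have hrl' : r < l + 1 := by omega
    set i : Fin N := ⟨k + r, by omega⟩ with hi
    set j : Fin N := ⟨k + (r + 1), by omega⟩ with hj
    have hij : (i : ℕ) + 1 = j := by simp only [hi, hj]; omega
    have hne : i ≠ j := by intro h; rw [h] at hij; omega
    set i' : Fin (l + 1) := ⟨r, hrl'⟩ with hi'
    set j' : Fin (l + 1) := ⟨r + 1, hrl⟩ with hj'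
    have hij' : (i' : ℕ) + 1 = j' := rfl
    have hsw : ∀ z : Fin N → ℂ, tailPart hN' (z ∘ Equiv.swap i j) =
        tailPart hN' z ∘ Equiv.swap i' j' := by
      intro z
      funext p
      simp only [tailPart, Function.comp_apply]
      congr 1
      simp only [Equiv.swap_apply_def, hi, hj, hi', hj', Fin.ext_iff]
      split_ifs <;> first | rfl | (exfalso; omega)
    have hsh : ∀ z : Fin N → ℂ, headPart hN' (z ∘ Equiv.swap i j) = headPart hN' z := by
      intro z
      funext p
      simp only [headPart, Function.comp_apply]
      congr 1
      apply Equiv.swap_apply_of_ne_of_ne <;> simp only [hi, hj, ne_eq, Fin.ext_iff] <;> omega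
    have hgen' : Generic q (ζ ∘ Equiv.swap i j) :=
      ⟨fun p => hζ.1 _, fun p p' hp => hζ.2 _ _ ((Equiv.swap i j).injective.ne hp)⟩
    have hR := congrFun (hw.Rsymm x ζ hζ i j hij) (moveSigns k N (r + 1))
    have hε1 : moveSigns k N (r + 1) i = true := by
      simp [moveSigns, hi]
    have hε2 : moveSigns k N (r + 1) j = false := by
      simp [moveSigns, hj]
    have hεs : moveSigns k N (r + 1) ∘ Equiv.swap i j = moveSigns k N r := by
      funext p
      simp only [Function.comp_apply, Equiv.swap_apply_def, moveSigns]
      split_ifs with h1 h2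
      · simp [h1, hi, hj]
      · simp [h2, hi, hj]
      · have h1' : (p : ℕ) ≠ k + r := fun h => h1 (Fin.ext h)
        have h2' : (p : ℕ) ≠ k + (r + 1) := fun h => h2 (Fin.ext h)
        simp [h1', h2']
    obtain ⟨e, he, hα, hβ⟩ := Rmat_coeffs (q := q) (hζ.1 j) (hζ.2 j i hne.symm).2
    rw [RAct_of_ne _ _ _ (by rw [hε1, hε2]; decide), PAct, hεs, ih hrl' _ hgen', ih hrl' _ hζ,
      hα, hβ, hsw, hsh, show sq (ζ ∘ Equiv.swap i j) = sq ζ ∘ Equiv.swap i j from rfl, hsw,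
      hsh] at hR
    set a := headPart hN' (sq ζ) with ha
    set b := tailPart hN' (sq ζ) with hb
    rw [← hi'] at hR
    have hti : tailPart hN' ζ i' = ζ i := rfl
    have htj : tailPart hN' ζ j' = ζ j := rfl
    have hbi : b i' = ζ i ^ 2 := rfl
    have hbj : b j' = ζ j ^ 2 := rfl
    have hsum : ∑ m, moveCoeff q (D x) a (b ∘ Equiv.swap i' j') m *
          siteFactor q (b ∘ Equiv.swap i' j') i' ((b ∘ Equiv.swap i' j') m) =
        ∑ m, moveCoeff q (D x) a b m *
          (q * (b m - ζ i ^ 2) * outerSite q i' j' b (b m)) := by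
      rw [← Equiv.sum_comp (Equiv.swap i' j') (fun m => moveCoeff q (D x) a b m *
          (q * (b m - ζ i ^ 2) * outerSite q i' j' b (b m)))]
      refine Finset.sum_congr rfl fun m _ => ?_
      rw [moveCoeff_perm (hr x), siteFactor_left hij', outerSite_swap, Function.comp_apply,
        Function.comp_apply, Equiv.swap_apply_right, hbi]
    rw [hsum, Function.comp_apply, Equiv.swap_apply_left, hti, htj] at hR
    rw [htj]
    simp only [siteFactor_left hij', siteFactor_right hij', hbi, hbj] at hR ⊢
    -- The diagonal entry of R, which multiplies the unknown component.
    have hαne : (ζ j ^ 2 - ζ i ^ 2) * q * e ≠ 0 := by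
      refine mul_ne_zero (mul_ne_zero (sub_ne_zero.2 (hζ.2 j i hne.symm).1) hq) ?_
      rintro rfl
      simp at he
    apply mul_left_cancel₀ hαne
    have hfin : (∏ p, headPart hN' ζ p) * ζ j * ∑ m, moveCoeff q (D x) a b m *
          (q * (b m - ζ i ^ 2) * outerSite q i' j' b (b m)) =
        (ζ j ^ 2 - ζ i ^ 2) * q * e * ((∏ p, headPart hN' ζ p) * ζ j *
          ∑ m, moveCoeff q (D x) a b m *
            ((b m - q ^ 2 * ζ i ^ 2) * outerSite q i' j' b (b m))) +
        (1 - q ^ 2) * ζ i * ζ j * e * ((∏ p, headPart hN' ζ p) * ζ i *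
          ∑ m, moveCoeff q (D x) a b m *
            (q * (b m - ζ j ^ 2) * outerSite q i' j' b (b m))) := by
      simp only [Finset.mul_sum, ← Finset.sum_add_distrib]
      refine Finset.sum_congr rfl fun m _ => ?_
      linear_combination (-((∏ p, headPart hN' ζ p) * ζ j * (moveCoeff q (D x) a b m *
        (q * (b m - ζ i ^ 2) * outerSite q i' j' b (b m))))) * he
    linear_combination hfin - hR

theorem leftEig_tail (hN' : k + (l + 1) = N) (r : Fin (l + 1)) :
    leftEig q (fun i : Fin N => decide (k ≤ (i : ℕ))) ⟨k + r, by omega⟩ =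
      q⁻¹ ^ k * q ^ (r : ℕ) := by
  subst hN'
  rw [leftEig, Finset.prod_filter, Fin.prod_univ_add]
  congr 1
  · rw [← Fin.prod_const]
    refine Finset.prod_congr rfl fun i _ => ?_
    have h1 : (Fin.castAdd (l + 1) i : Fin (k + (l + 1))) < ⟨k + r, by omega⟩ := by
      rw [Fin.lt_def]
      simp only [Fin.val_castAdd]
      omega
    have h2 : ¬ k ≤ (i : ℕ) := by omega
    rw [if_pos h1]
    simp [t1Eig, h2]
  · have : ∀ i : Fin (l + 1), (if (Fin.natAdd k i : Fin (k + (l + 1))) < ⟨k + r, by omega⟩ then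
        t1Eig q (decide (k ≤ ((Fin.natAdd k i : Fin (k + (l + 1))) : ℕ))) else 1) =
        if i < r then q else 1 := by
      intro i
      have : (Fin.natAdd k i : Fin (k + (l + 1))) < ⟨k + r, by omega⟩ ↔ i < r := by
        rw [Fin.lt_def, Fin.lt_def]
        simp
      simp only [this]
      simp [t1Eig]
    rw [Finset.prod_congr rfl fun i _ => this i, ← Finset.prod_filter, Finset.prod_const,
      Finset.filter_gt_eq_Iio, Fin.card_Iio]

/-- The component is the sum over r of the moving components with weights q^{r-k} ζ_{k+r}. After
interchanging the sums over r and m, `sum_siteFactor` at t = b_m evaluates the inner one, the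
product ∏_i (b_m - b_i) being zero. One factor q^l comes from there, the other from cancelling the
denominators of `moveCoeff`. -/
theorem IsBracket.e1Act_extreme (hq : q ≠ 0) (hq2 : q ^ 2 ≠ 1) {m : ℕ} {hN : k + 1 + l = N}
    (hN' : k + (l + 1) = N) {D : (Fin m → ℂ) → (Fin (k + 1) → ℂ) → (Fin l → ℂ) → ℂ}
    (hr : ∀ x a b (σ : Equiv.Perm (Fin l)), D x a (b ∘ σ) = D x a b)
    {w : (Fin m → ℂ) → (Fin N → ℂ) → Tens N} (hw : IsBracket q hN D w) (x : Fin m → ℂ)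
    {ζ : Fin N → ℂ} (hζ : Generic q ζ) {a : Fin k → ℂ} (ha : a = headPart hN' (sq ζ))
    {b : Fin (l + 1) → ℂ} (hb : b = tailPart hN' (sq ζ)) :
    e1Act q ζ (w x ζ) (fun i => decide (k ≤ (i : ℕ))) =
      q ^ (2 * l) * q⁻¹ ^ k * (∑ m, b m * (∏ j, (b m - a j * (q ^ 2)⁻¹)) *
        (∏ i, (b (m.succAbove i) - b m)⁻¹) * D x (Fin.snoc a (b m)) (b ∘ m.succAbove)) *
      ∏ j, (headPart hN' ζ j * ∏ i, (b i - a j * (q ^ 2)⁻¹)⁻¹) := by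
  have hbinj : ∀ p p', p ≠ p' → b p ≠ b p' ∧ b p ≠ q ^ 2 * b p' := by
    intro p p' hp
    rw [hb]
    exact hζ.2 _ _ (by simpa [Fin.ext_iff] using hp)
  have hab : ∀ p j, b p - a j * (q ^ 2)⁻¹ ≠ 0 := by
    intro p j h
    rw [ha, hb] at h
    have h1 := (hζ.2 ⟨j, by omega⟩ ⟨k + p, by omega⟩ (by simp [Fin.ext_iff]; omega)).2
    apply h1
    have h2 : sq ζ ⟨k + p, by omega⟩ = sq ζ ⟨j, by omega⟩ * (q ^ 2)⁻¹ := sub_eq_zero.1 h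
    have h3 : ζ ⟨k + p, by omega⟩ ^ 2 = ζ ⟨j, by omega⟩ ^ 2 * (q ^ 2)⁻¹ := h2
    rw [h3]
    field_simp
  have hcomp : ∀ r : Fin (l + 1), w x ζ (moveSigns k N r) =
      (∏ j, headPart hN' ζ j) * tailPart hN' ζ r *
      ∑ m, moveCoeff q (D x) a b m * siteFactor q b r (b m) := by
    intro r
    rw [ha, hb]
    exact hw.moving_component hq hN' hr x r r.2 ζ hζ
  have hsum : e1Act q ζ (w x ζ) (fun i => decide (k ≤ (i : ℕ))) =
      ∑ r : Fin (l + 1), q⁻¹ ^ k * q ^ (r : ℕ) *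
        (tailPart hN' ζ r * w x ζ (moveSigns k N r)) := by
    have hterm : ∀ r : Fin (l + 1),
        leftEig q (fun i : Fin N => decide (k ≤ (i : ℕ))) ⟨k + r, by omega⟩ *
          (ζ ⟨k + r, by omega⟩ * w x ζ
            (Function.update (fun i : Fin N => decide (k ≤ (i : ℕ))) ⟨k + r, by omega⟩ false)) =
        q⁻¹ ^ k * q ^ (r : ℕ) * (tailPart hN' ζ r * w x ζ (moveSigns k N r)) := by
      intro r
      rw [leftEig_tail hN']
      congr 3
      funext i
      by_cases h : i = ⟨k + r, by omega⟩
      · rw [h]; simp [moveSigns]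
      · have h' : (i : ℕ) ≠ k + r := fun h' => h (Fin.ext h')
        simp [moveSigns, h, h']
    rw [e1Act_apply]
    subst hN'
    rw [Fin.sum_univ_add]
    rw [Finset.sum_eq_zero, zero_add]
    · refine Finset.sum_congr rfl fun r _ => ?_
      rw [← hterm r, if_pos (by simp)]
      rfl
    · intro i _
      have : ¬ k ≤ (i : ℕ) := by omega
      simp [this]
  have hbt : ∀ r, tailPart hN' ζ r * tailPart hN' ζ r = b r := by
    intro r
    rw [hb, ← pow_two]
    rfl
  have hswap : e1Act q ζ (w x ζ) (fun i => decide (k ≤ (i : ℕ))) =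
      ∑ m, q⁻¹ ^ k * (∏ j, headPart hN' ζ j) * moveCoeff q (D x) a b m *
        ∑ r : Fin (l + 1), q ^ (r : ℕ) * (b r * siteFactor q b r (b m)) := by
    rw [hsum]
    simp only [hcomp, Finset.mul_sum]
    rw [Finset.sum_comm]
    refine Finset.sum_congr rfl fun m _ => Finset.sum_congr rfl fun r _ => ?_
    rw [← hbt r]
    ring
  rw [hswap, mul_assoc, Finset.sum_mul, Finset.mul_sum]
  refine Finset.sum_congr rfl fun m _ => ?_
  have hS : ∑ r : Fin (l + 1), q ^ (r : ℕ) * (b r * siteFactor q b r (b m)) =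
      q ^ l * (b m * ∏ i, (b m - q ^ 2 * b (m.succAbove i))) := by
    have h := sum_siteFactor q (b m) b
    have h0 : ∏ i, (b m - b i) = 0 := Finset.prod_eq_zero (Finset.mem_univ m) (sub_self _)
    rw [h0, sub_zero, Fin.prod_univ_succAbove _ m] at h
    have hne : q * (1 - q ^ 2) ≠ 0 := mul_ne_zero hq (sub_ne_zero.2 hq2.symm)
    apply mul_left_cancel₀ hne
    rw [h]
    ring
  have hP : (∏ j, ∏ i, (b (m.succAbove i) - a j * (q ^ 2)⁻¹)⁻¹) =
      (∏ j, (b m - a j * (q ^ 2)⁻¹)) * ∏ j, ∏ i, (b i - a j * (q ^ 2)⁻¹)⁻¹ := by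
    rw [← Finset.prod_mul_distrib]
    refine Finset.prod_congr rfl fun j _ => ?_
    rw [Fin.prod_univ_succAbove _ m, mul_inv_cancel_left₀ (hab m j)]
  have hQ : (∏ i, (b (m.succAbove i) - b m * (q ^ 2)⁻¹)⁻¹) *
      (∏ i, (q * (b m - b (m.succAbove i)))⁻¹) *
      (∏ i, (b m - q ^ 2 * b (m.succAbove i))) =
      q ^ l * ∏ i, (b (m.succAbove i) - b m)⁻¹ := by
    rw [← Fin.prod_const l q, ← Finset.prod_mul_distrib, ← Finset.prod_mul_distrib,
      ← Finset.prod_mul_distrib]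
    refine Finset.prod_congr rfl fun i _ => ?_
    have hne := hbinj _ _ (Fin.succAbove_ne m i).symm
    have h1 : b m - q ^ 2 * b (m.succAbove i) ≠ 0 := sub_ne_zero.2 hne.2
    have h2 : b m - b (m.succAbove i) ≠ 0 := sub_ne_zero.2 hne.1
    have h3 : b (m.succAbove i) - b m ≠ 0 := sub_ne_zero.2 hne.1.symm
    have h4 : b (m.succAbove i) - b m * (q ^ 2)⁻¹ =
        -((b m - q ^ 2 * b (m.succAbove i)) * (q ^ 2)⁻¹) := by
      field_simp
      ring
    have h5 : b (m.succAbove i) - b m = -(b m - b (m.succAbove i)) := by ring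
    rw [h4, h5]
    field_simp
  rw [hS, moveCoeff, hP, Finset.prod_mul_distrib, two_mul l, pow_add]
  linear_combination q⁻¹ ^ k * (∏ j, headPart hN' ζ j) *
    (D x (Fin.snoc a (b m)) (b ∘ m.succAbove) * ((∏ j, (b m - a j * (q ^ 2)⁻¹)) *
      ∏ j, ∏ i, (b i - a j * (q ^ 2)⁻¹)⁻¹)) * (q ^ l * b m) * hQ

end Extreme

/-! ### The antisymmetrisation identity for `Δ^{(nl)}` -/

theorem DPoly.isHomPoly_val {τ : Type} {m n l d : ℕ} {P : DPoly m n l} (hP : P.IsHomogeneous d)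
    (πx : Fin m → τ) (πa : Fin n → τ) (πb : Fin l → τ) :
    IsHomPoly d fun v : τ → ℂ => P.val (v ∘ πx) (v ∘ πa) (v ∘ πb) := by
  have h : IsHomPoly d fun v => MvPolynomial.eval v P := ⟨P, hP, fun _ => rfl⟩
  have h2 := h.comp (Sum.elim πx (Sum.elim πa πb))
  convert h2 using 2 with v
  rw [DPoly.val, Sum.comp_elim, Sum.comp_elim]

/-- h depends only on the multiset of all z_j, so its value is the same for every m and can leave
the sum over m. -/
theorem hFun_snoc_succAbove (q : ℂ) (κ : ℕ → ℂ) {k l : ℕ} (x : ℂ) (a : Fin k → ℂ)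
    (b : Fin (l + 1) → ℂ) (m : Fin (l + 1)) :
    hFun q κ x (Sum.elim (Fin.snoc a (b m) : Fin (k + 1) → ℂ) (b ∘ m.succAbove)) =
      hFun q κ x (Sum.elim a b) := by
  have h1 : ∀ f : ℂ → Polynomial ℂ,
      ∏ j, f (Sum.elim (Fin.snoc a (b m) : Fin (k + 1) → ℂ) (b ∘ m.succAbove) j) =
        ∏ j, f (Sum.elim a b j) := by
    intro f
    rw [Fintype.prod_sum_type, Fintype.prod_sum_type]
    simp only [Sum.elim_inl, Sum.elim_inr, Function.comp_apply]
    rw [Fin.prod_univ_castSucc, Fin.prod_univ_succAbove (fun i => f (b i)) m]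
    simp only [Fin.snoc_castSucc, Fin.snoc_last]
    rw [mul_assoc]
  have h2 : Fintype.card (Fin (k + 1) ⊕ Fin l) = Fintype.card (Fin k ⊕ Fin (l + 1)) := by
    simp only [Fintype.card_sum, Fintype.card_fin]; omega
  simp only [hFun, h2, h1 fun t => (Polynomial.X - Polynomial.C (t * q⁻¹)),
    h1 fun t => (Polynomial.X - Polynomial.C (t * q))]

/-! ### The two sides of the identity: symmetries and degrees -/

section AlternatingSums

variable (q : ℂ) (Δ : (n l : ℕ) → DPoly n n l) {k l : ℕ}

/-- `∑_m (-1)^m V(b̂_m) b_m ∏_j (b_m - a_j q⁻²) Δ^{(k+1 l)}(x | a, b_m | b̂_m)`, where `V` is the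
Vandermonde product. -/
def altB (x : Fin (k + 1) → ℂ) (a : Fin k → ℂ) (b : Fin (l + 1) → ℂ) : ℂ :=
  wedgeSum (fun t b' => vand b' * (t * (∏ j, (t - a j * (q ^ 2)⁻¹)) *
    (Δ (k + 1) l).val x (Fin.snoc a t) b')) b

/-- `∑_ν (-1)^{k+ν} ∏_j (x_ν - a_j q⁻¹) Δ^{(k l+1)}(x̂_ν | a | b)`. -/
def altX (x : Fin (k + 1) → ℂ) (a : Fin k → ℂ) (b : Fin (l + 1) → ℂ) : ℂ :=
  (-1) ^ k * wedgeSum (fun s y => (∏ j, (s - a j * q⁻¹)) * (Δ k (l + 1)).val y a b) x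

variable {q Δ} {κ : ℕ → ℂ} (hΔ : IsDeltaFamily q κ Δ)

theorem altB_perm_b (hΔ : IsDeltaFamily q κ Δ) (hkl : k + 1 < l) (x : Fin (k + 1) → ℂ)
    (a : Fin k → ℂ) (b : Fin (l + 1) → ℂ) (σ : Equiv.Perm (Fin (l + 1))) :
    altB q Δ x a (b ∘ σ) = csign σ * altB q Δ x a b :=
  wedgeSum_perm (fun t y σ => by rw [vand_perm, hΔ.symm_right _ _ hkl, mul_assoc]) b σ

theorem altX_perm_b (hΔ : IsDeltaFamily q κ Δ) (hkl : k < l + 1) (x : Fin (k + 1) → ℂ)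
    (a : Fin k → ℂ) (b : Fin (l + 1) → ℂ) (σ : Equiv.Perm (Fin (l + 1))) :
    altX q Δ x a (b ∘ σ) = altX q Δ x a b := by
  simp only [altX, hΔ.symm_right _ _ hkl]

theorem altB_perm_x (hΔ : IsDeltaFamily q κ Δ) (hkl : k + 1 < l) (x : Fin (k + 1) → ℂ)
    (a : Fin k → ℂ) (b : Fin (l + 1) → ℂ) (σ : Equiv.Perm (Fin (k + 1))) :
    altB q Δ (x ∘ σ) a b = csign σ * altB q Δ x a b := by
  simp only [altB, wedgeSum, hΔ.antisymm _ _ hkl, Finset.mul_sum]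
  exact Finset.sum_congr rfl fun m _ => by ring

theorem altX_perm_x (hΔ : IsDeltaFamily q κ Δ) (hkl : k < l + 1) (x : Fin (k + 1) → ℂ)
    (a : Fin k → ℂ) (b : Fin (l + 1) → ℂ) (σ : Equiv.Perm (Fin (k + 1))) :
    altX q Δ (x ∘ σ) a b = csign σ * altX q Δ x a b := by
  rw [altX, wedgeSum_perm (fun t y σ => by rw [hΔ.antisymm _ _ hkl, mul_left_comm]), altX]
  ring

theorem exists_snoc_comp_perm {α : Type} (a : Fin k → α) (t : α) (σ : Equiv.Perm (Fin k)) :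
    ∃ ρ : Equiv.Perm (Fin (k + 1)),
      (Fin.snoc (a ∘ σ) t : Fin (k + 1) → α) = (Fin.snoc a t : Fin (k + 1) → α) ∘ ρ := by
  refine ⟨(finSuccEquivLast).symm.permCongr σ.optionCongr, ?_⟩
  funext i
  refine Fin.lastCases ?_ (fun i => ?_) i <;> simp [Equiv.permCongr_apply]

theorem altB_perm_a (hΔ : IsDeltaFamily q κ Δ) (hkl : k + 1 < l) (x : Fin (k + 1) → ℂ)
    (a : Fin k → ℂ) (b : Fin (l + 1) → ℂ) (σ : Equiv.Perm (Fin k)) :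
    altB q Δ x (a ∘ σ) b = altB q Δ x a b := by
  have h : ∀ t b', (Δ (k + 1) l).val x (Fin.snoc (a ∘ σ) t) b' =
      (Δ (k + 1) l).val x (Fin.snoc a t) b' := by
    intro t b'
    obtain ⟨ρ, hρ⟩ := exists_snoc_comp_perm a t σ
    rw [hρ, hΔ.symm_left _ _ hkl]
  simp only [altB, h, Function.comp_apply]
  simp only [fun t : ℂ => Equiv.prod_comp σ fun j => (t - a j * (q ^ 2)⁻¹)]

theorem altX_perm_a (hΔ : IsDeltaFamily q κ Δ) (hkl : k < l + 1) (x : Fin (k + 1) → ℂ)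
    (a : Fin k → ℂ) (b : Fin (l + 1) → ℂ) (σ : Equiv.Perm (Fin k)) :
    altX q Δ x (a ∘ σ) b = altX q Δ x a b := by
  simp only [altX, hΔ.symm_left _ _ hkl, Function.comp_apply]
  simp only [fun t : ℂ => Equiv.prod_comp σ fun j => (t - a j * q⁻¹)]

theorem isHomPoly_altB (hΔ : IsDeltaFamily q κ Δ) (hkl : k + 1 < l) :
    IsHomPoly (l.choose 2 + k.choose 2 + k * l + k + l)
      (joinVars fun (x : Fin (k + 1) → ℂ) a (b : Fin (l + 1) → ℂ) => altB q Δ x a b) := by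
  unfold joinVars altB wedgeSum
  refine IsHomPoly.sum _ fun m _ => IsHomPoly.const_mul _ ?_
  have h1 := isHomPoly_vand
    (fun i => Sum.inr (Sum.inr (m.succAbove i)) : Fin l → Fin (k + 1) ⊕ Fin k ⊕ Fin (l + 1))
  have h2 := IsHomPoly.coord (Sum.inr (Sum.inr m) : Fin (k + 1) ⊕ Fin k ⊕ Fin (l + 1))
  have h3 : IsHomPoly (∑ _j : Fin k, 1) fun v : Fin (k + 1) ⊕ Fin k ⊕ Fin (l + 1) → ℂ =>
      ∏ j, (v (Sum.inr (Sum.inr m)) - (q ^ 2)⁻¹ * v (Sum.inr (Sum.inl j))) :=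
    IsHomPoly.prod _ fun j _ => h2.sub (IsHomPoly.const_mul _ (IsHomPoly.coord _))
  have h4 := DPoly.isHomPoly_val (hΔ.homogeneous _ _ hkl)
    (Sum.inl : _ → Fin (k + 1) ⊕ Fin k ⊕ Fin (l + 1))
    (Fin.snoc (Sum.inr ∘ Sum.inl) (Sum.inr (Sum.inr m))) (Sum.inr ∘ Sum.inr ∘ m.succAbove)
  convert h1.mul ((h2.mul h3).mul h4) using 1
  · have : (k + 1) * l = k * l + l := by ring
    rw [Nat.choose_succ_left _ _ (by omega), Nat.choose_one_right]
    simp only [Finset.sum_const, Finset.card_univ, Fintype.card_fin, smul_eq_mul, mul_one]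
    omega
  · funext v
    simp only [Fin.comp_snoc, mul_comm ((q ^ 2)⁻¹)]
    rfl

theorem isHomPoly_altX (hΔ : IsDeltaFamily q κ Δ) (hkl : k < l + 1) :
    IsHomPoly (k.choose 2 + k * l + k)
      (joinVars fun (x : Fin (k + 1) → ℂ) a (b : Fin (l + 1) → ℂ) => altX q Δ x a b) := by
  refine IsHomPoly.const_mul _ (IsHomPoly.sum _ fun ν _ => IsHomPoly.const_mul _ ?_)
  have h3 : IsHomPoly (∑ _j : Fin k, 1) fun v : Fin (k + 1) ⊕ Fin k ⊕ Fin (l + 1) → ℂ =>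
      ∏ j, (v (Sum.inl ν) - q⁻¹ * v (Sum.inr (Sum.inl j))) :=
    IsHomPoly.prod _ fun j _ => (IsHomPoly.coord _).sub (IsHomPoly.const_mul _ (IsHomPoly.coord _))
  have h4 := DPoly.isHomPoly_val (hΔ.homogeneous _ _ hkl)
    (Sum.inl ∘ ν.succAbove : _ → Fin (k + 1) ⊕ Fin k ⊕ Fin (l + 1))
    (Sum.inr ∘ Sum.inl) (Sum.inr ∘ Sum.inr)
  convert h3.mul h4 using 1
  · have : k * (l + 1) = k * l + k := by ring
    simp only [Finset.sum_const, Finset.card_univ, Fintype.card_fin, smul_eq_mul, mul_one]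
    omega
  · funext v
    simp only [mul_comm q⁻¹]
    rfl

theorem isHomPoly_altB_sub (hΔ : IsDeltaFamily q κ Δ) (hkl : k + 1 < l) (c : ℂ) :
    IsHomPoly (l.choose 2 + k.choose 2 + k * l + k + l)
      (joinVars fun (x : Fin (k + 1) → ℂ) a (b : Fin (l + 1) → ℂ) =>
        altB q Δ x a b - c * (vand b * altX q Δ x a b)) := by
  refine (isHomPoly_altB hΔ hkl).sub (IsHomPoly.const_mul c ?_)
  convert (isHomPoly_vand (fun i => Sum.inr (Sum.inr i) :
    Fin (l + 1) → Fin (k + 1) ⊕ Fin k ⊕ Fin (l + 1))).mul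
      (isHomPoly_altX hΔ (by omega : k < l + 1)) using 1
  · rw [Nat.choose_succ_left _ _ (by omega), Nat.choose_one_right]
    omega
  · rfl

end AlternatingSums

/-! ### Reduction on b_i = q⁻² a_j and induction on k -/

section AlternatingSumsStep

variable {q : ℂ} {Δ : (n l : ℕ) → DPoly n n l} {k l : ℕ} {κ : ℕ → ℂ}

theorem IsDeltaFamily.recursion_wedgeSum (hΔ : IsDeltaFamily q κ Δ) (hkl : k < l)
    (x a : Fin (k + 1) → ℂ) (b : Fin l → ℂ) :
    (Δ (k + 1) (l + 1)).val x a (Fin.snoc b (a (Fin.last k) * (q ^ 2)⁻¹)) =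
      (∏ μ, (x μ - a (Fin.last k) * q⁻¹)) * ((-1) ^ k *
        wedgeSum (fun s y => hFun q κ s (Sum.elim (Fin.init a) b) *
          (Δ k l).val y (Fin.init a) b) x) := by
  rw [hΔ.recursion _ _ hkl, wedgeSum, Finset.mul_sum (a := (-1 : ℂ) ^ k)]
  congr 1
  refine Finset.sum_congr rfl fun ν _ => ?_
  rw [pow_add]
  simp only [mul_assoc]
  rfl

theorem wedgeSum_const_mul {α : Type} (c : ℂ) (F : α → (Fin k → α) → ℂ) (x : Fin (k + 1) → α) :
    wedgeSum (fun t y => c * F t y) x = c * wedgeSum F x := by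
  rw [wedgeSum, wedgeSum, Finset.mul_sum]
  exact Finset.sum_congr rfl fun ν _ => mul_left_comm _ _ _

theorem snoc_comp_castSucc_succAbove {α : Type} (b : Fin (l + 1) → α) (t : α) (m : Fin (l + 1)) :
    (Fin.snoc b t : Fin (l + 2) → α) ∘ m.castSucc.succAbove =
      (Fin.snoc (b ∘ m.succAbove) t : Fin (l + 1) → α) := by
  funext i
  refine Fin.lastCases ?_ (fun i => ?_) i
  · rw [Function.comp_apply, Fin.succAbove_ne_last_last (Fin.castSucc_ne_last m), Fin.snoc_last,
      Fin.snoc_last]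
  · rw [Function.comp_apply, Fin.castSucc_succAbove_castSucc, Fin.snoc_castSucc,
      Fin.snoc_castSucc, Function.comp_apply]

theorem snoc_snoc_comp_swap {α : Type} (a : Fin k → α) (s t : α) :
    (Fin.snoc (Fin.snoc a s : Fin (k + 1) → α) t : Fin (k + 2) → α) ∘
        Equiv.swap (Fin.last (k + 1)) (Fin.last k).castSucc =
      (Fin.snoc (Fin.snoc a t : Fin (k + 1) → α) s : Fin (k + 2) → α) := by
  funext i
  refine Fin.lastCases ?_ (fun i => ?_) i
  · simp
  · refine Fin.lastCases ?_ (fun i => ?_) i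
    · simp
    · rw [Function.comp_apply, Equiv.swap_apply_of_ne_of_ne]
      · simp
      · exact Fin.castSucc_ne_last _
      · exact fun h => Fin.castSucc_ne_last i (Fin.castSucc_injective _ h)

/-- With α the last entry of a, the term that removes the new entry α q⁻² of b has a zero factor. In
the others symmetry in the left group puts α behind b_m, and the recursion applies with h
independent of m. The minus sign arises because b_m - α q⁻² completes the Vandermonde factors α q⁻²
- b_i. -/
theorem altB_snoc (hΔ : IsDeltaFamily q κ Δ) (hkl : k + 1 < l) (x : Fin (k + 2) → ℂ)
    (a : Fin (k + 1) → ℂ) (b : Fin (l + 1) → ℂ) :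
    altB q Δ x a (Fin.snoc b (a (Fin.last k) * (q ^ 2)⁻¹) : Fin (l + 2) → ℂ) =
      -(∏ i, (a (Fin.last k) * (q ^ 2)⁻¹ - b i)) * (∏ μ, (x μ - a (Fin.last k) * q⁻¹)) *
        ((-1) ^ (k + 1) * wedgeSum (fun s y => hFun q κ s (Sum.elim (Fin.init a) b) *
          altB q Δ y (Fin.init a) b) x) := by
  set α := a (Fin.last k) with hα
  have hrec : ∀ m : Fin (l + 1), (Δ (k + 2) (l + 1)).val x (Fin.snoc a (b m))
      (Fin.snoc (b ∘ m.succAbove) (α * (q ^ 2)⁻¹)) = (∏ μ, (x μ - α * q⁻¹)) * ((-1) ^ (k + 1) *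
        wedgeSum (fun s y => hFun q κ s (Sum.elim (Fin.init a) b) *
          (Δ (k + 1) l).val y (Fin.snoc (Fin.init a) (b m)) (b ∘ m.succAbove)) x) := by
    intro m
    have h1 : (Fin.snoc a (b m) : Fin (k + 2) → ℂ) ∘
        Equiv.swap (Fin.last (k + 1)) (Fin.last k).castSucc =
          Fin.snoc (Fin.snoc (Fin.init a) (b m) : Fin (k + 1) → ℂ) α := by
      rw [← snoc_snoc_comp_swap, hα, Fin.snoc_init_self]
    rw [← hΔ.symm_left _ _ (by omega) (Equiv.swap (Fin.last (k + 1)) (Fin.last k).castSucc), h1]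
    have h2 := hΔ.recursion_wedgeSum hkl x
      (Fin.snoc (Fin.snoc (Fin.init a) (b m) : Fin (k + 1) → ℂ) α) (b ∘ m.succAbove)
    rw [Fin.snoc_last, Fin.init_snoc] at h2
    rw [h2]
    simp only [hFun_snoc_succAbove]
  have hterm : ∀ m : Fin (l + 1),
      vand (Fin.snoc (b ∘ m.succAbove) (α * (q ^ 2)⁻¹) : Fin (l + 1) → ℂ) *
        (b m * (∏ j, (b m - a j * (q ^ 2)⁻¹)) *
          (Δ (k + 2) (l + 1)).val x (Fin.snoc a (b m))
            (Fin.snoc (b ∘ m.succAbove) (α * (q ^ 2)⁻¹))) =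
      -(∏ i, (α * (q ^ 2)⁻¹ - b i)) * (∏ μ, (x μ - α * q⁻¹)) * (-1) ^ (k + 1) *
        (vand (b ∘ m.succAbove) * (b m * (∏ j, (b m - Fin.init a j * (q ^ 2)⁻¹)) *
          wedgeSum (fun s y => hFun q κ s (Sum.elim (Fin.init a) b) *
          (Δ (k + 1) l).val y (Fin.snoc (Fin.init a) (b m)) (b ∘ m.succAbove)) x)) := by
    intro m
    rw [hrec, vand_snoc, Fin.prod_univ_castSucc (fun j => b m - a j * (q ^ 2)⁻¹),
      Fin.prod_univ_succAbove (fun i => α * (q ^ 2)⁻¹ - b i) m]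
    simp only [Fin.init, Function.comp_apply, ← hα]
    ring
  rw [altB, wedgeSum, Fin.sum_univ_castSucc]
  have hlast : (∏ j, ((Fin.snoc b (α * (q ^ 2)⁻¹) : Fin (l + 2) → ℂ) (Fin.last (l + 1)) -
      a j * (q ^ 2)⁻¹)) = 0 := by
    apply Finset.prod_eq_zero (Finset.mem_univ (Fin.last k))
    rw [Fin.snoc_last, hα, sub_self]
  rw [hlast, mul_zero, zero_mul, mul_zero, mul_zero, add_zero]
  simp only [snoc_comp_castSucc_succAbove, Fin.snoc_castSucc, hterm, Fin.val_castSucc]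
  simp only [wedgeSum, altB, Finset.mul_sum]
  rw [Finset.sum_comm]
  exact Finset.sum_congr rfl fun ν _ => Finset.sum_congr rfl fun m _ => by ring

/-- The recursion supplies the factors x_μ - α q⁻¹ for μ ≠ ν, where α is the last entry of a, and
the prefactor supplies the one for ν. Here the argument of h is removed second, whereas in
`altB_snoc` it is removed first. -/
theorem altX_snoc (hΔ : IsDeltaFamily q κ Δ) (hkl : k + 1 < l) (x : Fin (k + 2) → ℂ)
    (a : Fin (k + 1) → ℂ) (b : Fin (l + 1) → ℂ) :
    altX q Δ x a (Fin.snoc b (a (Fin.last k) * (q ^ 2)⁻¹) : Fin (l + 2) → ℂ) =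
      -(∏ μ, (x μ - a (Fin.last k) * q⁻¹)) *
        wedgeSum (fun s y => (∏ j, (s - Fin.init a j * q⁻¹)) *
          wedgeSum (fun s' z => hFun q κ s' (Sum.elim (Fin.init a) b) *
            (Δ k (l + 1)).val z (Fin.init a) b) y) x := by
  rw [altX]
  simp only [hΔ.recursion_wedgeSum (by omega : k < l + 1)]
  rw [wedgeSum, wedgeSum, Finset.mul_sum, Finset.mul_sum]
  refine Finset.sum_congr rfl fun ν _ => ?_
  rw [Fin.prod_univ_castSucc (fun j => x ν - a j * q⁻¹),
    Fin.prod_univ_succAbove (fun μ => x μ - a (Fin.last k) * q⁻¹) ν]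
  have hs : ((-1 : ℂ)) ^ k * (-1) ^ k = 1 := by rw [← mul_pow]; simp
  simp only [Function.comp_apply, pow_succ]
  set W := wedgeSum (fun s' z => hFun q κ s' (Sum.elim (Fin.init a) b) *
    (Δ k (l + 1)).val z (Fin.init a) b) (x ∘ ν.succAbove)
  simp only [Fin.init]
  linear_combination (-(-1 : ℂ) ^ (ν : ℕ) * (∏ i : Fin k, (x ν - a i.castSucc * q⁻¹)) *
    (x ν - a (Fin.last k) * q⁻¹) * (∏ i, (x (ν.succAbove i) - a (Fin.last k) * q⁻¹)) * W) * hs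

/-- The antisymmetrisation identity, provided it holds for `k = 0`. -/
theorem altB_eq_of_base (hq : q ≠ 0) (hΔ : IsDeltaFamily q κ Δ) {d : ℕ} (hd : 0 < d) {c : ℂ}
    (hbase : ∀ (x : Fin 1 → ℂ) (a : Fin 0 → ℂ) (b : Fin (d + 1 + 1) → ℂ),
      altB q Δ x a b = c * (vand b * altX q Δ x a b)) :
    ∀ (k l : ℕ), l = k + 1 + d → ∀ (x : Fin (k + 1) → ℂ) (a : Fin k → ℂ) (b : Fin (l + 1) → ℂ),
      altB q Δ x a b = c * (vand b * altX q Δ x a b) := by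
  intro k
  induction k with
  | zero =>
    intro l hl
    obtain rfl : l = d + 1 := by omega
    exact hbase
  | succ k ih =>
    intro l hl x a b
    obtain ⟨l, rfl⟩ : ∃ l', l = l' + 1 := ⟨l - 1, by omega⟩
    have hkl : k + 1 + 1 < l + 1 := by omega
    have hsnoc : ∀ (x : Fin (k + 2) → ℂ) (a : Fin (k + 1) → ℂ) (b : Fin (l + 1) → ℂ),
        altB q Δ x a (Fin.snoc b (a (Fin.last k) * (q ^ 2)⁻¹) : Fin (l + 2) → ℂ) =
          c * (vand (Fin.snoc b (a (Fin.last k) * (q ^ 2)⁻¹) : Fin (l + 2) → ℂ) *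
            altX q Δ x a (Fin.snoc b (a (Fin.last k) * (q ^ 2)⁻¹) : Fin (l + 2) → ℂ)) := by
      intro x a b
      rw [altB_snoc hΔ (by omega), altX_snoc hΔ (by omega), wedgeSum_wedgeSum_swap, vand_snoc]
      have : ∀ (s : ℂ) (y : Fin (k + 1) → ℂ), hFun q κ s (Sum.elim (Fin.init a) b) *
          altB q Δ y (Fin.init a) b = c * vand b * (-1) ^ k *
            (hFun q κ s (Sum.elim (Fin.init a) b) *
              wedgeSum (fun s y => (∏ j, (s - Fin.init a j * q⁻¹)) *
                (Δ k (l + 1)).val y (Fin.init a) b) y) := by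
        intro s y
        rw [ih l (by omega), altX]
        ring
      simp only [this]
      have hs : ((-1 : ℂ)) ^ k * (-1) ^ k = 1 := by rw [← mul_pow]; simp
      rw [wedgeSum_const_mul, pow_succ (-1 : ℂ) k]
      set W := wedgeSum (fun s y => hFun q κ s (Sum.elim (Fin.init a) b) *
        wedgeSum (fun s y => (∏ j, (s - Fin.init a j * q⁻¹)) *
          (Δ k (l + 1)).val y (Fin.init a) b) y) x
      linear_combination (c * vand b * (∏ i, (a (Fin.last k) * (q ^ 2)⁻¹ - b i)) *
        (∏ μ, (x μ - a (Fin.last k) * q⁻¹)) * W) * hs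
    rw [← sub_eq_zero]
    set B := Finset.univ.filter fun p : Fin (l + 2) × Fin (l + 2) => p.1 < p.2 with hBdef
    refine eq_zero_of_vanish (F := fun x a b => altB q Δ x a b - c * (vand b * altX q Δ x a b))
      (isHomPoly_altB_sub hΔ hkl c) (r := (q ^ 2)⁻¹) (inv_ne_zero (pow_ne_zero 2 hq)) (B := B)
      (fun p hp => (Finset.mem_filter.1 hp).2) ?_ ?_ ?_ ?_ x a b
    · intro x a b μ ν hμν hxx
      refine eq_zero_of_antisymm
        (F := fun x => altB q Δ x a b - c * (vand b * altX q Δ x a b)) ?_ hμν hxx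
      intro σ y
      simp only [altB_perm_x hΔ hkl, altX_perm_x hΔ (by omega : k + 1 < l + 1 + 1)]
      ring
    · intro x a b i j hij
      -- The symmetries in a and b move the hyperplane b_i = q⁻² a_j to the last entries, where the
      -- reduction applies.
      have hba : (a ∘ Equiv.swap j (Fin.last k)) (Fin.last k) * (q ^ 2)⁻¹ =
          (b ∘ Equiv.swap i (Fin.last (l + 1))) (Fin.last (l + 1)) := by
        simp [hij, mul_comm]
      have h := hsnoc x (a ∘ Equiv.swap j (Fin.last k))
        (Fin.init (b ∘ Equiv.swap i (Fin.last (l + 1))))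
      rw [hba, Fin.snoc_init_self, altB_perm_b hΔ hkl, altX_perm_b hΔ (by omega),
        vand_perm, altB_perm_a hΔ hkl, altX_perm_a hΔ (by omega), ← sub_eq_zero] at h
      have h2 := csign_mul_self (Equiv.swap i (Fin.last (l + 1)))
      show altB q Δ x a b - c * (vand b * altX q Δ x a b) = 0
      linear_combination csign (Equiv.swap i (Fin.last (l + 1))) * h -
        (altB q Δ x a b - c * (vand b * altX q Δ x a b)) * h2
    · intro x a b p _ hp hbb
      refine eq_zero_of_antisymm
        (F := fun b => altB q Δ x a b - c * (vand b * altX q Δ x a b)) ?_ hp hbb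
      intro σ y
      simp only [altB_perm_b hΔ hkl, altX_perm_b hΔ (by omega : k + 1 < l + 1 + 1), vand_perm]
      ring
    -- The number of hyperplanes exceeds the degree by k + 1, the number of variables a. Without
    -- variables a there would be no excess, which is why the base case is separate.
    · have e1 : B.card = (l + 2).choose 2 := card_filter_fst_lt_snd _
      have e2 : (l + 2).choose 2 = (l + 1) + (l + 1).choose 2 := by
        rw [Nat.choose_succ_left _ _ (by omega), Nat.choose_one_right]
      have e3 : (k + 1 + 1).choose 2 = (k + 1) + (k + 1).choose 2 := by
        rw [Nat.choose_succ_left _ _ (by omega), Nat.choose_one_right]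
      rw [e1, e2, e3]
      nlinarith

end AlternatingSumsStep

section

/-! ### The antisymmetrisation identity for `n = 1` -/

open Polynomial

section FirstCase

variable {q : ℂ} {Δ Δ' : (n l : ℕ) → DPoly n n l} {l : ℕ} {κ : ℕ → ℂ}

theorem DPoly.val_initial (hΔ : IsDeltaFamily q κ Δ) (hl : 0 < l) (x a : Fin 0 → ℂ)
    (b : Fin l → ℂ) : (Δ 0 l).val x a b = 1 := by
  rw [DPoly.val, hΔ.initial l hl, map_one]

/-- The polynomials `Δ^{(1l)}` are unique. -/
theorem IsDeltaFamily.val_one_eq (hq : q ≠ 0) (hΔ : IsDeltaFamily q κ Δ)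
    (hΔ' : IsDeltaFamily q κ Δ') (hl : 1 < l) (x a : Fin 1 → ℂ) (b : Fin l → ℂ) :
    (Δ 1 l).val x a b = (Δ' 1 l).val x a b := by
  obtain ⟨l, rfl⟩ : ∃ l', l = l' + 1 := ⟨l - 1, by omega⟩
  rw [← sub_eq_zero]
  -- The degree is l, and the recursion prescribes the values on the l + 1 hyperplanes b_i = q⁻² a.
  refine eq_zero_of_vanish
    (F := fun x a b => (Δ 1 (l + 1)).val x a b - (Δ' 1 (l + 1)).val x a b)
    (d := (1 : ℕ).choose 2 + 1 * (l + 1) - 1)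
    ((DPoly.isHomPoly_val (hΔ.homogeneous _ _ hl) _ _ _).sub
      (DPoly.isHomPoly_val (hΔ'.homogeneous _ _ hl) _ _ _))
    (r := (q ^ 2)⁻¹) (inv_ne_zero (pow_ne_zero 2 hq)) (B := ∅) (by simp)
    (fun x a b μ ν h => absurd (Subsingleton.elim μ ν) h) ?_ (by simp) (by simp) x a b
  intro x a b i j hij
  have hba : a (Fin.last 0) * (q ^ 2)⁻¹ = (b ∘ Equiv.swap i (Fin.last l)) (Fin.last l) := by
    rw [Function.comp_apply, Equiv.swap_apply_right, hij, mul_comm, Subsingleton.elim j]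
  have hsn : (Fin.snoc (Fin.init (b ∘ Equiv.swap i (Fin.last l))) (a (Fin.last 0) * (q ^ 2)⁻¹) :
      Fin (l + 1) → ℂ) = b ∘ Equiv.swap i (Fin.last l) := by
    rw [hba, Fin.snoc_init_self]
  have h1 := hΔ.recursion 0 l (by omega) x a (Fin.init (b ∘ Equiv.swap i (Fin.last l)))
  have h2 := hΔ'.recursion 0 l (by omega) x a (Fin.init (b ∘ Equiv.swap i (Fin.last l)))
  simp only [DPoly.val_initial hΔ (by omega : 0 < l)] at h1
  simp only [DPoly.val_initial hΔ' (by omega : 0 < l)] at h2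
  rw [hsn, hΔ.symm_right _ _ hl] at h1
  rw [hsn, hΔ'.symm_right _ _ hl] at h2
  show (Δ (0 + 1) (l + 1)).val x a b - (Δ' (0 + 1) (l + 1)).val x a b = 0
  rw [h1, h2, sub_self]

/-- Dilations fix the constant f = 1, so the second summand drops out, and division by X leaves only
the linear coefficient of the quotient. This simplicity is the reason for evaluating at x = 0. -/
theorem eval_zero_rowPoly (q r : ℂ) (a : Fin 1 → ℂ) (b : Fin l → ℂ) :
    (rowPoly q r a b (X ^ 0)).eval 0 =
      -(a 0 * r) * (1 - r ^ 2) * (rootsPoly r b /ₘ (X - C (a 0 * r ^ 3))).coeff 1 := by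
  rw [← coeff_zero_eq_eval_zero, rowPoly, coeff_divX, rowNumerator]
  simp only [rootsPoly, Fin.prod_univ_one, pow_zero, one_mul]
  have h1 : dil (r ^ 2) (1 : ℂ[X]) = 1 := one_comp
  rw [h1, h1, sub_self, mul_zero, zero_mul, add_zero, coeff_X_sub_C_mul, dil, coeff_sub, coeff_sub,
    comp_C_mul_X_coeff, comp_C_mul_X_coeff]
  ring

theorem deltaPoly_one_val_zero (q : ℂ) (κ : ℕ → ℂ) (a : Fin 1 → ℂ) (b : Fin l → ℂ) :
    (deltaPoly q κ 1 l).val 0 a b =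
      κ (l - 1) * (-(a 0 * q⁻¹) * (1 - q⁻¹ ^ 2) *
        (rootsPoly q⁻¹ b /ₘ (X - C (a 0 * q⁻¹ ^ 3))).coeff 1) := by
  rw [deltaPoly_val, ← eval_zero_rowPoly q, rowDet, Matrix.det_unique, Fin.prod_univ_one]
  rfl

/-! #### The value at the roots of unity -/

variable {ω : ℂ}

theorem prod_X_sub_pow (hω : IsPrimitiveRoot ω (l + 1)) :
    ∏ i : Fin (l + 1), (X - C (ω ^ (i : ℕ))) = (X ^ (l + 1) - 1 : ℂ[X]) := by
  classical
  rw [X_pow_sub_one_eq_prod (Nat.succ_pos l) hω]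
  have hinj : Function.Injective fun i : Fin (l + 1) => ω ^ (i : ℕ) :=
    fun i j h => Fin.ext (hω.pow_inj i.2 j.2 h)
  have himg : Finset.univ.image (fun i : Fin (l + 1) => ω ^ (i : ℕ)) =
      nthRootsFinset (l + 1) 1 := by
    refine Finset.eq_of_subset_of_card_le ?_ ?_
    · intro z hz
      obtain ⟨i, -, rfl⟩ := Finset.mem_image.1 hz
      rw [mem_nthRootsFinset (Nat.succ_pos l), ← pow_mul, mul_comm, pow_mul, hω.pow_eq_one,
        one_pow]
    · rw [hω.card_nthRootsFinset, Finset.card_image_of_injective _ hinj, Finset.card_univ,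
        Fintype.card_fin]
  rw [← himg, Finset.prod_image fun i _ j _ h => hinj h]

/-- Both sides are (X^{l+1} - 1)/(X - u) with u = ω^m, because u^{l+1} = 1. All coefficients become
powers of u. -/
theorem prod_X_sub_pow_succAbove (hω : IsPrimitiveRoot ω (l + 1)) (m : Fin (l + 1)) :
    ∏ i : Fin l, (X - C (ω ^ (m.succAbove i : ℕ))) =
      ∑ i ∈ Finset.range (l + 1), (X ^ i * C (ω ^ (m : ℕ)) ^ (l - i) : ℂ[X]) := by
  have h1 := prod_X_sub_pow hω
  rw [Fin.prod_univ_succAbove _ m] at h1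
  have h2 := geom_sum₂_mul (X : ℂ[X]) (C (ω ^ (m : ℕ))) (l + 1)
  have h3 : (C (ω ^ (m : ℕ)) : ℂ[X]) ^ (l + 1) = 1 := by
    rw [← C_pow, ← pow_mul, mul_comm, pow_mul, hω.pow_eq_one, one_pow, C_1]
  rw [h3, ← h1, mul_comm] at h2
  exact (mul_left_cancel₀ (X_sub_C_ne_zero _) h2).symm

/-- The sum `∑_{i=2}^{l} s^{i-2} u^{l-i}` at `s = q⁻² u`. -/
theorem one_sub_mul_sum (r u : ℂ) (d : ℕ) :
    (1 - r ^ 2) * ∑ i ∈ Finset.Icc 2 (d + 1), (u * r ^ 2) ^ (i - 2) * u ^ (d + 1 - i) =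
      u ^ (d - 1) * (1 - (r ^ 2) ^ d) := by
  have h1 : ∑ i ∈ Finset.Icc 2 (d + 1), (u * r ^ 2) ^ (i - 2) * u ^ (d + 1 - i) =
      ∑ j ∈ Finset.range d, u ^ (d - 1) * (r ^ 2) ^ j := by
    refine (Finset.sum_bij (fun j _ => j + 2) ?_ ?_ ?_ ?_).symm
    · intro j hj; simp only [Finset.mem_range, Finset.mem_Icc] at *; omega
    · intro i _ j _ h; omega
    · intro i hi
      simp only [Finset.mem_Icc] at hi
      exact ⟨i - 2, by simp only [Finset.mem_range]; omega, by omega⟩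
    · intro j hj
      rw [Finset.mem_range] at hj
      have : d - 1 = j + (d + 1 - (j + 2)) := by omega
      rw [Nat.add_sub_cancel, mul_pow, this, pow_add]
      ring
  rw [h1, ← Finset.mul_sum]
  linear_combination (-u ^ (d - 1)) * mul_geom_sum (r ^ 2) d

theorem rootsPoly_pow_succAbove (hq : q ≠ 0) (hω : IsPrimitiveRoot ω (l + 1)) (m : Fin (l + 1)) :
    rootsPoly q⁻¹ (fun i => q * ω ^ (m.succAbove i : ℕ)) =
      ∑ i ∈ Finset.range (l + 1), (X ^ i * C (ω ^ (m : ℕ)) ^ (l - i) : ℂ[X]) := by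
  rw [← prod_X_sub_pow_succAbove hω, rootsPoly]
  refine Finset.prod_congr rfl fun i _ => ?_
  rw [mul_comm q, mul_inv_cancel_right₀ hq]

theorem coeff_rootsPoly_pow_succAbove (hq : q ≠ 0) (hω : IsPrimitiveRoot ω (l + 1))
    (m : Fin (l + 1)) {i : ℕ} (hi : i ≤ l) :
    (rootsPoly q⁻¹ (fun i => q * ω ^ (m.succAbove i : ℕ))).coeff i = (ω ^ (m : ℕ)) ^ (l - i) := by
  rw [rootsPoly_pow_succAbove hq hω, finsetSum_coeff]
  simp only [← C_pow, coeff_mul_C, coeff_X_pow]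
  rw [Finset.sum_eq_single i]
  · simp
  · intro j _ hj; rw [if_neg hj.symm, zero_mul]
  · intro h; exact absurd (Finset.mem_range.2 (by omega)) h

theorem deltaPoly_one_val_roots (hq : q ≠ 0) {d : ℕ} (hd : 0 < d)
    (hω : IsPrimitiveRoot ω (d + 2)) (m : Fin (d + 2)) (κ : ℕ → ℂ) :
    q * ω ^ (m : ℕ) * (deltaPoly q κ 1 (d + 1)).val 0 (fun _ => q * ω ^ (m : ℕ))
        (fun i => q * ω ^ (m.succAbove i : ℕ)) =
      -(q * κ d * (1 - (q⁻¹ ^ 2) ^ d) * (ω ^ (m : ℕ)) ^ (d + 1)) := by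
  set u := ω ^ (m : ℕ) with hu
  have hdeg : (rootsPoly q⁻¹ (fun i => q * ω ^ (m.succAbove i : ℕ))).natDegree = d + 1 := by
    rw [rootsPoly, natDegree_prod_of_monic _ _ fun _ _ => monic_X_sub_C _]
    simp only [natDegree_X_sub_C, Finset.sum_const, Finset.card_univ, Fintype.card_fin,
      smul_eq_mul, mul_one]
  have e1 : q * u * q⁻¹ ^ 3 = u * q⁻¹ ^ 2 := by field_simp
  have e2 : q * u * q⁻¹ = u := by field_simp
  rw [deltaPoly_one_val_zero, coeff_divByMonic_X_sub_C, hdeg, e1, e2, Nat.add_sub_cancel]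
  have h : ∑ i ∈ Finset.Icc (1 + 1) (d + 1), (u * q⁻¹ ^ 2) ^ (i - (1 + 1)) *
      (rootsPoly q⁻¹ (fun i => q * ω ^ (m.succAbove i : ℕ))).coeff i =
      ∑ i ∈ Finset.Icc 2 (d + 1), (u * q⁻¹ ^ 2) ^ (i - 2) * u ^ (d + 1 - i) := by
    refine Finset.sum_congr rfl fun i hi => ?_
    rw [Finset.mem_Icc] at hi
    rw [coeff_rootsPoly_pow_succAbove hq hω m hi.2]
  rw [h]
  have h2 := one_sub_mul_sum q⁻¹ u d
  obtain ⟨e, rfl⟩ : ∃ e, d = e + 1 := ⟨d - 1, by omega⟩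
  rw [Nat.add_sub_cancel] at h2
  linear_combination (-q * u * κ (e + 1) * u) * h2

theorem prod_roots_sub (hω : IsPrimitiveRoot ω (l + 1)) (m : Fin (l + 1)) :
    ∏ i : Fin l, (q * ω ^ (m.succAbove i : ℕ) - q * ω ^ (m : ℕ)) =
      (-q) ^ l * ((l + 1 : ℂ) * (ω ^ (m : ℕ)) ^ l) := by
  have h := congrArg (Polynomial.eval (ω ^ (m : ℕ))) (prod_X_sub_pow_succAbove hω m)
  rw [eval_prod, eval_finsetSum] at h
  simp only [eval_sub, eval_X, eval_C, eval_mul, eval_pow] at h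
  have h2 : ∑ i ∈ Finset.range (l + 1), (ω ^ (m : ℕ)) ^ i * (ω ^ (m : ℕ)) ^ (l - i) =
      (l + 1 : ℂ) * (ω ^ (m : ℕ)) ^ l := by
    rw [Finset.sum_congr rfl (g := fun _ => (ω ^ (m : ℕ)) ^ l) fun i hi => by
      rw [← pow_add]; congr 1; have := Finset.mem_range.1 hi; omega]
    simp
  rw [← h2, ← h, ← Fin.prod_const l (-q), ← Finset.prod_mul_distrib]
  exact Finset.prod_congr rfl fun i _ => by ring

/-- `∑_m (-1)^m V(b̂_m) b_m Δ^{(1 d+1)}(x | b_m | b̂_m) = κ_d (-1)^d q^{-d} (1 - q^{-2d}) V(b)`. -/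
theorem altB_one (hq : q ≠ 0) (hΔ : IsDeltaFamily q κ Δ) {d : ℕ} (hd : 0 < d)
    (x : Fin 1 → ℂ) (a : Fin 0 → ℂ) (b : Fin (d + 1 + 1) → ℂ) :
    altB q Δ x a b = κ d * (-1) ^ d * q⁻¹ ^ d * (1 - (q⁻¹ ^ 2) ^ d) *
      (vand b * altX q Δ x a b) := by
  have hω := Complex.isPrimitiveRoot_exp (d + 1 + 1) (by omega)
  set ω := Complex.exp (2 * Real.pi * Complex.I / ((d + 1 + 1 : ℕ) : ℂ)) with hωdef
  -- The factor q makes the roots of `rootsPoly q⁻¹` the roots of unity themselves; the entries are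
  -- distinct, so the Vandermonde product is not zero.
  set b₀ : Fin (d + 1 + 1) → ℂ := fun i => q * ω ^ (i : ℕ) with hb₀
  have hinj : Function.Injective b₀ := fun i j h =>
    Fin.ext (hω.pow_inj i.2 j.2 (mul_left_cancel₀ hq h))
  have hV := vand_ne_zero hinj
  have hX : altX q Δ x a b = 1 := by
    simp [altX, wedgeSum, DPoly.val_initial hΔ]
  have hdeg : IsHomPoly ((d + 1 + 1).choose 2)
      (joinVars fun (x : Fin 1 → ℂ) (a : Fin 0 → ℂ) (b : Fin (d + 1 + 1) → ℂ) =>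
        altB q Δ x a b) := by
    have := isHomPoly_altB (k := 0) (l := d + 1) hΔ (by omega)
    convert this using 1
    rw [Nat.choose_succ_left _ _ (by omega), Nat.choose_one_right]
    simp only [Nat.choose_zero_succ]
    omega
  have hzero : altB q Δ 0 a b₀ =
      κ d * (-1) ^ d * q⁻¹ ^ d * (1 - (q⁻¹ ^ 2) ^ d) * vand b₀ := by
    -- At the roots of unity all d + 2 terms are equal, each being the expected value divided by d +
    -- 2. By uniqueness Δ^{(1 d+1)} may be taken from the determinant.
    have hterm : ∀ m : Fin (d + 1 + 1),
        (-1 : ℂ) ^ (m : ℕ) * (vand (b₀ ∘ m.succAbove) * (b₀ m *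
          (∏ j : Fin 0, (b₀ m - a j * (q ^ 2)⁻¹)) *
            (Δ (0 + 1) (d + 1)).val 0 (Fin.snoc a (b₀ m)) (b₀ ∘ m.succAbove))) =
        ((d + 2 : ℕ) : ℂ)⁻¹ * (κ d * (-1) ^ d * q⁻¹ ^ d * (1 - (q⁻¹ ^ 2) ^ d) * vand b₀) := by
      intro m
      have h1 : (Fin.snoc a (b₀ m) : Fin 1 → ℂ) = fun _ => q * ω ^ (m : ℕ) := by
        funext i
        rw [show i = Fin.last 0 from Subsingleton.elim (α := Fin 1) _ _, Fin.snoc_last]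
      have h2 := deltaPoly_one_val_roots hq hd hω m κ
      have h3 := vand_succAbove b₀ m
      have h4 := prod_roots_sub (q := q) hω m
      have h5 : ((d + 2 : ℕ) : ℂ) ≠ 0 := by exact_mod_cast (by omega : d + 2 ≠ 0)
      rw [hΔ.val_one_eq hq (isDeltaFamily_deltaPoly hq κ) (by omega), h1,
        Finset.univ_eq_empty, Finset.prod_empty, mul_one]
      have h6 : b₀ m * (deltaPoly q κ 1 (d + 1)).val 0 (fun _ => q * ω ^ (m : ℕ))
          (b₀ ∘ m.succAbove) = -(q * κ d * (1 - (q⁻¹ ^ 2) ^ d) * (ω ^ (m : ℕ)) ^ (d + 1)) := h2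
      have h7 : ∏ i : Fin (d + 1), (b₀ (m.succAbove i) - b₀ m) =
          (-q) ^ (d + 1) * (((d + 1 : ℕ) + 1 : ℂ) * (ω ^ (m : ℕ)) ^ (d + 1)) := h4
      rw [h6, h3, h7]
      have h8 : (-q) ^ (d + 1) = -((-1) ^ d * q ^ d * q) := by
        rw [neg_pow, pow_succ, pow_succ]; ring
      have h9 : (-1 : ℂ) ^ d * (-1) ^ d = 1 := by rw [← mul_pow]; simp
      have h10 : q⁻¹ ^ d * q ^ d = 1 := by rw [← mul_pow, inv_mul_cancel₀ hq, one_pow]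
      have h11 : ((d + 1 : ℕ) + 1 : ℂ) = ((d + 2 : ℕ) : ℂ) := by push_cast; ring
      rw [h8, h11]
      rw [eq_inv_mul_iff_mul_eq₀ h5]
      set S := ((d + 2 : ℕ) : ℂ) * (-1) ^ (m : ℕ) * vand (b₀ ∘ m.succAbove) * q * κ d *
        (1 - (q⁻¹ ^ 2) ^ d) * (ω ^ (m : ℕ)) ^ (d + 1) with hS
      linear_combination S * (q⁻¹ ^ d * q ^ d) * h9 + S * h10
    rw [altB, wedgeSum, Finset.sum_congr rfl fun m _ => hterm m]
    have h5 : ((d + 2 : ℕ) : ℂ) ≠ 0 := by exact_mod_cast (by omega : d + 2 ≠ 0)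
    rw [Finset.sum_const, Finset.card_univ, Fintype.card_fin, nsmul_eq_mul,
      mul_inv_cancel_left₀ h5]
  -- The ratio to the Vandermonde product depends neither on x nor on b, so the value at 0 and b₀
  -- suffices.
  have h := mul_vand_eq_of_antisymm_of_degree hdeg (fun x a b i j hij hbb =>
    eq_zero_of_antisymm (F := fun b => altB q Δ x a b)
      (fun σ y => altB_perm_b hΔ (by omega) x a y σ) hij hbb) x 0 a a b b₀
  rw [hX, mul_one]
  apply mul_right_cancel₀ hV
  rw [h, hzero]
  ring

theorem altB_eq (hq : q ≠ 0) (hΔ : IsDeltaFamily q κ Δ) {d k l : ℕ} (hd : 0 < d)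
    (hl : l = k + 1 + d) (x : Fin (k + 1) → ℂ) (a : Fin k → ℂ) (b : Fin (l + 1) → ℂ) :
    altB q Δ x a b = κ d * (-1) ^ d * q⁻¹ ^ d * (1 - (q⁻¹ ^ 2) ^ d) *
      (vand b * altX q Δ x a b) :=
  altB_eq_of_base hq hΔ hd (altB_one hq hΔ hd) k l hl x a b

end FirstCase

end

section

/-! ### Integrals against antisymmetric kernels -/

open MeasureTheory

section MultiContour

variable {m : ℕ} {γ : ℝ → ℂ} {F G Ψ : (Fin m → ℂ) → ℂ}

theorem multiContour_congr
    (h : ∀ x : Fin m → ℂ, (∀ μ, x μ ∈ γ '' Set.Icc 0 1) → F x = G x) :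
    multiContour γ F = multiContour γ G := by
  refine setIntegral_congr_fun measurableSet_Icc fun t ht => ?_
  have : F (fun μ => γ (t μ)) = G (fun μ => γ (t μ)) :=
    h _ fun μ => ⟨t μ, ⟨ht.1 μ, ht.2 μ⟩, rfl⟩
  simp only [this]

theorem multiContour_const_mul (c : ℂ) :
    multiContour γ (fun x => c * F x) = c * multiContour γ F := by
  rw [multiContour, multiContour, ← integral_const_mul]
  simp only [mul_left_comm c]

theorem multiContour_comp_perm (σ : Equiv.Perm (Fin m)) :
    multiContour γ (fun x => F (x ∘ σ)) = multiContour γ F := by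
  have hmp := volume_measurePreserving_piCongrLeft (fun _ : Fin m => ℝ) σ⁻¹
  have happ : ∀ t : Fin m → ℝ,
      MeasurableEquiv.piCongrLeft (fun _ : Fin m => ℝ) σ⁻¹ t = t ∘ σ := by
    intro t
    funext i
    have : MeasurableEquiv.piCongrLeft (fun _ : Fin m => ℝ) σ⁻¹ t (σ⁻¹ (σ i)) = t (σ i) :=
      Equiv.piCongrLeft_apply_apply (fun _ : Fin m => ℝ) σ⁻¹ t (σ i)
    simpa using this
  have h := hmp.setIntegral_preimage_emb (MeasurableEquiv.measurableEmbedding _)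
    (fun t : Fin m → ℝ => (∏ μ, deriv γ (t μ) / (2 * (Real.pi : ℂ) * Complex.I)) *
      F (fun μ => γ (t μ))) (Set.Icc 0 1)
  have hset : (MeasurableEquiv.piCongrLeft (fun _ : Fin m => ℝ) σ⁻¹) ⁻¹' Set.Icc 0 1 =
      Set.Icc 0 1 := by
    ext t
    simp only [Set.mem_preimage, happ, Set.mem_Icc, Pi.le_def, Function.comp_apply, Pi.zero_apply,
      Pi.one_apply]
    exact ⟨fun h => ⟨fun i => by simpa using h.1 (σ.symm i), fun i => by simpa using h.2 (σ.symm i)⟩,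
      fun h => ⟨fun i => h.1 _, fun i => h.2 _⟩⟩
  rw [hset] at h
  rw [multiContour, multiContour, ← h]
  refine setIntegral_congr_fun measurableSet_Icc fun t _ => ?_
  simp only [happ, Function.comp_apply]
  rw [Equiv.prod_comp σ fun μ => deriv γ (t μ) / (2 * (Real.pi : ℂ) * Complex.I)]
  rfl

theorem multiContour_mul_comp_perm
    (hΨ : ∀ (σ : Equiv.Perm (Fin m)) (x : Fin m → ℂ), (∀ μ, x μ ∈ γ '' Set.Icc 0 1) →
      Ψ (x ∘ σ) = csign σ * Ψ x) (G : (Fin m → ℂ) → ℂ) (σ : Equiv.Perm (Fin m)) :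
    multiContour γ (fun x => Ψ x * G (x ∘ σ)) = csign σ * multiContour γ fun x => Ψ x * G x := by
  rw [← multiContour_comp_perm (F := fun x => Ψ x * G x) σ, ← multiContour_const_mul]
  refine multiContour_congr fun x hx => ?_
  rw [hΨ σ x hx, ← mul_assoc, ← mul_assoc, csign_mul_self, one_mul]

/-- The Lipschitz constant bounds `deriv γ` at interior points only; the open cube differs from the
closed one by a null set. -/
theorem integrableOn_prod_deriv {K : NNReal} (hγ : LipschitzOnWith K γ (Set.Icc 0 1)) :
    IntegrableOn (fun t : Fin m → ℝ => ∏ μ, deriv γ (t μ) / (2 * (Real.pi : ℂ) * Complex.I))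
      (Set.Icc 0 1) := by
  have hmeas : Measurable fun t : Fin m → ℝ =>
      ∏ μ, deriv γ (t μ) / (2 * (Real.pi : ℂ) * Complex.I) :=
    Finset.measurable_fun_prod _ fun μ _ =>
      ((measurable_deriv γ).comp (measurable_pi_apply μ)).div_const _
  have hae : (Set.univ.pi fun i : Fin m => Set.Ioo ((0 : Fin m → ℝ) i) ((1 : Fin m → ℝ) i))
      =ᵐ[volume] Set.Icc (0 : Fin m → ℝ) 1 := Measure.univ_pi_Ioo_ae_eq_Icc
  refine (integrableOn_congr_set_ae hae).1 ?_
  refine Measure.integrableOn_of_bounded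
    (M := ∏ _μ : Fin m, ((K : ℝ) / ‖(2 * (Real.pi : ℂ) * Complex.I)‖)) ?_
    hmeas.aestronglyMeasurable ?_
  · rw [measure_congr hae]
    exact isCompact_Icc.measure_lt_top.ne
  · refine (ae_restrict_iff' (MeasurableSet.univ_pi fun i => measurableSet_Ioo)).2
      (Filter.Eventually.of_forall fun t ht => ?_)
    rw [norm_prod]
    refine Finset.prod_le_prod (fun _ _ => norm_nonneg _) fun μ _ => ?_
    rw [norm_div]
    have hμ : t μ ∈ Set.Ioo (0 : ℝ) 1 := ht μ (Set.mem_univ μ)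
    exact div_le_div_of_nonneg_right
      (norm_deriv_le_of_lipschitzOn (Icc_mem_nhds hμ.1 hμ.2) hγ) (norm_nonneg _)

theorem multiContour_sum {K : NNReal} (hγ : LipschitzOnWith K γ (Set.Icc 0 1)) {ι : Type}
    (s : Finset ι) {f : ι → (Fin m → ℂ) → ℂ}
    (hf : ∀ i ∈ s, ContinuousOn (f i) {x | ∀ μ, x μ ∈ γ '' Set.Icc 0 1}) :
    multiContour γ (fun x => ∑ i ∈ s, f i x) = ∑ i ∈ s, multiContour γ (f i) := by
  simp only [multiContour, Finset.mul_sum]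
  refine integral_finsetSum s fun i hi => ?_
  have hc : ContinuousOn (fun t : Fin m → ℝ => f i fun μ => γ (t μ)) (Set.Icc 0 1) := by
    refine (hf i hi).comp ?_ fun t ht μ => ⟨t μ, ⟨ht.1 μ, ht.2 μ⟩, rfl⟩
    exact continuousOn_pi.2 fun μ => hγ.continuousOn.comp (continuous_apply μ).continuousOn
      fun t ht => ⟨ht.1 μ, ht.2 μ⟩
  exact (integrableOn_prod_deriv hγ).mul_continuousOn hc isCompact_Icc

/-- Antisymmetrising `G` multiplies the integral against an antisymmetric kernel by the number of
summands. -/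
theorem multiContour_mul_wedgeSum {k : ℕ} {Ψ : (Fin (k + 1) → ℂ) → ℂ} {K : NNReal}
    (hγ : LipschitzOnWith K γ (Set.Icc 0 1))
    (hΨc : ContinuousOn Ψ {x | ∀ μ, x μ ∈ γ '' Set.Icc 0 1})
    (hΨ : ∀ (σ : Equiv.Perm (Fin (k + 1))) (x : Fin (k + 1) → ℂ), (∀ μ, x μ ∈ γ '' Set.Icc 0 1) →
      Ψ (x ∘ σ) = csign σ * Ψ x) {G : ℂ → (Fin k → ℂ) → ℂ}
    (hG : Continuous fun x : Fin (k + 1) → ℂ => G (x 0) (Fin.tail x)) :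
    multiContour γ (fun x => Ψ x * ((-1) ^ k * wedgeSum G x)) =
      ((k + 1 : ℕ) : ℂ) * multiContour γ fun x => Ψ x * G (x (Fin.last k)) (Fin.init x) := by
  set H : (Fin (k + 1) → ℂ) → ℂ := fun x => G (x 0) (Fin.tail x) with hH
  have hcyc : ∀ (ν : Fin (k + 1)) (x : Fin (k + 1) → ℂ),
      G (x ν) (x ∘ ν.succAbove) = H (x ∘ ν.cycleRange.symm) := by
    intro ν x
    rw [← comp_cycleRange_symm_succ, hH]
    simp only [Function.comp_apply, Fin.cycleRange_symm_zero]
    rfl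
  have hint : ∀ ν : Fin (k + 1), multiContour γ (fun x => Ψ x * G (x ν) (x ∘ ν.succAbove)) =
      (-1) ^ (ν : ℕ) * multiContour γ fun x => Ψ x * H x := by
    intro ν
    simp only [hcyc]
    rw [multiContour_mul_comp_perm hΨ, csign_cycleRange_symm]
  -- Singling out the last variable instead of the first is a cycle of sign (-1)^k, matching the
  -- prefactor of the alternating sum.
  have hlast : multiContour γ (fun x => Ψ x * G (x (Fin.last k)) (Fin.init x)) =
      (-1) ^ k * multiContour γ fun x => Ψ x * H x := by
    have h := hint (Fin.last k)
    rw [Fin.val_last] at h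
    rw [← h]
    refine multiContour_congr fun x _ => ?_
    rw [Fin.succAbove_last]
    rfl
  have hsum : (fun x => Ψ x * ((-1) ^ k * wedgeSum G x)) = fun x => ∑ ν : Fin (k + 1),
      ((-1) ^ k * (-1) ^ (ν : ℕ)) * (Ψ x * G (x ν) (x ∘ ν.succAbove)) := by
    funext x
    rw [wedgeSum, Finset.mul_sum, Finset.mul_sum]
    exact Finset.sum_congr rfl fun ν _ => by ring
  rw [hsum, multiContour_sum hγ]
  · rw [hlast]
    simp only [multiContour_const_mul, hint]
    rw [Finset.sum_congr rfl (g := fun _ => (-1) ^ k * multiContour γ fun x => Ψ x * H x)]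
    · rw [Finset.sum_const, Finset.card_univ, Fintype.card_fin, nsmul_eq_mul]
    · intro ν _
      have hs : (-1 : ℂ) ^ (ν : ℕ) * (-1) ^ (ν : ℕ) = 1 := by rw [← mul_pow]; simp
      linear_combination ((-1) ^ k * multiContour γ fun x => Ψ x * H x) * hs
  · intro ν _
    refine continuousOn_const.mul (hΨc.mul ?_)
    simp only [hcyc]
    have : Continuous fun x : Fin (k + 1) → ℂ => x ∘ ν.cycleRange.symm :=
      continuous_pi fun i => continuous_apply _
    exact (hG.comp this).continuousOn

end MultiContour

end

/-! ### The action of `e_1` -/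

section Action

variable {q : ℂ} {Δ : (n l : ℕ) → DPoly n n l} {k l : ℕ} {κ : ℕ → ℂ}

/-- The polynomial `c ∑_ν (-1)^{k+ν} ∏_j (x_ν - a_j q⁻¹) Δ^{(k l+1)}(x̂_ν | a | b)`. -/
def altXPoly (q c : ℂ) (Δ : (n l : ℕ) → DPoly n n l) (k l : ℕ) : DPoly (k + 1) k (l + 1) :=
  MvPolynomial.C (c * (-1) ^ k) * ∑ ν : Fin (k + 1), MvPolynomial.C ((-1) ^ (ν : ℕ)) *
    ((∏ j, (MvPolynomial.X (Sum.inl ν) -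
        MvPolynomial.X (Sum.inr (Sum.inl j)) * MvPolynomial.C q⁻¹)) *
      MvPolynomial.rename (Sum.elim (Sum.inl ∘ ν.succAbove) Sum.inr) (Δ k (l + 1)))

theorem altXPoly_val (q c : ℂ) (Δ : (n l : ℕ) → DPoly n n l) (x : Fin (k + 1) → ℂ) (a : Fin k → ℂ)
    (b : Fin (l + 1) → ℂ) : (altXPoly q c Δ k l).val x a b = c * altX q Δ x a b := by
  have h : ∀ ν : Fin (k + 1), (Sum.elim x (Sum.elim a b) ∘
      Sum.elim (Sum.inl ∘ ν.succAbove) Sum.inr : Fin k ⊕ Fin k ⊕ Fin (l + 1) → ℂ) =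
        Sum.elim (x ∘ ν.succAbove) (Sum.elim a b) := by
    intro ν
    funext i
    rcases i with i | i <;> rfl
  rw [DPoly.val, altXPoly, altX, wedgeSum, map_mul, MvPolynomial.eval_C, map_sum, mul_assoc]
  congr 2
  refine Finset.sum_congr rfl fun ν _ => ?_
  rw [map_mul, map_mul, MvPolynomial.eval_C, map_prod, MvPolynomial.eval_rename, h]
  simp only [map_sub, map_mul, MvPolynomial.eval_X, MvPolynomial.eval_C, Sum.elim_inl,
    Sum.elim_inr]
  rfl

/-- By `vand_succAbove`, V(b) ∏_i (b_i - b_m)⁻¹ = (-1)^m V(b̂_m), so the sum with denominators is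
`altB` divided by V(b). -/
theorem sum_eq_altX (hq : q ≠ 0) (hΔ : IsDeltaFamily q κ Δ) {d : ℕ} (hd : 0 < d)
    (hl : l = k + 1 + d) (x : Fin (k + 1) → ℂ) (a : Fin k → ℂ) {b : Fin (l + 1) → ℂ}
    (hb : Function.Injective b) :
    ∑ m, b m * (∏ j, (b m - a j * (q ^ 2)⁻¹)) * (∏ i, (b (m.succAbove i) - b m)⁻¹) *
        (Δ (k + 1) l).val x (Fin.snoc a (b m)) (b ∘ m.succAbove) =
      κ d * (-1) ^ d * q⁻¹ ^ d * (1 - (q⁻¹ ^ 2) ^ d) * altX q Δ x a b := by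
  apply mul_left_cancel₀ (vand_ne_zero hb)
  rw [mul_left_comm, ← altB_eq hq hΔ hd hl, altB, wedgeSum, Finset.mul_sum]
  refine Finset.sum_congr rfl fun m _ => ?_
  have h : (∏ i, (b (m.succAbove i) - b m)) ≠ 0 := Finset.prod_ne_zero_iff.2 fun i _ =>
    sub_ne_zero.2 fun h => Fin.succAbove_ne m i (hb h)
  rw [vand_succAbove b m, Finset.prod_inv_distrib]
  field_simp

theorem isBracket_e1Act {N d : ℕ} (hq : q ≠ 0) (hq2 : q ^ 2 ≠ 1) (hΔ : IsDeltaFamily q κ Δ)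
    (hd : 0 < d) (hl : l = k + 1 + d) {hN : k + 1 + l = N} (hN' : k + (l + 1) = N)
    {w : (Fin (k + 1) → ℂ) → (Fin N → ℂ) → Tens N} (hw : IsBracket q hN (Δ (k + 1) l).val w) :
    IsBracket q hN' (fun x a b => q ^ (2 * l) * q⁻¹ ^ k *
      (κ d * (-1) ^ d * q⁻¹ ^ d * (1 - (q⁻¹ ^ 2) ^ d)) * altX q Δ x a b)
      (fun x ζ => e1Act q ζ (w x ζ)) where
  weight x ζ hζ ε hε := e1Act_weight (hw.weight x ζ hζ) hε
  extreme x ζ hζ := by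
    have hb : Function.Injective (tailPart hN' (sq ζ)) := by
      intro i j h
      by_contra hij
      exact (hζ.2 _ _ (by simpa [Fin.ext_iff] using hij)).1 h
    rw [hw.e1Act_extreme hq hq2 hN'
        (fun x a b σ => hΔ.symm_right _ _ (by omega) σ x a b) x hζ rfl rfl,
      sum_eq_altX hq hΔ hd hl x _ hb]
    ring
  Rsymm x ζ hζ i j hij := by
    have hne : j ≠ i := by rintro rfl; omega
    exact e1Act_exchange hq hij (hζ.1 j) (hζ.2 j i hne).2 (hw.Rsymm x ζ hζ i j hij)

theorem congAt_altX {N : ℕ} (hN' : k + (l + 1) = N) (c : ℂ) {C : (Fin N → ℂ) → ℝ → ℂ}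
    {Ψ : (Fin (k + 1) → ℂ) → (Fin N → ℂ) → ℂ} {ζ : Fin N → ℂ} (h : IsKernelAt C Ψ ζ) :
    CongAt C Ψ ζ (fun x z => c * altX q Δ x (headPart hN' z) (tailPart hN' z))
      (fun x z => ((k + 1 : ℕ) : ℂ) * c * ((∏ j, (x (Fin.last k) - headPart hN' z j * q⁻¹)) *
        (Δ k (l + 1)).val (Fin.init x) (headPart hN' z) (tailPart hN' z))) := by
  obtain ⟨K, hK⟩ := h.closedCurve.2
  set a := headPart hN' (sq ζ) with ha
  set b := tailPart hN' (sq ζ) with hb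
  have hcont : Continuous fun x : Fin (k + 1) → ℂ =>
      (∏ j, (x 0 - a j * q⁻¹)) * (Δ k (l + 1)).val (Fin.tail x) a b := by
    refine Continuous.mul (by fun_prop) ?_
    refine (MvPolynomial.continuous_eval (Δ k (l + 1))).comp ?_
    refine continuous_pi fun i => ?_
    rcases i with i | i
    · exact continuous_apply (i.succ : Fin (k + 1))
    · exact continuous_const
  have key := multiContour_mul_wedgeSum (Ψ := fun x => Ψ x ζ) hK h.continuousOn h.antisymm
    (G := fun s y => (∏ j, (s - a j * q⁻¹)) * (Δ k (l + 1)).val y a b) hcont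
  have e1 : (fun x => Ψ x ζ * (c * altX q Δ x a b)) = fun x => c * (Ψ x ζ * ((-1) ^ k *
      wedgeSum (fun s y => (∏ j, (s - a j * q⁻¹)) * (Δ k (l + 1)).val y a b) x)) := by
    funext x
    rw [altX, mul_left_comm]
  have e2 : (fun x => Ψ x ζ * (((k + 1 : ℕ) : ℂ) * c * ((∏ j, (x (Fin.last k) - a j * q⁻¹)) *
      (Δ k (l + 1)).val (Fin.init x) a b))) = fun x => (((k + 1 : ℕ) : ℂ) * c) * (Ψ x ζ *
        ((∏ j, (x (Fin.last k) - a j * q⁻¹)) * (Δ k (l + 1)).val (Fin.init x) a b)) := by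
    funext x
    rw [mul_left_comm]
  show multiContour (C (sq ζ)) (fun x => Ψ x ζ * (c * altX q Δ x a b)) =
    multiContour (C (sq ζ)) (fun x => Ψ x ζ * (((k + 1 : ℕ) : ℂ) * c *
      ((∏ j, (x (Fin.last k) - a j * q⁻¹)) * (Δ k (l + 1)).val (Fin.init x) a b)))
  rw [e1, e2, multiContour_const_mul, multiContour_const_mul, key]
  ring

end Action

end XXZ

end

/-- Here `n = k + 1`, `N = n + l`; `D` is the polynomial `Δ^{(1)}_{(n-1 l+1)}`. -/
theorem mainTheorem3 (q : ℝ) (hq : -1 < q) (hq0 : q < 0) (κ : ℕ → ℂ) :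
    (∃ Δ, XXZ.IsDeltaFamily (q : ℂ) κ Δ) ∧
    ∀ Δ, XXZ.IsDeltaFamily (q : ℂ) κ Δ →
      ∀ (k l N : ℕ) (_ : k + 1 < l) (hN : k + 1 + l = N) (hN' : k + (l + 1) = N),
        (∃ w, XXZ.IsBracket (q : ℂ) hN (Δ (k + 1) l).val w) ∧
        ∀ w, XXZ.IsBracket (q : ℂ) hN (Δ (k + 1) l).val w →
          ∃ D : XXZ.DPoly (k + 1) k (l + 1),
            XXZ.IsBracket (q : ℂ) hN' D.val (fun x ζ => XXZ.e1Act (q : ℂ) ζ (w x ζ)) ∧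
            ∀ (C : (Fin N → ℂ) → ℝ → ℂ) (Ψ : (Fin (k + 1) → ℂ) → (Fin N → ℂ) → ℂ)
              (ζ : Fin N → ℂ), XXZ.IsKernelAt C Ψ ζ →
              XXZ.CongAt C Ψ ζ
                (fun x z => D.val x (XXZ.headPart hN' z) (XXZ.tailPart hN' z))
                (fun x z =>
                  ((k + 1 : ℕ) : ℂ) * κ (l - (k + 1)) * (-1) ^ (l - (k + 1)) * (q : ℂ) ^ (l + 1)
                    * (1 - ((q : ℂ) ^ (2 * (l - (k + 1))))⁻¹)
                    * (∏ j, (x (Fin.last k) - XXZ.headPart hN' z j * (q : ℂ)⁻¹))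
                    * (Δ k (l + 1)).val (Fin.init x) (XXZ.headPart hN' z)
                        (XXZ.tailPart hN' z)) := by
  have hq' : (q : ℂ) ≠ 0 := by exact_mod_cast hq0.ne
  have hq2 : (q : ℂ) ^ 2 ≠ 1 := by
    have : q ^ 2 ≠ 1 := by nlinarith
    exact_mod_cast this
  refine ⟨⟨_, XXZ.isDeltaFamily_deltaPoly hq' κ⟩, fun Δ hΔ k l N hkl hN hN' => ⟨?_, fun w hw => ?_⟩⟩
  · exact XXZ.exists_isBracket hq' hN
      (fun x a b σ => hΔ.symm_left _ _ hkl σ x a b) (fun x a b σ => hΔ.symm_right _ _ hkl σ x a b)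
  obtain ⟨d, hd, hl⟩ : ∃ d, 0 < d ∧ l = k + 1 + d := ⟨l - (k + 1), by omega, by omega⟩
  set c : ℂ := (q : ℂ) ^ (2 * l) * (q : ℂ)⁻¹ ^ k *
    (κ d * (-1) ^ d * (q : ℂ)⁻¹ ^ d * (1 - ((q : ℂ)⁻¹ ^ 2) ^ d)) with hc
  have hcd : c = κ (l - (k + 1)) * (-1) ^ (l - (k + 1)) * (q : ℂ) ^ (l + 1) *
      (1 - ((q : ℂ) ^ (2 * (l - (k + 1))))⁻¹) := by
    have h1 : l - (k + 1) = d := by omega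
    -- This turns q^{2l} q^{-k} q^{-d} into q^{l+1}.
    have h2 : 2 * l = l + 1 + k + d := by omega
    have h3 : (q : ℂ) ^ k * (q : ℂ)⁻¹ ^ k = 1 := by rw [← mul_pow, mul_inv_cancel₀ hq', one_pow]
    have h4 : (q : ℂ) ^ d * (q : ℂ)⁻¹ ^ d = 1 := by rw [← mul_pow, mul_inv_cancel₀ hq', one_pow]
    rw [hc, h1, h2, ← inv_pow, ← pow_mul, pow_add, pow_add]
    set E := (q : ℂ) ^ (l + 1) * (κ d * (-1) ^ d * (1 - (q : ℂ)⁻¹ ^ (2 * d)))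
    linear_combination E * ((q : ℂ) ^ d * (q : ℂ)⁻¹ ^ d) * h3 + E * h4
  have hD : (XXZ.altXPoly (q : ℂ) c Δ k l).val =
      fun x a b => c * XXZ.altX (q : ℂ) Δ x a b := by
    funext x a b
    exact XXZ.altXPoly_val _ _ _ _ _ _
  refine ⟨XXZ.altXPoly q c Δ k l, ?_, fun C Ψ ζ hΨ => ?_⟩
  · rw [hD]
    exact XXZ.isBracket_e1Act hq' hq2 hΔ hd hl hN' hw
  · rw [hD]
    have h := XXZ.congAt_altX (q := (q : ℂ)) (Δ := Δ) hN' c hΨ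
    rw [hcd] at h ⊢
    simpa only [mul_assoc] using h
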